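/- **Setting.** Let $d\ge 0$, let $\mathcal P$ be the set of (nonempty) convex polytopes in $\mathbb R^d$ with the Borel $\sigma$-algebra of the Hausdorff metric, $\mathcal B$ the Borel sets of $\mathbb R^d$ and $\lambda$ Lebesgue measure; write $A^x=A+x$. A *local extension* of $\varphi:\mathcal P\to\mathbb R$ is a map $\Phi:\mathcal P\times\mathcal B\to\mathbb R$ such that $\Phi(\cdot,A)$ is measurable for every $A$, $\Phi(P,\cdot)$ is a finite signed measure for every $P$, $\varphi(P)=\Phi(P,\mathbb R^d)$, $\Phi(P+x,A+x)=\Phi(P,A)$, and $\Phi(P,A)=\Phi(Q,A)$ whenever $P\cap U=Q\cap U$ and $A\subset U$ for some open $U$. For a polytope $P$ let $\mathcal F_m(P)$ be the set of its $m$-dimensional faces ($P$ itself counts as a face). For $F\in\mathcal F_m(P)$ let $\lambda_F$ be the $m$-dimensional Lebesgue measure restricted to $F$, and let $n(P,F)$ be the intersection of the normal cone of $P$ at $F$ with the unit sphere. For faces $F_i$ of polytopes $P_i$, $i=1,\dots,k$, let $n(P_1,\dots,P_k;F_1,\dots,F_k)$ be the intersection of the unit sphere with the normal cone of $\bigcap_i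 P_i^{x_i}$ at $\bigcap_i F_i^{x_i}$, where $x_1,\dots,x_k$ are chosen such that the relative interiors of $F_1^{x_1},\dots,F_k^{x_k}$ have a common point (the result does not depend on this choice). If $\sum_i\dim F_i\ge (k-1)d$, let $[F_1,\dots,F_k]$ be the volume of the parallelepiped spanned by the union of orthonormal bases of the orthogonal complements of the direction spaces of $F_1,\dots,F_k$. Put $\Psi(\emptyset,\cdot)=0$ for every measure-valued functional $\Psi$ on $\mathcal P$. **Theorem 5.1.** Let $\Phi$ be a local extension of $\varphi:\mathcal P\to\mathbb R$. Then $\Phi$ has a unique decomposition $\Phi=\sum_{j=0}^d\Phi^{(j)}$ into maps $P\mapsto\Phi^{(j)}(P,\cdot)$ with values in the finite signed Borel measures such that $\Phi^{(j)}(\alpha P,\alpha A)=\alpha^j\Phi^{(j)}(P,A)$ for all $\alpha>0$, $P\in\mathcal P$, $A\in\mathcal B$, and $\Phi^{(d)}(P,A)=c_d\,\lambda(P\cap A)$ with a constant $c_d$; and there are functions $f_0,\dots,f_d$ of the sets $n(P,F)$ ($P\in\mathcal P$, $F\in\mathcal F_j(P)$ for $f_j$), uniquely determined there, with $$\Phi^{(j)}(P,\cdot)=\sum_{F\in\mathcal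 F_j(P)}f_j(n(P,F))\,\lambda_F ,\qquad j=0,\dots,d .$$ For every $j\in\{0,\dots,d\}$ the following holds. (a) For $P,Q\in\mathcal P$ and $A,B\in\mathcal B$, the function $x\mapsto\Phi^{(j)}(P\cap Q^x,A\cap B^x)$ is integrable and $$\int_{\mathbb R^d}\Phi^{(j)}(P\cap Q^x,A\cap B^x)\,\lambda(dx)=\sum_{m=j}^d\Phi^{(j)}_{m,d-m+j}(P,Q;A\times B)$$ with the finite signed measures on $\mathbb R^d\times\mathbb R^d$ $$\Phi^{(j)}_{m,d-m+j}(P,Q;\cdot)=\sum_{F\in\mathcal F_m(P)}\ \sum_{G\in\mathcal F_{d-m+j}(Q)}f_j(n(P,Q;F,G))\,[F,G]\,\lambda_F\otimes\lambda_G .$$ In particular, $\Phi^{(j)}_{j,d}(P,Q;A\times B)=\Phi^{(j)}(P,A)\,\lambda(Q\cap B)$ and $\Phi^{(j)}_{d,j}(P,Q;A\times B)=\lambda(P\cap A)\,\Phi^{(j)}(Q,B)$. (b) For $k\ge2$, $P_1,\dots,P_k\in\mathcal P$ and $A_1,\dots,A_k\in\mathcal B$, the integrand below is integrable and $$\int_{(\mathbb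 R^d)^{k-1}}\Phi^{(j)}(P_1\cap P_2^{x_2}\cap\dots\cap P_k^{x_k},\,A_1\cap A_2^{x_2}\cap\dots\cap A_k^{x_k})\,\lambda^{k-1}(d(x_2,\dots,x_k))=\sum_{\substack{m_1,\dots,m_k=j\\ m_1+\dots+m_k=(k-1)d+j}}^{d}\Phi^{(j)}_{m_1,\dots,m_k}(P_1,\dots,P_k;A_1\times\dots\times A_k)$$ with the finite signed measures on $(\mathbb R^d)^k$ $$\Phi^{(j)}_{m_1,\dots,m_k}(P_1,\dots,P_k;\cdot)=\sum_{F_1\in\mathcal F_{m_1}(P_1)}\cdots\sum_{F_k\in\mathcal F_{m_k}(P_k)}f_j(n(P_1,\dots,P_k;F_1,\dots,F_k))\,[F_1,\dots,F_k]\,\lambda_{F_1}\otimes\dots\otimes\lambda_{F_k}.$$ (c) For $k\ge 2$ and $(m_1,\dots,m_k)$ as in (b), $\Phi^{(j)}_{m_1,\dots,m_k}(P_1,\dots,P_k;\cdot)$ is homogeneous of degree $m_i$ in $P_i$, $i=1,\dots,k$: replacing $P_i$ by $\alpha P_i$ and a Borel set $S\subset(\mathbb R^d)^k$ by its image under $(z_1,\dots,z_k)\mapsto(z_1,\dots,\alpha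 z_i,\dots,z_k)$ multiplies the value by $\alpha^{m_i}$, for every $\alpha>0$. -/

import Mathlib

open Set MeasureTheory TopologicalSpace
open scoped RealInnerProductSpace

noncomputable section

namespace LocalFunctional

/-- The Euclidean space `ℝ^d`. -/
abbrev Space (d : ℕ) : Type := EuclideanSpace ℝ (Fin d)

variable {d : ℕ}

/-! ### Polytopes and their faces -/

/-- A convex polytope: a nonempty compact set that is the convex hull of finitely many points. -/
def Polytope (d : ℕ) : Type :=
  {K : NonemptyCompacts (Space d) //
    ∃ S : Finset (Space d), (K : Set (Space d)) = convexHull ℝ (S : Set (Space d))}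

namespace Polytope

/-- The topology of the Hausdorff metric. -/
instance : TopologicalSpace (Polytope d) :=
  inferInstanceAs (TopologicalSpace {K : NonemptyCompacts (Space d) //
    ∃ S : Finset (Space d), (K : Set (Space d)) = convexHull ℝ (S : Set (Space d))})

/-- The point set of a polytope. -/
def carrier (P : Polytope d) : Set (Space d) := (P.1 : Set (Space d))

instance : CoeOut (Polytope d) (Set (Space d)) := ⟨carrier⟩

/-- The translate `P + x`. -/
def translate (P : Polytope d) (x : Space d) : Polytope d :=
  ⟨P.1.map (fun y => y + x) (by fun_prop), by
    classical
    obtain ⟨S, hS⟩ := P.2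
    refine ⟨S.image (fun y => y + x), ?_⟩
    rw [NonemptyCompacts.coe_map, hS, Finset.coe_image]
    exact (AffineMap.id ℝ (Space d) + AffineMap.const ℝ (Space d) x).image_convexHull _⟩

/-- The dilate `α P`. -/
def dilate (α : ℝ) (P : Polytope d) : Polytope d :=
  ⟨P.1.map (fun y => α • y) (by fun_prop), by
    classical
    obtain ⟨S, hS⟩ := P.2
    refine ⟨S.image (fun y => α • y), ?_⟩
    rw [NonemptyCompacts.coe_map, hS, Finset.coe_image]
    exact (α • LinearMap.id : Space d →ₗ[ℝ] Space d).image_convexHull _⟩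

theorem isCompact (P : Polytope d) : IsCompact (P : Set (Space d)) := P.1.isCompact

end Polytope

/-- The `m`-dimensional faces of a polytope `P` (nonempty, with `P` itself being a face of `P`). -/
def Face (P : Polytope d) (m : ℕ) : Type :=
  {F : Set (Space d) // F.Nonempty ∧ IsExposed ℝ (P : Set (Space d)) F ∧
    Module.finrank ℝ (vectorSpan ℝ F) = m}

namespace Face

variable {P : Polytope d} {m : ℕ}

/-- The point set of a face. -/
def carrier (F : Face P m) : Set (Space d) := F.1

instance : CoeOut (Face P m) (Set (Space d)) := ⟨carrier⟩

theorem isCompact (F : Face P m) : IsCompact (F : Set (Space d)) :=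
  F.2.2.1.isCompact P.isCompact

/-- A polytope has only finitely many faces. -/
instance : Finite (Face P m) := by
  obtain ⟨S, hS⟩ := P.2
  have hS' : (P : Set (Space d)) = convexHull ℝ (S : Set (Space d)) := hS
  have hconv : Convex ℝ (P : Set (Space d)) := hS' ▸ convex_convexHull ℝ _
  let g : Face P m → Set S := fun F => {s | (s : Space d) ∈ (F : Set (Space d)).extremePoints ℝ}
  refine Finite.of_injective g fun F G hFG => Subtype.ext ?_
  have key : ∀ H : Face P m, (H : Set (Space d)).extremePoints ℝ =
      (fun s : S => (s : Space d)) '' g H := by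
    intro H
    ext z
    constructor
    · intro hz
      have h1 : z ∈ (P : Set (Space d)).extremePoints ℝ :=
        H.2.2.1.isExtreme.extremePoints_subset_extremePoints hz
      rw [hS'] at h1
      exact ⟨⟨z, extremePoints_convexHull_subset h1⟩, hz, rfl⟩
    · rintro ⟨s, hs, rfl⟩
      exact hs
  have hF := closure_convexHull_extremePoints F.isCompact (F.2.2.1.convex hconv)
  have hG := closure_convexHull_extremePoints G.isCompact (G.2.2.1.convex hconv)
  rw [key F, hFG, ← key G, hG] at hF
  exact hF.symm

instance : Fintype (Face P m) := Fintype.ofFinite _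

/-- `λ_F`: the `m`-dimensional Lebesgue measure in the affine hull of the `m`-face `F`,
restricted to `F`. -/
def measure (F : Face P m) : Measure (Space d) :=
  (Measure.euclideanHausdorffMeasure m).restrict (F : Set (Space d))

instance (F : Face P m) : IsFiniteMeasure F.measure := by
  refine ⟨?_⟩
  obtain ⟨p, hp⟩ := F.2.1
  have hp' : p ∈ (F : Set (Space d)) := hp
  let f : vectorSpan ℝ (F : Set (Space d)) → Space d := fun v => (v : Space d) + p
  have hf : Isometry f := (isometry_add_right p).comp isometry_subtype_coe
  have himg : f '' (f ⁻¹' (F : Set (Space d))) = (F : Set (Space d)) := by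
    rw [image_preimage_eq_iff]
    intro y hy
    exact ⟨⟨y - p, vsub_mem_vectorSpan ℝ hy hp'⟩, by simp [f]⟩
  have hK : IsCompact (f ⁻¹' (F : Set (Space d))) :=
    hf.isClosedEmbedding.isCompact_preimage F.isCompact
  have hm : Module.finrank ℝ (vectorSpan ℝ (F : Set (Space d))) = m := F.2.2.2
  have e : (Measure.euclideanHausdorffMeasure m : Measure (vectorSpan ℝ (F : Set (Space d)))) =
      volume := by
    rw [← InnerProductSpace.euclideanHausdorffMeasure_eq_volume, hm]
  rw [measure, Measure.restrict_apply_univ, ← himg, hf.euclideanHausdorffMeasure_image, e]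
  exact hK.measure_lt_top

end Face

/-! ### Local functionals and their homogeneous parts -/

/-- `Φ` is a local extension of `φ`: a measurable kernel of finite signed Borel measures on `ℝ^d`
that is translation covariant and locally determined and has total mass `φ`. -/
structure IsLocalExtension (φ : Polytope d → ℝ) (Φ : Polytope d → SignedMeasure (Space d)) :
    Prop where
  measurable : ∀ A : Set (Space d), MeasurableSet A →
    @Measurable _ _ (borel (Polytope d)) _ (fun P => Φ P A)
  total : ∀ P, φ P = Φ P univ
  translate : ∀ (P : Polytope d) (A : Set (Space d)) (x : Space d), MeasurableSet A →
    Φ (P.translate x) ((fun y => y + x) '' A) = Φ P A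
  locally_determined : ∀ (P Q : Polytope d) (A U : Set (Space d)), MeasurableSet A → IsOpen U →
    (P : Set (Space d)) ∩ U = (Q : Set (Space d)) ∩ U → A ⊆ U → Φ P A = Φ Q A

/-- A measure-valued functional on polytopes is homogeneous of degree `j`. -/
def IsHomogeneous (j : ℕ) (Ψ : Polytope d → SignedMeasure (Space d)) : Prop :=
  ∀ (α : ℝ) (P : Polytope d) (A : Set (Space d)), 0 < α → MeasurableSet A →
    Ψ (P.dilate α) ((fun y => α • y) '' A) = α ^ j * Ψ P A

/-- `Φh 0, …, Φh d` are the homogeneous parts of `Φ`: `Φh j` is homogeneous of degree `j`, their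
sum is `Φ`, and the part of degree `d` is a constant multiple of the volume. -/
structure IsHomogeneousDecomposition (Φ : Polytope d → SignedMeasure (Space d))
    (Φh : ℕ → Polytope d → SignedMeasure (Space d)) : Prop where
  homogeneous : ∀ j ≤ d, IsHomogeneous j (Φh j)
  sum_eq : ∀ P, Φ P = ∑ j ∈ Finset.range (d + 1), Φh j P
  top : ∃ c : ℝ, ∀ (P : Polytope d) (A : Set (Space d)), MeasurableSet A →
    Φh d P A = c * volume.real ((P : Set (Space d)) ∩ A)

/-- The normal cone of `K` at its face `F`: all `u` such that every point of `F` maximizes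
`⟪u, ·⟫` over `K`. -/
def normalCone (K F : Set (Space d)) : Set (Space d) :=
  {u | ∀ x ∈ F, ∀ y ∈ K, ⟪u, y⟫ ≤ ⟪u, x⟫}

/-- `n(K, F)`: the intersection of the normal cone with the unit sphere. -/
def sphericalNormals (K F : Set (Space d)) : Set (Space d) :=
  normalCone K F ∩ Metric.sphere 0 1

/-- `f 0, …, f d` are the associated functions of the homogeneous parts `Φh 0, …, Φh d`. Only
their values at the spherical polytopes `n(P, F)`, `F` a `j`-face of `P`, are relevant; for
`j = d` this is the constant `f d ∅`. -/
def IsAssociated (Φh : ℕ → Polytope d → SignedMeasure (Space d))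
    (f : ℕ → Set (Space d) → ℝ) : Prop :=
  ∀ j ≤ d, ∀ P : Polytope d,
    Φh j P = ∑ F : Face P j, f j (sphericalNormals P F) • F.measure.toSignedMeasure

/-! ### Mixed measures -/

/-- `n(K_1, …, K_k; F_1, …, F_k)`: the spherical normals of `⋂ (K_i + x_i)` at `⋂ (F_i + x_i)`,
where the `x_i` are such that the relative interiors of the sets `F_i + x_i` have a common point.
For polytopes `K_i` and faces `F_i` this does not depend on the choice of the `x_i`. -/
def mixedSphericalNormals {ι : Type*} (K F : ι → Set (Space d)) : Set (Space d) :=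
  {u | ∃ x : ι → Space d,
    (⋂ i, (fun y => y + x i) '' intrinsicInterior ℝ (F i)).Nonempty ∧
    u ∈ sphericalNormals (⋂ i, (fun y => y + x i) '' K i) (⋂ i, (fun y => y + x i) '' F i)}

/-- `[L_1, …, L_k]` for subspaces with `∑ dim L_i ≤ d`: the volume of the parallelepiped spanned by
the union of orthonormal bases of the `L_i`, as the square root of the Gram determinant. -/
def subspaceDet {ι : Type*} [Fintype ι] [DecidableEq ι] (L : ι → Submodule ℝ (Space d)) : ℝ :=
  √(Matrix.gram ℝ (fun p : (i : ι) × Fin (Module.finrank ℝ (L i)) =>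
    (stdOrthonormalBasis ℝ (L p.1) p.2 : Space d))).det

/-- `[F_1, …, F_k]` for sets with `∑ dim F_i ≥ (k - 1) d`: the determinant of the orthogonal
complements of the direction spaces. -/
def faceDet {ι : Type*} [Fintype ι] [DecidableEq ι] (F : ι → Set (Space d)) : ℝ :=
  subspaceDet (fun i => (vectorSpan ℝ (F i))ᗮ)

/-- The mixed measure `∑_{F, G} f(n(P, Q; F, G)) [F, G] λ_F ⊗ λ_G` on `ℝ^d × ℝ^d`, summed over the
`m`-faces `F` of `P` and the `m'`-faces `G` of `Q`. -/
def mixedMeasureTwo (f : Set (Space d) → ℝ) (m m' : ℕ) (P Q : Polytope d) :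
    SignedMeasure (Space d × Space d) :=
  ∑ F : Face P m, ∑ G : Face Q m',
    (f (mixedSphericalNormals ![(P : Set (Space d)), Q] ![(F : Set (Space d)), G]) *
      faceDet ![(F : Set (Space d)), G]) • (F.measure.prod G.measure).toSignedMeasure

/-- The mixed measure
`∑ f(n(P_1, …, P_k; F_1, …, F_k)) [F_1, …, F_k] λ_{F_1} ⊗ ⋯ ⊗ λ_{F_k}` on `(ℝ^d)^k`, summed over
all tuples of `m_i`-faces `F_i` of `P_i`. -/
def mixedMeasure (f : Set (Space d) → ℝ) {k : ℕ} (m : Fin k → ℕ) (P : Fin k → Polytope d) :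
    SignedMeasure (Fin k → Space d) :=
  ∑ F : (i : Fin k) → Face (P i) (m i),
    (f (mixedSphericalNormals (fun i => (P i : Set (Space d))) (fun i => (F i : Set (Space d)))) *
      faceDet (fun i => (F i : Set (Space d)))) •
      (Measure.pi (fun i => (F i).measure)).toSignedMeasure

open Classical in
/-- The value of `Ψ` at a set: `Ψ P` if the set is a polytope `P`, and `0` otherwise (in
particular for the empty set). -/
def evalSet (Ψ : Polytope d → SignedMeasure (Space d)) (K : Set (Space d)) :
    SignedMeasure (Space d) :=
  if h : ∃ P : Polytope d, (P : Set (Space d)) = K then Ψ h.choose else 0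

/-- `K_1 ∩ (K_2 + x_2) ∩ ⋯ ∩ (K_{n+1} + x_{n+1})`. -/
def interTranslates {n : ℕ} (K : Fin (n + 1) → Set (Space d)) (x : Fin n → Space d) :
    Set (Space d) :=
  K 0 ∩ ⋂ i : Fin n, (fun y => y + x i) '' K i.succ

/-- The tuples `(m_1, …, m_k)` with `j ≤ m_i ≤ d` and `m_1 + ⋯ + m_k = (k - 1) d + j`. -/
def degreeTuples (d k j : ℕ) : Finset (Fin k → ℕ) :=
  (Fintype.piFinset fun _ => Finset.Icc j d).filter fun m => ∑ i, m i = (k - 1) * d + j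

end LocalFunctional

end

open LocalFunctional

/-! Everything rests on the cone of feasible directions `dirCone`. Near a point p, a polyhedral set
coincides with p plus this cone, and the cone is constant on the relative interior of each face F.
By locality and translation covariance, Φ(P, ·) is therefore invariant under translations along F
within the relative interior of F. A finite signed measure with this invariance is a multiple of λ_F
(`SignedMeasure.mul_eq_mul_of_translation_invariant`, a double counting by Tonelli). Off P the same
argument gives a multiple of Lebesgue measure, which must vanish because Φ(P, ·) is finite
(`eq_zero_of_disjoint`). The relative interiors of the faces partition P, so Φ(P, ·) is a
combination of the measures λ_F. The feasible cone is the polar of n(P, F), hence the coefficient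
depends on n(P, F) only (`faceDensity_eq`). Grouping faces by dimension gives the homogeneous parts,
since a dilation by α multiplies λ_F by α^j and fixes n(P, F). The parts are unique as coefficients
of a polynomial in α, the functions f_j by evaluation on relative interiors.

For the integral formulas, a linear relation between the normals of faces F_i confines the
translations for which the translated faces meet to a hyperplane
(`ae_not_exists_of_not_linearIndependent`). So for almost all translations, faces that meet have
independent normal spaces. The faces of the intersection are then the intersections of translated
faces whose relative interiors meet; a codimension count gives their dimension, and their normals do
not depend on the translations (`evalSet_interTranslates`).

It remains to integrate the j-dimensional measure of an intersection of translates of sets B_i in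
the F_i. Each B_i is thickened by a unit cube in its normal space. For the thickened sets, Tonelli
gives the product of the volumes. The coarea formula for the inner products with all normal vectors,
with Jacobian [F_1, …, F_k], slices their intersection into fibres, whose integrals over the
translations all agree (`lintegral_measure_iInter_translate_of_subset`). -/

noncomputable section

namespace LocalFunctional

open Filter Topology Module

section

/-! ### Polyhedral sets -/

/-- Fourier-Motzkin elimination: a finitely generated cone is a finite intersection of
half-spaces. -/
theorem exists_dual_of_span {V : Type*} [AddCommGroup V] [Module ℝ V] [FiniteDimensional ℝ V]
    (s : Finset V) : ∃ t : Finset (V →ₗ[ℝ] ℝ), ∀ x,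
      x ∈ Submodule.span NNReal (s : Set V) ↔ ∀ l ∈ t, l x ≤ 0 := by
  classical
  induction s using Finset.induction_on with
  | empty =>
    let b := Module.finBasis ℝ V
    refine ⟨Finset.univ.image b.coord ∪ Finset.univ.image (fun i => -b.coord i), fun x => ?_⟩
    simp only [Finset.coe_empty, Submodule.span_empty, Submodule.mem_bot]
    constructor
    · rintro rfl l -
      simp
    · intro h
      refine b.ext_elem fun i => ?_
      have h1 := h (b.coord i) (by simp)
      have h2 := h (-b.coord i) (by simp)
      simp at h1 h2
      simpa using le_antisymm h1 h2
  | insert a s _ ih =>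
    obtain ⟨t, ht⟩ := ih
    -- A point x is in the new cone iff some c ≥ 0 satisfies l x ≤ c * l a for all l in t.
    -- Functionals positive at a bound c from below, negative ones from above. The filter keeps 0
    -- below every upper bound and the products keep every lower bound below every upper one.
    refine ⟨t.filter (fun l => l a ≤ 0) ∪
      ((t.filter (fun l => 0 < l a)) ×ˢ (t.filter (fun l => l a < 0))).image
        (fun p => p.1 a • p.2 - p.2 a • p.1), fun x => ?_⟩
    rw [Finset.coe_insert, Submodule.mem_span_insert]
    constructor
    · rintro ⟨c, z, hz, rfl⟩ l hl
      rw [ht] at hz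
      rcases Finset.mem_union.1 hl with hl | hl
      · rw [Finset.mem_filter] at hl
        have := hz l hl.1
        have h2 : (c : ℝ) * l a ≤ 0 := mul_nonpos_of_nonneg_of_nonpos c.2 hl.2
        simp only [map_add, NNReal.smul_def, map_smul, smul_eq_mul]
        linarith
      · obtain ⟨⟨l1, l2⟩, hp, rfl⟩ := Finset.mem_image.1 hl
        simp only [Finset.mem_product, Finset.mem_filter] at hp
        have h1 := hz l1 hp.1.1
        have h2 := hz l2 hp.2.1
        simp only [map_add, NNReal.smul_def, map_smul, smul_eq_mul, LinearMap.sub_apply,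
          LinearMap.smul_apply]
        have := mul_nonpos_of_nonneg_of_nonpos hp.1.2.le h2
        have := mul_nonneg_of_nonpos_of_nonpos hp.2.2.le h1
        linarith
    · intro h
      -- The coefficient of a will be the largest lower bound, 0 included.
      set S : Finset ℝ := insert 0 ((t.filter (fun l => 0 < l a)).image (fun l => l x / l a))
        with hS
      have hne : S.Nonempty := ⟨0, by simp [hS]⟩
      have h0 : 0 ≤ S.max' hne := Finset.le_max' _ _ (by simp [hS])
      have hp : ∀ l ∈ t, 0 < l a → l x / l a ≤ S.max' hne := fun l hl hla =>
        Finset.le_max' _ _ (by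
          rw [hS]
          exact Finset.mem_insert_of_mem (Finset.mem_image.2 ⟨l, by simp [hl, hla], rfl⟩))
      have hn : ∀ l ∈ t, l a < 0 → S.max' hne * l a ≥ l x := by
        intro l hl hla
        have hmem := S.max'_mem hne
        generalize S.max' hne = M at hmem
        rw [hS, Finset.mem_insert, Finset.mem_image] at hmem
        rcases hmem with h1 | ⟨m, hm, h1⟩
        · rw [h1, zero_mul]
          exact h l (Finset.mem_union_left _ (by simp [hl, hla.le]))
        · rw [← h1]
          simp only [Finset.mem_filter] at hm
          have := h (m a • l - l a • m) (Finset.mem_union_right _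
            (Finset.mem_image.2 ⟨(m, l), by simp [hl, hla, hm], rfl⟩))
          simp only [LinearMap.sub_apply, LinearMap.smul_apply, smul_eq_mul] at this
          rw [ge_iff_le, div_mul_eq_mul_div, le_div_iff₀ hm.2]
          linarith
      obtain ⟨c, hc⟩ : ∃ c : NNReal, (c : ℝ) = S.max' hne := ⟨⟨_, h0⟩, rfl⟩
      refine ⟨c, x - S.max' hne • a, (ht _).2 fun l hl => ?_, ?_⟩
      · simp only [map_sub, map_smul, smul_eq_mul]
        rcases lt_trichotomy (l a) 0 with h1 | h1 | h1
        · linarith [hn l hl h1]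
        · have := h l (Finset.mem_union_left _ (by simp [hl, h1]))
          simp [h1, this]
        · have := hp l hl h1
          rw [div_le_iff₀ h1] at this
          linarith
      · rw [NNReal.smul_def, hc]
        simp

variable {E : Type*} [NormedAddCommGroup E] [InnerProductSpace ℝ E]

/-- A set is polyhedral if it is a finite intersection of half-spaces. -/
def IsPolyhedral (K : Set E) : Prop :=
  ∃ s : Finset (E × ℝ), K = {x | ∀ a ∈ s, ⟪a.1, x⟫ ≤ a.2}

/-- Homogenization: x lies in the hull of S iff (x, 1) lies in the cone generated by the points (s,
1). The dual functionals of that cone, read at height 1, are affine inequalities for x. -/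
theorem isPolyhedral_convexHull [FiniteDimensional ℝ E] (S : Finset E) :
    IsPolyhedral (convexHull ℝ (S : Set E)) := by
  classical
  obtain ⟨t, ht⟩ := exists_dual_of_span (S.image (fun s => (s, (1 : ℝ))))
  let g : ((E × ℝ) →ₗ[ℝ] ℝ) → E × ℝ := fun l =>
    ((InnerProductSpace.toDual ℝ E).symm
      (LinearMap.toContinuousLinearMap (l ∘ₗ LinearMap.inl ℝ E ℝ)), -l (0, 1))
  have hg : ∀ l x, l (x, 1) = ⟪(g l).1, x⟫ - (g l).2 := by
    intro l x
    have : (x, (1 : ℝ)) = (x, 0) + (0, 1) := by simp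
    rw [this, map_add]
    simp [g]
  refine ⟨t.image g, ?_⟩
  ext x
  have h1 : x ∈ convexHull ℝ (S : Set E) ↔
      (x, (1 : ℝ)) ∈ Submodule.span NNReal ((S.image (fun s => (s, (1 : ℝ))) : Finset (E × ℝ)) :
        Set (E × ℝ)) := by
    rw [Finset.mem_convexHull', Finset.coe_image, Submodule.mem_span_image_finset_iff_exists_fun']
    constructor
    · rintro ⟨w, hw, hw1, hwx⟩
      refine ⟨fun y => (w y).toNNReal, ?_⟩
      have : ∀ y ∈ S, (w y).toNNReal • (y, (1 : ℝ)) = (w y • y, w y) := fun y hy => by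
        rw [NNReal.smul_def, Real.coe_toNNReal _ (hw y hy)]
        simp
      rw [Finset.sum_congr rfl this, Prod.ext_iff, Prod.fst_sum, Prod.snd_sum]
      exact ⟨hwx, hw1⟩
    · rintro ⟨c, hc⟩
      rw [Prod.ext_iff, Prod.fst_sum, Prod.snd_sum] at hc
      simp only [NNReal.smul_def, Prod.smul_mk, smul_eq_mul, mul_one] at hc
      exact ⟨fun y => c y, fun y _ => (c y).2, hc.2, hc.1⟩
  rw [h1, ht]
  simp only [hg, mem_ofPred_eq, Finset.mem_image, forall_exists_index, and_imp,
    forall_apply_eq_imp_iff₂, sub_nonpos]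

end

/-! ### Feasible directions and minimal faces -/

section

variable {E : Type*} [NormedAddCommGroup E] [InnerProductSpace ℝ E]

/-- The cone of feasible directions of `K` at `p`. -/
def dirCone (K : Set E) (p : E) : Set E := {v | ∀ᶠ t : ℝ in 𝓝[>] 0, p + t • v ∈ K}

/-- The lineality space of the cone of feasible directions of `K` at `p`. -/
def lineality (K : Set E) (p : E) : Submodule ℝ E :=
  Submodule.span ℝ {v | v ∈ dirCone K p ∧ -v ∈ dirCone K p}

/-- The smallest face of a polyhedral set `K` containing the point `p`. -/
def minFace (K : Set E) (p : E) : Set E := {x | x ∈ K ∧ x - p ∈ lineality K p}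

/-- Nonempty exposed faces. -/
def IsFace (K F : Set E) : Prop := F.Nonempty ∧ IsExposed ℝ K F

theorem mem_dirCone {K : Set E} {p v : E} :
    v ∈ dirCone K p ↔ ∀ᶠ t : ℝ in 𝓝[>] 0, p + t • v ∈ K := Iff.rfl

theorem mem_minFace {K : Set E} {p x : E} : x ∈ minFace K p ↔ x ∈ K ∧ x - p ∈ lineality K p :=
  Iff.rfl

theorem tendsto_smul_nhdsGT_zero (v : E) : Tendsto (fun t : ℝ => t • v) (𝓝[>] 0) (𝓝 0) := by
  have : Tendsto (fun t : ℝ => t • v) (𝓝 0) (𝓝 ((0 : ℝ) • v)) :=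
    (continuous_id.smul continuous_const).tendsto 0
  rw [zero_smul] at this
  exact this.mono_left nhdsWithin_le_nhds

/-! #### Computations in terms of a system of linear inequalities -/

section halfspaces

variable {s : Finset (E × ℝ)} {p : E}

/-- Inequalities that are strict at p remain strict nearby, so only the active ones restrict small
displacements. -/
theorem eventually_mem_halfspaces_iff (hp : p ∈ {x : E | ∀ a ∈ s, ⟪a.1, x⟫ ≤ a.2}) :
    ∀ᶠ v in 𝓝 (0 : E), (p + v ∈ {x : E | ∀ a ∈ s, ⟪a.1, x⟫ ≤ a.2} ↔
      ∀ a ∈ s, ⟪a.1, p⟫ = a.2 → ⟪a.1, v⟫ ≤ 0) := by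
  have h : ∀ᶠ v in 𝓝 (0 : E), ∀ a ∈ s, ⟪a.1, p⟫ ≠ a.2 → ⟪a.1, p + v⟫ < a.2 := by
    rw [Filter.eventually_all_finset]
    intro a ha
    by_cases hap : ⟪a.1, p⟫ = a.2
    · simp [hap]
    · have h1 : ⟪a.1, p + 0⟫ < a.2 := by
        rw [add_zero]
        exact lt_of_le_of_ne (hp a ha) hap
      have h2 : Continuous fun v => ⟪a.1, p + v⟫ := by fun_prop
      exact (h2.tendsto 0 |>.eventually_lt_const h1).mono fun v hv _ => hv
  filter_upwards [h] with v hv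
  constructor
  · intro h1 a ha hap
    have := h1 a ha
    rw [inner_add_right, hap] at this
    linarith
  · intro h1 a ha
    by_cases hap : ⟪a.1, p⟫ = a.2
    · rw [inner_add_right, hap]
      linarith [h1 a ha hap]
    · exact (hv a ha hap).le

theorem mem_dirCone_halfspaces (hp : p ∈ {x : E | ∀ a ∈ s, ⟪a.1, x⟫ ≤ a.2}) {v : E} :
    v ∈ dirCone {x : E | ∀ a ∈ s, ⟪a.1, x⟫ ≤ a.2} p ↔
      ∀ a ∈ s, ⟪a.1, p⟫ = a.2 → ⟪a.1, v⟫ ≤ 0 := by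
  have h1 := (tendsto_smul_nhdsGT_zero v).eventually (eventually_mem_halfspaces_iff hp)
  have h2 : ∀ᶠ t : ℝ in 𝓝[>] 0, (p + t • v ∈ {x : E | ∀ a ∈ s, ⟪a.1, x⟫ ≤ a.2} ↔
      ∀ a ∈ s, ⟪a.1, p⟫ = a.2 → ⟪a.1, v⟫ ≤ 0) := by
    filter_upwards [h1, self_mem_nhdsWithin] with t ht ht0
    rw [ht]
    refine forall_congr' fun a => forall_congr' fun _ => forall_congr' fun _ => ?_
    rw [inner_smul_right, mul_nonpos_iff_pos_imp_nonpos]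
    have : (0 : ℝ) < t := ht0
    constructor
    · exact fun h => h.1 this
    · exact fun h => ⟨fun _ => h, fun h' => this.le⟩
  rw [mem_dirCone, eventually_congr h2]
  simp

theorem mem_lineality_halfspaces (hp : p ∈ {x : E | ∀ a ∈ s, ⟪a.1, x⟫ ≤ a.2}) {v : E} :
    v ∈ lineality {x : E | ∀ a ∈ s, ⟪a.1, x⟫ ≤ a.2} p ↔
      ∀ a ∈ s, ⟪a.1, p⟫ = a.2 → ⟪a.1, v⟫ = 0 := by
  constructor
  · intro h a ha hap
    induction h using Submodule.span_induction with
    | mem x hx =>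
      have h1 := (mem_dirCone_halfspaces hp).1 hx.1 a ha hap
      have h2 := (mem_dirCone_halfspaces hp).1 hx.2 a ha hap
      rw [inner_neg_right] at h2
      linarith
    | zero => simp
    | add x y _ _ hx hy => rw [inner_add_right, hx, hy, add_zero]
    | smul c x _ hx => rw [inner_smul_right, hx, mul_zero]
  · intro h
    refine Submodule.subset_span ⟨(mem_dirCone_halfspaces hp).2 fun a ha hap => (h a ha hap).le,
      (mem_dirCone_halfspaces hp).2 fun a ha hap => ?_⟩
    rw [inner_neg_right, h a ha hap, neg_zero]

end halfspaces

/-! #### Polyhedral sets and their faces -/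

namespace IsPolyhedral

variable {K : Set E} {p : E}

theorem convex (hK : IsPolyhedral K) : Convex ℝ K := by
  obtain ⟨s, rfl⟩ := hK
  intro x hx y hy a b ha hb hab c hc
  rw [inner_add_right, inner_smul_right, inner_smul_right]
  calc a * ⟪c.1, x⟫ + b * ⟪c.1, y⟫ ≤ a * c.2 + b * c.2 := by
        gcongr
        · exact hx c hc
        · exact hy c hc
    _ = c.2 := by rw [← add_mul, hab, one_mul]

theorem isClosed (hK : IsPolyhedral K) : IsClosed K := by
  obtain ⟨s, rfl⟩ := hK
  simp only [ofPred_forall]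
  exact isClosed_biInter fun a _ => isClosed_le (by fun_prop) continuous_const

/-- This form no longer mentions a system of inequalities, so two polytopes can be compared locally
through their cones alone. -/
theorem eventually_mem_iff (hK : IsPolyhedral K) (hp : p ∈ K) :
    ∀ᶠ v in 𝓝 (0 : E), (p + v ∈ K ↔ v ∈ dirCone K p) := by
  obtain ⟨s, rfl⟩ := hK
  filter_upwards [eventually_mem_halfspaces_iff hp] with v hv
  rw [hv, mem_dirCone_halfspaces hp]

/-- In the polyhedral case the vectors feasible in both directions already form a subspace, so the
span in `lineality` adds nothing. -/
theorem mem_lineality_iff (hK : IsPolyhedral K) (hp : p ∈ K) {v : E} :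
    v ∈ lineality K p ↔ v ∈ dirCone K p ∧ -v ∈ dirCone K p := by
  refine ⟨fun h => ?_, fun h => Submodule.subset_span h⟩
  obtain ⟨s, rfl⟩ := hK
  rw [mem_lineality_halfspaces hp] at h
  rw [mem_dirCone_halfspaces hp, mem_dirCone_halfspaces hp]
  exact ⟨fun a ha hap => (h a ha hap).le, fun a ha hap => by
    rw [inner_neg_right, h a ha hap, neg_zero]⟩

theorem sub_mem_dirCone (hK : IsPolyhedral K) (hp : p ∈ K) {x : E} (hx : x ∈ K) :
    x - p ∈ dirCone K p := by
  obtain ⟨s, rfl⟩ := hK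
  rw [mem_dirCone_halfspaces hp]
  intro a ha hap
  rw [inner_sub_right, hap]
  linarith [hx a ha]

theorem self_mem_minFace (hp : p ∈ K) : p ∈ minFace K p := ⟨hp, by simp⟩

/-- The sum of the active normals exposes it: on K each summand is at most its value at p, so the
sum is maximal only where all active inequalities are equalities. -/
theorem isFace_minFace (hK : IsPolyhedral K) (hp : p ∈ K) : IsFace K (minFace K p) := by
  classical
  refine ⟨⟨p, self_mem_minFace hp⟩, fun _ => ?_⟩
  obtain ⟨s, rfl⟩ := hK
  refine ⟨∑ a ∈ s.filter (fun a => ⟪a.1, p⟫ = a.2), innerSL ℝ a.1, ?_⟩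
  have key : ∀ x, (∑ a ∈ s.filter (fun a => ⟪a.1, p⟫ = a.2), innerSL ℝ a.1) x =
      ∑ a ∈ s.filter (fun a => ⟪a.1, p⟫ = a.2), ⟪a.1, x⟫ := fun x => by
    simp
  have hmax : ∀ y ∈ {x : E | ∀ a ∈ s, ⟪a.1, x⟫ ≤ a.2}, ∀ a ∈ s.filter (fun a => ⟪a.1, p⟫ = a.2),
      ⟪a.1, y⟫ ≤ ⟪a.1, p⟫ := by
    intro y hy a ha
    rw [Finset.mem_filter] at ha
    rw [ha.2]
    exact hy a ha.1
  ext x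
  simp only [mem_minFace, mem_lineality_halfspaces hp, key]
  constructor
  · rintro ⟨hx, h⟩
    refine ⟨hx, fun y hy => Finset.sum_le_sum fun a ha => (hmax y hy a ha).trans ?_⟩
    rw [Finset.mem_filter] at ha
    have := h a ha.1 ha.2
    rw [inner_sub_right] at this
    linarith
  · rintro ⟨hx, h⟩
    refine ⟨hx, fun a ha hap => ?_⟩
    have h1 := (Finset.sum_eq_sum_iff_of_le (hmax x hx)).1
      (le_antisymm (Finset.sum_le_sum (hmax x hx)) (h p hp)) a (by simp [ha, hap])
    rw [inner_sub_right, h1, sub_self]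

theorem eventually_mem_minFace (hK : IsPolyhedral K) (hp : p ∈ K) :
    ∀ᶠ v in 𝓝 (0 : E), v ∈ lineality K p → p + v ∈ minFace K p := by
  filter_upwards [hK.eventually_mem_iff hp] with v hv hvl
  exact ⟨hv.2 ((hK.mem_lineality_iff hp).1 hvl).1, by simpa using hvl⟩

theorem vectorSpan_minFace (hK : IsPolyhedral K) (hp : p ∈ K) :
    vectorSpan ℝ (minFace K p) = lineality K p := by
  refine le_antisymm ?_ fun v hv => ?_
  · rw [vectorSpan_def, Submodule.span_le]
    rintro _ ⟨x, hx, y, hy, rfl⟩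
    have := sub_mem hx.2 hy.2
    simpa using this
  · have h := (tendsto_smul_nhdsGT_zero v).eventually (hK.eventually_mem_minFace hp)
    obtain ⟨t, ht, ht0⟩ := (h.and self_mem_nhdsWithin).exists
    have ht0' : (0 : ℝ) < t := ht0
    have h1 := vsub_mem_vectorSpan ℝ (ht (Submodule.smul_mem _ _ hv)) (self_mem_minFace hp)
    have h2 := Submodule.smul_mem _ t⁻¹ h1
    simpa [smul_smul, ht0'.ne'] using h2

end IsPolyhedral

/-! ### Relative interiors and faces -/

theorem mem_intrinsicInterior_iff_eventually {F : Set E} {q : E} :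
    q ∈ intrinsicInterior ℝ F ↔
      q ∈ F ∧ ∀ᶠ v in 𝓝 (0 : E), v ∈ vectorSpan ℝ F → q + v ∈ F := by
  have key : ∀ hq : q ∈ F, ((∀ᶠ v in 𝓝 (0 : E), v ∈ vectorSpan ℝ F → q + v ∈ F) ↔
      F ∈ 𝓝[affineSpan ℝ F] q) := by
    intro hq
    change _ ↔ ∀ᶠ x in 𝓝[affineSpan ℝ F] q, x ∈ F
    rw [eventually_nhdsWithin_iff, ← map_add_left_nhds_zero q, eventually_map]
    refine eventually_congr (Eventually.of_forall fun v => ?_)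
    have : q + v ∈ affineSpan ℝ F ↔ v ∈ vectorSpan ℝ F := by
      rw [← direction_affineSpan, add_comm]
      exact AffineSubspace.vadd_mem_iff_mem_direction v (mem_affineSpan ℝ hq)
    rw [SetLike.mem_coe, this]
  constructor
  · intro h
    have hq := intrinsicInterior_subset h
    refine ⟨hq, (key hq).2 ?_⟩
    obtain ⟨y, hy, rfl⟩ := mem_intrinsicInterior.1 h
    exact preimage_coe_mem_nhds_subtype.1 (mem_interior_iff_mem_nhds.1 hy)
  · rintro ⟨hq, h⟩
    exact mem_intrinsicInterior.2 ⟨⟨q, mem_affineSpan ℝ hq⟩,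
      mem_interior_iff_mem_nhds.2 (preimage_coe_mem_nhds_subtype.2 ((key hq).1 h)), rfl⟩

theorem IsPolyhedral.mem_intrinsicInterior_minFace {K : Set E} {p : E} (hK : IsPolyhedral K)
    (hp : p ∈ K) : p ∈ intrinsicInterior ℝ (minFace K p) := by
  rw [mem_intrinsicInterior_iff_eventually, hK.vectorSpan_minFace hp]
  exact ⟨IsPolyhedral.self_mem_minFace hp, hK.eventually_mem_minFace hp⟩

theorem exists_add_smul_mem_of_mem_intrinsicInterior {F : Set E} {p x : E}
    (hp : p ∈ intrinsicInterior ℝ F) (hx : x ∈ F) : ∃ t : ℝ, 0 < t ∧ p + t • (p - x) ∈ F := by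
  have h := (mem_intrinsicInterior_iff_eventually.1 hp).2
  have h' := (tendsto_smul_nhdsGT_zero (p - x)).eventually h
  obtain ⟨t, ht, ht0⟩ := (h'.and self_mem_nhdsWithin).exists
  exact ⟨t, ht0, ht (Submodule.smul_mem _ _
    (vsub_mem_vectorSpan ℝ (intrinsicInterior_subset hp) hx))⟩

theorem mem_openSegment_extension {p x : E} {t : ℝ} (ht : 0 < t) :
    p ∈ openSegment ℝ x (p + t • (p - x)) := by
  refine ⟨t / (1 + t), 1 / (1 + t), by positivity, by positivity, by field_simp; ring, ?_⟩
  have : (1 + t) ≠ 0 := by positivity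
  rw [smul_add, smul_smul, smul_sub, ← sub_eq_zero]
  have h2 : (1 / (1 + t) : ℝ) = 1 - t / (1 + t) := by field_simp; ring
  have h3 : (1 / (1 + t) * t : ℝ) = t / (1 + t) := by ring
  rw [h3, h2]
  module

namespace IsFace

variable {K F F' : Set E} {p q : E}

theorem subset (hF : IsFace K F) : F ⊆ K := hF.2.subset

/-- Prolonging the segment from x in F beyond the relatively interior point p puts p in an open
segment of K with endpoint x, and F' is extreme. -/
theorem subset_of_mem (hF : IsFace K F) (hF' : IsFace K F') (hp : p ∈ intrinsicInterior ℝ F)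
    (hp' : p ∈ F') : F ⊆ F' := by
  intro x hx
  obtain ⟨t, ht, h⟩ := exists_add_smul_mem_of_mem_intrinsicInterior hp hx
  exact hF'.2.isExtreme.left_mem_of_mem_openSegment (hF.subset hx) (hF.subset h) hp'
    (mem_openSegment_extension ht)

theorem eq_of_mem (hF : IsFace K F) (hF' : IsFace K F') (hp : p ∈ intrinsicInterior ℝ F)
    (hp' : p ∈ intrinsicInterior ℝ F') : F = F' :=
  (hF.subset_of_mem hF' hp (intrinsicInterior_subset hp')).antisymm
    (hF'.subset_of_mem hF hp' (intrinsicInterior_subset hp))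

theorem mem (hF : IsFace K F) (hp : p ∈ intrinsicInterior ℝ F) : p ∈ K :=
  hF.subset (intrinsicInterior_subset hp)

theorem eq_minFace (hK : IsPolyhedral K) (hF : IsFace K F) (hp : p ∈ intrinsicInterior ℝ F) :
    F = minFace K p :=
  hF.eq_of_mem (hK.isFace_minFace (hF.mem hp)) hp (hK.mem_intrinsicInterior_minFace (hF.mem hp))

theorem vectorSpan_eq (hK : IsPolyhedral K) (hF : IsFace K F) (hp : p ∈ intrinsicInterior ℝ F) :
    vectorSpan ℝ F = lineality K p := by
  conv_lhs => rw [hF.eq_minFace hK hp]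
  exact hK.vectorSpan_minFace (hF.mem hp)

/-- Prolong the segment from p to q up to a point of F. The homothety centred there that takes p to
q maps K into K by convexity, and it maps feasible displacements at p to feasible displacements at
q. -/
theorem dirCone_subset (hK : IsPolyhedral K) (hF : IsFace K F) (hp : p ∈ F)
    (hq : q ∈ intrinsicInterior ℝ F) : dirCone K p ⊆ dirCone K q := by
  obtain ⟨t, ht, h⟩ := exists_add_smul_mem_of_mem_intrinsicInterior hq hp
  intro v hv
  -- The homothety has ratio t / (1 + t), so a displacement of length r at q comes from one longer
  -- by the inverse factor at p.
  have hc : Tendsto (fun r : ℝ => r * ((1 + t) / t)) (𝓝[>] 0) (𝓝[>] 0) := by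
    refine tendsto_nhdsWithin_of_tendsto_nhds_of_eventually_within _ ?_ ?_
    · have : Tendsto (fun r : ℝ => r * ((1 + t) / t)) (𝓝 0) (𝓝 (0 * ((1 + t) / t))) :=
        (continuous_id.mul continuous_const).tendsto 0
      rw [zero_mul] at this
      exact this.mono_left nhdsWithin_le_nhds
    · filter_upwards [self_mem_nhdsWithin] with r hr
      have : (0 : ℝ) < r := hr
      simp only [mem_Ioi]
      positivity
  filter_upwards [hc.eventually (mem_dirCone.1 hv)] with r hr
  have h1 := hK.convex hr (hF.subset h) (a := t / (1 + t)) (b := 1 / (1 + t)) (by positivity)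
    (by positivity) (by field_simp; ring)
  have h0 : (1 + t) ≠ 0 := by positivity
  convert h1 using 1
  have h2 : (1 / (1 + t) : ℝ) = 1 - t / (1 + t) := by field_simp; ring
  have h3 : t / (1 + t) * (r * ((1 + t) / t)) = r := by field_simp
  have h4 : (1 - t / (1 + t)) * t = t / (1 + t) := by field_simp; ring
  rw [h2, smul_add, smul_add, smul_smul, smul_smul, h3, h4]
  module

theorem dirCone_eq (hK : IsPolyhedral K) (hF : IsFace K F) (hp : p ∈ intrinsicInterior ℝ F)
    (hq : q ∈ intrinsicInterior ℝ F) : dirCone K p = dirCone K q :=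
  (hF.dirCone_subset hK (intrinsicInterior_subset hp) hq).antisymm
    (hF.dirCone_subset hK (intrinsicInterior_subset hq) hp)

theorem convex (hK : IsPolyhedral K) (hF : IsFace K F) : Convex ℝ F := hF.2.convex hK.convex

theorem exists_mem_intrinsicInterior [FiniteDimensional ℝ E] (hK : IsPolyhedral K)
    (hF : IsFace K F) : ∃ p, p ∈ intrinsicInterior ℝ F :=
  Set.Nonempty.intrinsicInterior (hF.convex hK) hF.1

end IsFace

end

section

section

variable {E : Type*} [NormedAddCommGroup E] [InnerProductSpace ℝ E]

/-! #### Intersections and translates of polyhedral sets -/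

theorem image_add_right_eq_setOf {E : Type*} [AddGroup E] (K : Set E) (x : E) :
    (fun y => y + x) '' K = {z | z - x ∈ K} := by
  ext z
  constructor
  · rintro ⟨y, hy, rfl⟩
    simpa using hy
  · intro hz
    exact ⟨z - x, hz, by simp⟩

theorem mem_image_add_right {E : Type*} [AddGroup E] {K : Set E} {x z : E} :
    z ∈ (fun y => y + x) '' K ↔ z - x ∈ K := by
  rw [image_add_right_eq_setOf]
  rfl

theorem IsPolyhedral.iInter {ι : Type*} [Finite ι] {K : ι → Set E}
    (hK : ∀ i, IsPolyhedral (K i)) : IsPolyhedral (⋂ i, K i) := by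
  classical
  have := Fintype.ofFinite ι
  choose s hs using hK
  refine ⟨Finset.univ.biUnion s, ?_⟩
  ext x
  simp only [hs, mem_iInter, mem_ofPred_eq, Finset.mem_biUnion, Finset.mem_univ, true_and]
  exact ⟨fun h a ⟨i, hi⟩ => h i a hi, fun h i a hi => h a ⟨i, hi⟩⟩

theorem IsPolyhedral.translate {K : Set E} (hK : IsPolyhedral K) (x : E) :
    IsPolyhedral ((fun y => y + x) '' K) := by
  classical
  obtain ⟨s, rfl⟩ := hK
  refine ⟨s.image fun a => (a.1, a.2 + ⟪a.1, x⟫), ?_⟩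
  ext z
  rw [mem_image_add_right]
  simp only [mem_ofPred_eq, Finset.forall_mem_image, inner_sub_right, sub_le_iff_le_add]

theorem dirCone_iInter {ι : Type*} [Finite ι] (K : ι → Set E) (p : E) :
    dirCone (⋂ i, K i) p = ⋂ i, dirCone (K i) p := by
  ext v
  simp only [mem_dirCone, mem_iInter, eventually_all]

theorem dirCone_translate (K : Set E) (x p : E) :
    dirCone ((fun y => y + x) '' K) p = dirCone K (p - x) := by
  ext v
  simp only [mem_dirCone, mem_image_add_right, add_sub_right_comm]

theorem lineality_translate (K : Set E) (x p : E) :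
    lineality ((fun y => y + x) '' K) p = lineality K (p - x) := by
  rw [lineality, lineality, dirCone_translate]

/-- Feasibility in an intersection of finitely many sets is feasibility in each, and membership in
`lineality` is two-sided feasibility. -/
theorem mem_lineality_iInter {ι : Type*} [Finite ι] {K : ι → Set E}
    (hK : ∀ i, IsPolyhedral (K i)) {p : E} (hp : ∀ i, p ∈ K i) {v : E} :
    v ∈ lineality (⋂ i, K i) p ↔ ∀ i, v ∈ lineality (K i) p := by
  rw [(IsPolyhedral.iInter hK).mem_lineality_iff (mem_iInter.2 hp), dirCone_iInter]
  rw [mem_iInter, mem_iInter, ← forall_and]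
  exact forall_congr' fun i => ((hK i).mem_lineality_iff (hp i)).symm

theorem minFace_iInter {ι : Type*} [Finite ι] [Nonempty ι] {K : ι → Set E}
    (hK : ∀ i, IsPolyhedral (K i)) {p : E} (hp : ∀ i, p ∈ K i) :
    minFace (⋂ i, K i) p = ⋂ i, minFace (K i) p := by
  ext x
  simp only [mem_minFace, mem_lineality_iInter hK hp, mem_iInter, forall_and]

theorem intrinsicInterior_translate (K : Set E) (x : E) :
    intrinsicInterior ℝ ((fun y => y + x) '' K) = (fun y => y + x) '' intrinsicInterior ℝ K := by
  have h := AffineIsometry.intrinsicInterior_image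
    (AffineIsometryEquiv.constVAdd ℝ E x).toAffineIsometry K
  have h2 : ((AffineIsometryEquiv.constVAdd ℝ E x).toAffineIsometry : E → E) =
      fun y => y + x := by
    ext y
    simp [add_comm]
  rwa [h2] at h

theorem vectorSpan_translate (K : Set E) (x : E) :
    vectorSpan ℝ ((fun y => y + x) '' K) = vectorSpan ℝ K := by
  rw [vectorSpan_def, vectorSpan_def]
  congr 1
  ext v
  simp only [Set.mem_vsub, exists_mem_image, vsub_eq_sub, add_sub_add_right_eq_sub]

theorem IsFace.translate {K F : Set E} (hK : IsPolyhedral K) (hF : IsFace K F) {p : E}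
    (hp : p ∈ intrinsicInterior ℝ F) (x : E) :
    IsFace ((fun y => y + x) '' K) ((fun y => y + x) '' F) := by
  have h : (fun y => y + x) '' F = minFace ((fun y => y + x) '' K) (p + x) := by
    ext z
    rw [mem_minFace, mem_image_add_right, mem_image_add_right, lineality_translate,
      add_sub_cancel_right, hF.eq_minFace hK hp, mem_minFace, sub_sub, add_comm x p]
  rw [h]
  exact (hK.translate x).isFace_minFace (mem_image_of_mem _ (hF.mem hp))

theorem iInter_eq_minFace {ι : Type*} [Finite ι] [Nonempty ι] {K F : ι → Set E}
    (hK : ∀ i, IsPolyhedral (K i)) (hF : ∀ i, IsFace (K i) (F i)) {p : E}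
    (hp : ∀ i, p ∈ intrinsicInterior ℝ (F i)) : ⋂ i, F i = minFace (⋂ i, K i) p := by
  rw [minFace_iInter hK fun i => (hF i).mem (hp i)]
  exact iInter_congr fun i => (hF i).eq_minFace (hK i) (hp i)

theorem isFace_iInter {ι : Type*} [Finite ι] [Nonempty ι] {K F : ι → Set E}
    (hK : ∀ i, IsPolyhedral (K i)) (hF : ∀ i, IsFace (K i) (F i)) {p : E}
    (hp : ∀ i, p ∈ intrinsicInterior ℝ (F i)) : IsFace (⋂ i, K i) (⋂ i, F i) := by
  rw [iInter_eq_minFace hK hF hp]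
  exact (IsPolyhedral.iInter hK).isFace_minFace (mem_iInter.2 fun i => (hF i).mem (hp i))

theorem mem_intrinsicInterior_iInter {ι : Type*} [Finite ι] [Nonempty ι] {K F : ι → Set E}
    (hK : ∀ i, IsPolyhedral (K i)) (hF : ∀ i, IsFace (K i) (F i)) {p : E}
    (hp : ∀ i, p ∈ intrinsicInterior ℝ (F i)) : p ∈ intrinsicInterior ℝ (⋂ i, F i) := by
  rw [iInter_eq_minFace hK hF hp]
  exact (IsPolyhedral.iInter hK).mem_intrinsicInterior_minFace
    (mem_iInter.2 fun i => (hF i).mem (hp i))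

/-- If the relative interiors of faces of polyhedral sets meet, their intersection is the relative
interior of the intersection of the faces. -/
theorem intrinsicInterior_iInter {ι : Type*} [Finite ι] [Nonempty ι] {K F : ι → Set E}
    (hK : ∀ i, IsPolyhedral (K i)) (hF : ∀ i, IsFace (K i) (F i))
    (hne : (⋂ i, intrinsicInterior ℝ (F i)).Nonempty) :
    intrinsicInterior ℝ (⋂ i, F i) = ⋂ i, intrinsicInterior ℝ (F i) := by
  obtain ⟨p, hp⟩ := hne
  rw [mem_iInter] at hp
  ext q
  rw [mem_iInter]
  refine ⟨fun hq i => ?_, fun hq => mem_intrinsicInterior_iInter hK hF hq⟩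
  have hpF : p ∈ ⋂ i, F i := mem_iInter.2 fun i => intrinsicInterior_subset (hp i)
  have hqF := mem_iInter.1 (intrinsicInterior_subset hq)
  have hqK : q ∈ K i := (hF i).subset (hqF i)
  -- The segment from p to q extends beyond q inside every F i, so extremality puts p in the minimal
  -- face of K i at q. As p is relatively interior to F i, this forces F i to be that minimal face.
  obtain ⟨t, ht, h⟩ := exists_add_smul_mem_of_mem_intrinsicInterior hq hpF
  have hface := (hK i).isFace_minFace hqK
  have hpm : p ∈ minFace (K i) q :=
    hface.2.isExtreme.left_mem_of_mem_openSegment ((hF i).mem (hp i))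
      ((hF i).subset (mem_iInter.1 h i)) (IsPolyhedral.self_mem_minFace hqK)
      (mem_openSegment_extension ht)
  have h1 : F i = minFace (K i) q :=
    ((hF i).subset_of_mem hface (hp i) hpm).antisymm
      (hface.subset_of_mem (hF i) ((hK i).mem_intrinsicInterior_minFace hqK) (hqF i))
  rw [h1]
  exact (hK i).mem_intrinsicInterior_minFace hqK

/-! #### Dilates -/

theorem dirCone_dilate (K : Set E) {a : ℝ} (ha : 0 < a) (p : E) :
    dirCone ((fun y => a • y) '' K) (a • p) = dirCone K p := by
  have ha' := ha.ne'
  have hmem : ∀ z, z ∈ (fun y => a • y) '' K ↔ a⁻¹ • z ∈ K := fun z =>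
    ⟨by rintro ⟨y, hy, rfl⟩; simpa [smul_smul, ha'] using hy,
      fun h => ⟨_, h, by simp [smul_smul, ha']⟩⟩
  have key : ∀ b : ℝ, 0 < b → ∀ (f : ℝ → Prop), (∀ᶠ t in 𝓝[>] (0 : ℝ), f t) →
      ∀ᶠ t in 𝓝[>] (0 : ℝ), f (b * t) := by
    intro b hb f hf
    have : Tendsto (fun t : ℝ => b * t) (𝓝[>] 0) (𝓝[>] 0) := by
      refine tendsto_nhdsWithin_of_tendsto_nhds_of_eventually_within _ ?_ ?_
      · have : Tendsto (fun r : ℝ => b * r) (𝓝 0) (𝓝 (b * 0)) :=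
          (continuous_const.mul continuous_id).tendsto 0
        rw [mul_zero] at this
        exact this.mono_left nhdsWithin_le_nhds
      · filter_upwards [self_mem_nhdsWithin] with r hr
        exact mul_pos hb hr
    exact this.eventually hf
  ext v
  simp only [mem_dirCone, hmem, smul_add, smul_smul, inv_mul_cancel₀ ha', one_smul]
  constructor
  · intro h
    filter_upwards [key a ha _ h] with t ht
    rwa [inv_mul_cancel_left₀ ha'] at ht
  · intro h
    exact key a⁻¹ (inv_pos.2 ha) _ h

theorem intrinsicInterior_dilate [FiniteDimensional ℝ E] (K : Set E) {a : ℝ} (ha : 0 < a) :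
    intrinsicInterior ℝ ((fun y => a • y) '' K) = (fun y => a • y) '' intrinsicInterior ℝ K :=
  AffineEquiv.intrinsicInterior_image (LinearEquiv.smulOfNeZero ℝ E a ha.ne').toAffineEquiv K

theorem IsPolyhedral.dilate {K : Set E} (hK : IsPolyhedral K) {a : ℝ} (ha : 0 < a) :
    IsPolyhedral ((fun y => a • y) '' K) := by
  classical
  obtain ⟨s, rfl⟩ := hK
  refine ⟨s.image fun b => (b.1, a * b.2), ?_⟩
  ext z
  simp only [mem_image, mem_ofPred_eq, Finset.mem_image, forall_exists_index, and_imp,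
    forall_apply_eq_imp_iff₂]
  constructor
  · rintro ⟨y, hy, rfl⟩ b hb
    rw [inner_smul_right]
    exact mul_le_mul_of_nonneg_left (hy b hb) ha.le
  · intro h
    refine ⟨a⁻¹ • z, fun b hb => ?_, by simp [smul_smul, ha.ne']⟩
    rw [inner_smul_right, inv_mul_le_iff₀ ha]
    exact h b hb

theorem vectorSpan_dilate (K : Set E) {a : ℝ} (ha : 0 < a) :
    vectorSpan ℝ ((fun y => a • y) '' K) = vectorSpan ℝ K := by
  have h := AffineMap.map_vectorSpan
    (f := (LinearMap.lsmul ℝ E a).toAffineMap) (s := K)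
  have h2 : ((LinearMap.lsmul ℝ E a).toAffineMap : E → E) = fun y => a • y := rfl
  rw [h2] at h
  rw [← h]
  change Submodule.map (a • (LinearMap.id : E →ₗ[ℝ] E)) _ = _
  rw [Submodule.map_smul _ _ _ ha.ne', Submodule.map_id]

theorem IsFace.dilate {K F : Set E} (hF : IsFace K F) {a : ℝ} (ha : 0 < a) :
    IsFace ((fun y => a • y) '' K) ((fun y => a • y) '' F) := by
  refine ⟨hF.1.image _, fun _ => ?_⟩
  obtain ⟨l, hl⟩ := hF.2 hF.1
  refine ⟨l, ?_⟩
  ext z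
  constructor
  · rintro ⟨y, hy, rfl⟩
    rw [hl] at hy
    refine ⟨mem_image_of_mem _ hy.1, ?_⟩
    rintro _ ⟨w, hw, rfl⟩
    simp only [map_smul, smul_eq_mul]
    exact mul_le_mul_of_nonneg_left (hy.2 w hw) ha.le
  · rintro ⟨⟨y, hy, rfl⟩, h⟩
    refine mem_image_of_mem _ ?_
    rw [hl]
    refine ⟨hy, fun w hw => ?_⟩
    have := h _ (mem_image_of_mem _ hw)
    simp only [map_smul, smul_eq_mul] at this
    exact le_of_mul_le_mul_left this ha

/-! #### Compact polyhedral sets -/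

/-- An extreme point is determined by its active inequalities: a second point with the same active
set lies in the minimal face of the first, and the segment between them could be prolonged. So there
are finitely many extreme points, and Krein-Milman applies. -/
theorem IsPolyhedral.exists_finset_eq_convexHull [FiniteDimensional ℝ E] {K : Set E}
    (hK : IsPolyhedral K) (hc : IsCompact K) : ∃ S : Finset E, K = convexHull ℝ (S : Set E) := by
  classical
  have hfin : (K.extremePoints ℝ).Finite := by
    obtain ⟨s, rfl⟩ := id hK
    refine Set.Finite.of_finite_image (f := fun p => s.filter fun a => ⟪a.1, p⟫ = a.2)
      ((s.powerset.finite_toSet).subset ?_) ?_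
    · rintro _ ⟨p, -, rfl⟩
      simp only [Finset.mem_coe, Finset.mem_powerset]
      exact Finset.filter_subset _ _
    · intro p hp q hq hpq
      have hpK := hp.1
      have hqK := hq.1
      have hl : q ∈ minFace {x : E | ∀ a ∈ s, ⟪a.1, x⟫ ≤ a.2} p := by
        rw [mem_minFace, mem_lineality_halfspaces hpK]
        refine ⟨hqK, fun a ha hap => ?_⟩
        have : a ∈ s.filter fun a => ⟪a.1, p⟫ = a.2 := by simp [ha, hap]
        rw [show (s.filter fun a => ⟪a.1, p⟫ = a.2) = s.filter fun a => ⟪a.1, q⟫ = a.2 from hpq,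
          Finset.mem_filter] at this
        rw [inner_sub_right, this.2, hap, sub_self]
      obtain ⟨t, ht, h⟩ := exists_add_smul_mem_of_mem_intrinsicInterior
        (hK.mem_intrinsicInterior_minFace hpK) hl
      exact (hp.2 hqK h.1 (mem_openSegment_extension ht)).symm
  refine ⟨hfin.toFinset, ?_⟩
  rw [hfin.coe_toFinset, ← (hfin.isClosed_convexHull ℝ).closure_eq,
    closure_convexHull_extremePoints hc hK.convex]

end

variable {d : ℕ}

theorem Polytope.isPolyhedral (P : Polytope d) : IsPolyhedral (P : Set (Space d)) := by
  obtain ⟨S, hS⟩ := P.2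
  rw [Polytope.carrier, hS]
  exact isPolyhedral_convexHull S

theorem Polytope.nonempty (P : Polytope d) : (P : Set (Space d)).Nonempty := P.1.nonempty

theorem Polytope.carrier_injective :
    Function.Injective (Polytope.carrier : Polytope d → Set (Space d)) :=
  fun _ _ h => Subtype.ext (SetLike.coe_injective h)

theorem Polytope.carrier_translate (P : Polytope d) (x : Space d) :
    (P.translate x : Set (Space d)) = (fun y => y + x) '' (P : Set (Space d)) :=
  NonemptyCompacts.coe_map ..

theorem Polytope.carrier_dilate (P : Polytope d) (a : ℝ) :
    (P.dilate a : Set (Space d)) = (fun y => a • y) '' (P : Set (Space d)) :=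
  NonemptyCompacts.coe_map ..

theorem IsPolyhedral.exists_polytope {K : Set (Space d)} (hK : IsPolyhedral K) (hc : IsCompact K)
    (hne : K.Nonempty) : ∃ P : Polytope d, (P : Set (Space d)) = K :=
  ⟨⟨⟨⟨K, hc⟩, hne⟩, hK.exists_finset_eq_convexHull hc⟩, rfl⟩

/-! #### Normal cones -/

theorem mem_normalCone_iff {K F : Set (Space d)} (hK : IsPolyhedral K) (hF : IsFace K F)
    {p : Space d} (hp : p ∈ intrinsicInterior ℝ F) {u : Space d} :
    u ∈ normalCone K F ↔ ∀ v ∈ dirCone K p, ⟪u, v⟫ ≤ 0 := by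
  have hpK := hF.mem hp
  constructor
  · intro h v hv
    obtain ⟨t, ht, ht0⟩ := ((mem_dirCone.1 hv).and self_mem_nhdsWithin).exists
    have ht0' : (0 : ℝ) < t := ht0
    have := h p (intrinsicInterior_subset hp) _ ht
    rw [inner_add_right, inner_smul_right] at this
    by_contra! hc
    have := mul_pos ht0' hc
    linarith
  · intro h x hx y hy
    have h1 := h _ (hK.sub_mem_dirCone hpK hy)
    rw [hF.eq_minFace hK hp] at hx
    have h2 := h _ ((hK.mem_lineality_iff hpK).1 hx.2).2
    rw [inner_sub_right] at h1
    rw [inner_neg_right, inner_sub_right] at h2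
    linarith

theorem sphericalNormals_eq {K F : Set (Space d)} (hK : IsPolyhedral K) (hF : IsFace K F)
    {p : Space d} (hp : p ∈ intrinsicInterior ℝ F) :
    sphericalNormals K F = {u | ∀ v ∈ dirCone K p, ⟪u, v⟫ ≤ 0} ∩ Metric.sphere 0 1 := by
  rw [sphericalNormals]
  congr 1
  ext u
  exact mem_normalCone_iff hK hF hp

/-- The bipolar theorem made concrete: the normalized nonzero active normals belong to n(K, F) and
already cut out the cone. Thus n(K, F) determines the local shape of K along F. -/
theorem dirCone_eq_polar {K F : Set (Space d)} (hK : IsPolyhedral K) (hF : IsFace K F)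
    {p : Space d} (hp : p ∈ intrinsicInterior ℝ F) :
    dirCone K p = {v | ∀ u ∈ sphericalNormals K F, ⟪u, v⟫ ≤ 0} := by
  rw [sphericalNormals_eq hK hF hp]
  have hpK := hF.mem hp
  ext v
  refine ⟨fun hv u hu => hu.1 v hv, fun h => ?_⟩
  obtain ⟨s, rfl⟩ := hK
  rw [mem_dirCone_halfspaces hpK]
  intro a ha hap
  rcases eq_or_ne a.1 0 with h0 | h0
  · simp [h0]
  have hn : 0 < ‖a.1‖ := norm_pos_iff.2 h0
  have := h (‖a.1‖⁻¹ • a.1) ⟨fun w hw => ?_, ?_⟩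
  · rw [real_inner_smul_left] at this
    by_contra! hc
    have := mul_pos (inv_pos.2 hn) hc
    linarith
  · rw [real_inner_smul_left]
    exact mul_nonpos_of_nonneg_of_nonpos (inv_pos.2 hn).le
      ((mem_dirCone_halfspaces hpK).1 hw a ha hap)
  · simp [norm_smul, hn.ne']

/-- The right-hand side contains no translations: the feasible cone of an intersection is the
intersection of the cones, and each of these is constant on the relative interior of its face. This
gives the independence of the chosen translations. -/
theorem mixedSphericalNormals_eq {ι : Type*} [Finite ι] [Nonempty ι] {K F : ι → Set (Space d)}
    (hK : ∀ i, IsPolyhedral (K i)) (hF : ∀ i, IsFace (K i) (F i)) {p : ι → Space d}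
    (hp : ∀ i, p i ∈ intrinsicInterior ℝ (F i)) :
    mixedSphericalNormals K F =
      {u | ∀ v, (∀ i, v ∈ dirCone (K i) (p i)) → ⟪u, v⟫ ≤ 0} ∩ Metric.sphere 0 1 := by
  have key : ∀ (x : ι → Space d) (q : Space d),
      q ∈ (⋂ i, (fun y => y + x i) '' intrinsicInterior ℝ (F i)) →
      sphericalNormals (⋂ i, (fun y => y + x i) '' K i) (⋂ i, (fun y => y + x i) '' F i) =
      {u | ∀ v, (∀ i, v ∈ dirCone (K i) (p i)) → ⟪u, v⟫ ≤ 0} ∩ Metric.sphere 0 1 := by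
    intro x q hq
    have hq' : ∀ i, q ∈ intrinsicInterior ℝ ((fun y => y + x i) '' F i) := fun i => by
      rw [intrinsicInterior_translate]
      exact mem_iInter.1 hq i
    have hK' := fun i => (hK i).translate (x i)
    have hF' := fun i => (hF i).translate (hK i) (hp i) (x i)
    rw [sphericalNormals_eq (IsPolyhedral.iInter hK') (isFace_iInter hK' hF' hq')
      (mem_intrinsicInterior_iInter hK' hF' hq'), dirCone_iInter]
    congr 1
    ext u
    refine forall_congr' fun v => ?_
    rw [mem_iInter]
    refine imp_congr_left (forall_congr' fun i => ?_)
    rw [dirCone_translate, (hF i).dirCone_eq (hK i) (hp i)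
      (mem_image_add_right.1 (mem_iInter.1 hq i))]
  ext u
  constructor
  · rintro ⟨x, ⟨q, hq⟩, hu⟩
    rwa [key x q hq] at hu
  · intro hu
    have hq : (0 : Space d) ∈ ⋂ i, (fun y => y + -p i) '' intrinsicInterior ℝ (F i) := by
      rw [mem_iInter]
      intro i
      rw [mem_image_add_right]
      simpa using hp i
    refine ⟨fun i => -p i, ⟨0, hq⟩, ?_⟩
    rwa [key _ 0 hq]

theorem mixedSphericalNormals_eq_sphericalNormals {ι : Type*} [Finite ι] [Nonempty ι]
    {K F : ι → Set (Space d)} (hK : ∀ i, IsPolyhedral (K i)) (hF : ∀ i, IsFace (K i) (F i))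
    {x : ι → Space d} {q : Space d}
    (hq : q ∈ ⋂ i, (fun y => y + x i) '' intrinsicInterior ℝ (F i)) :
    mixedSphericalNormals K F =
      sphericalNormals (⋂ i, (fun y => y + x i) '' K i) (⋂ i, (fun y => y + x i) '' F i) := by
  have hp : ∀ i, q - x i ∈ intrinsicInterior ℝ (F i) := fun i =>
    mem_image_add_right.1 (mem_iInter.1 hq i)
  have hq' : ∀ i, q ∈ intrinsicInterior ℝ ((fun y => y + x i) '' F i) := fun i => by
    rw [intrinsicInterior_translate]
    exact mem_iInter.1 hq i
  have hK' := fun i => (hK i).translate (x i)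
  have hF' := fun i => (hF i).translate (hK i) (hp i) (x i)
  rw [mixedSphericalNormals_eq hK hF hp, sphericalNormals_eq (IsPolyhedral.iInter hK')
    (isFace_iInter hK' hF' hq') (mem_intrinsicInterior_iInter hK' hF' hq'), dirCone_iInter]
  simp only [mem_iInter, dirCone_translate]

end

section

section

variable {E : Type*} [NormedAddCommGroup E] [InnerProductSpace ℝ E] [FiniteDimensional ℝ E]
  [MeasurableSpace E] [BorelSpace E]

/-! ### Lebesgue measure on faces -/

theorem euclideanHausdorffMeasure_eq_volume_of_sub_mem (L : Submodule ℝ E) (p : E) {A : Set E}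
    (hA : ∀ x ∈ A, x - p ∈ L) :
    μHE[finrank ℝ L] A = volume {v : L | p + (v : E) ∈ A} := by
  have hf : Isometry fun v : L => p + (v : E) :=
    (isometry_add_left p).comp isometry_subtype_coe
  have himg : A = (fun v : L => p + (v : E)) '' {v : L | p + (v : E) ∈ A} := by
    ext x
    constructor
    · intro hx
      exact ⟨⟨x - p, hA x hx⟩, by simpa using hx, by simp⟩
    · rintro ⟨v, hv, rfl⟩
      exact hv
  conv_lhs => rw [himg]
  rw [hf.euclideanHausdorffMeasure_image, InnerProductSpace.euclideanHausdorffMeasure_eq_volume]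

theorem measurableSet_intrinsicInterior (F : Set E) : MeasurableSet (intrinsicInterior ℝ F) := by
  have h : MeasurableSet (affineSpan ℝ F : Set E) :=
    (AffineSubspace.closed_of_finiteDimensional _).measurableSet
  exact h.subtype_image isOpen_interior.measurableSet

/-- In the direction space the relative interior becomes an ordinary interior. Positivity of
Lebesgue measure on open sets and nullity of the frontier of a convex set then carry over to faces.
-/
theorem setOf_add_mem_intrinsicInterior {E : Type*} [NormedAddCommGroup E]
    [InnerProductSpace ℝ E] (F : Set E) (p : E) :
    {v : vectorSpan ℝ F | p + (v : E) ∈ intrinsicInterior ℝ F} =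
      interior {v : vectorSpan ℝ F | p + (v : E) ∈ F} := by
  ext v
  have key : (∀ᶠ w in 𝓝 (0 : E), w ∈ vectorSpan ℝ F → p + (v : E) + w ∈ F) ↔
      {v : vectorSpan ℝ F | p + (v : E) ∈ F} ∈ 𝓝 v := by
    rw [← map_add_left_nhds_zero v, mem_map, nhds_subtype_eq_comap]
    change _ ↔ ∀ᶠ w in comap _ _, p + ((v + w : vectorSpan ℝ F) : E) ∈ F
    rw [eventually_comap]
    refine eventually_congr (Eventually.of_forall fun w => ?_)
    constructor
    · rintro h a rfl
      have := h a.2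
      rwa [add_assoc] at this
    · intro h hw
      have := h ⟨w, hw⟩ rfl
      rwa [Submodule.coe_add, ← add_assoc] at this
  rw [mem_interior_iff_mem_nhds, ← key, mem_ofPred_eq, mem_intrinsicInterior_iff_eventually]
  refine ⟨fun h => h.2, fun h => ⟨?_, h⟩⟩
  simpa using h.self_of_nhds (Submodule.zero_mem _)

theorem euclideanHausdorffMeasure_intrinsicInterior_pos {F : Set E} {p : E}
    (hp : p ∈ intrinsicInterior ℝ F) :
    0 < μHE[finrank ℝ (vectorSpan ℝ F)] (intrinsicInterior ℝ F) := by
  have hpF := intrinsicInterior_subset hp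
  rw [euclideanHausdorffMeasure_eq_volume_of_sub_mem (vectorSpan ℝ F) p
    fun x hx => vsub_mem_vectorSpan ℝ (intrinsicInterior_subset hx) hpF,
    setOf_add_mem_intrinsicInterior]
  refine isOpen_interior.measure_pos _ ⟨0, ?_⟩
  rw [← setOf_add_mem_intrinsicInterior]
  simpa using hp

theorem euclideanHausdorffMeasure_diff_intrinsicInterior {F : Set E} {p : E} (hF : Convex ℝ F)
    (hp : p ∈ F) : μHE[finrank ℝ (vectorSpan ℝ F)] (F \ intrinsicInterior ℝ F) = 0 := by
  rw [euclideanHausdorffMeasure_eq_volume_of_sub_mem (vectorSpan ℝ F) p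
    fun x hx => vsub_mem_vectorSpan ℝ hx.1 hp]
  have hc : Convex ℝ {v : vectorSpan ℝ F | p + (v : E) ∈ F} := by
    intro v hv w hw a b ha hb hab
    have := hF hv hw ha hb hab
    simp only [mem_ofPred_eq, Submodule.coe_add, Submodule.coe_smul]
    convert this using 1
    rw [smul_add, smul_add]
    have h1 : p = a • p + b • p := by rw [← add_smul, hab, one_smul]
    nth_rewrite 1 [h1]
    abel
  refine measure_mono_null ?_ (hc.addHaar_frontier volume)
  intro v hv
  refine ⟨subset_closure hv.1, ?_⟩
  rw [← setOf_add_mem_intrinsicInterior]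
  exact hv.2

theorem euclideanHausdorffMeasure_inter_intrinsicInterior {F : Set E} {p : E} (hF : Convex ℝ F)
    (hp : p ∈ F) (A : Set E) : μHE[finrank ℝ (vectorSpan ℝ F)] (A ∩ intrinsicInterior ℝ F) =
      μHE[finrank ℝ (vectorSpan ℝ F)] (A ∩ F) := by
  refine le_antisymm (measure_mono (inter_subset_inter_right _ intrinsicInterior_subset)) ?_
  rw [← measure_inter_add_sdiff₀ (A ∩ F)
    (measurableSet_intrinsicInterior F).nullMeasurableSet]
  have h0 : μHE[finrank ℝ (vectorSpan ℝ F)] ((A ∩ F) \ intrinsicInterior ℝ F) = 0 :=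
    measure_mono_null (sdiff_subset_sdiff_left inter_subset_right)
      (euclideanHausdorffMeasure_diff_intrinsicInterior hF hp)
  rw [h0, add_zero]
  exact measure_mono (inter_subset_inter_left _ inter_subset_left)

/-! ### Locally translation invariant signed measures -/

theorem lintegral_measure_section {E F : Type*} [MeasurableSpace E] [MeasurableSpace F]
    (κ : Measure F) [SFinite κ]
    (ν : Measure E) [SFinite ν] {S : Set (F × E)} (hS : MeasurableSet S) {B : Set E}
    (hB : MeasurableSet B) {c : ENNReal} (h1 : ∀ x ∈ B, κ {y | (y, x) ∈ S} = c)
    (h2 : ∀ x ∉ B, ∀ y, (y, x) ∉ S) : ∫⁻ y, ν {x | (y, x) ∈ S} ∂κ = ν B * c := by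
  have h3 : ∫⁻ y, ν {x | (y, x) ∈ S} ∂κ = κ.prod ν S := (Measure.prod_apply hS).symm
  rw [h3, Measure.prod_apply_symm hS]
  have h4 : (fun x => κ ((fun y => (y, x)) ⁻¹' S)) = B.indicator fun _ => c := by
    ext x
    by_cases hx : x ∈ B
    · rw [indicator_of_mem hx]
      exact h1 x hx
    · rw [indicator_of_notMem hx]
      have : (fun y => (y, x)) ⁻¹' S = ∅ := eq_empty_of_forall_notMem fun y hy => h2 x hx y hy
      rw [this, measure_empty]
  rw [h4, lintegral_indicator_const hB, mul_comm]

/-- A signed measure that is invariant under the translations along `L` inside a subset of a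
translate of `L` is proportional to the Lebesgue measure there. -/
theorem SignedMeasure.mul_eq_mul_of_translation_invariant (s : SignedMeasure E)
    (L : Submodule ℝ E) (p : E) {R : Set E} (hR : ∀ x ∈ R, x - p ∈ L)
    (hs : ∀ t ∈ L, ∀ A, MeasurableSet A → A ⊆ R → (fun y => y + t) '' A ⊆ R →
      s ((fun y => y + t) '' A) = s A) {A C : Set E} (hA : MeasurableSet A) (hC : MeasurableSet C)
    (hAR : A ⊆ R) (hCR : C ⊆ R) (hAf : μHE[finrank ℝ L] A ≠ ⊤) (hCf : μHE[finrank ℝ L] C ≠ ⊤) :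
    s A * (μHE[finrank ℝ L] C).toReal = s C * (μHE[finrank ℝ L] A).toReal := by
  have hAv := euclideanHausdorffMeasure_eq_volume_of_sub_mem L p fun x hx => hR x (hAR hx)
  have hCv := euclideanHausdorffMeasure_eq_volume_of_sub_mem L p fun x hx => hR x (hCR hx)
  set a := μHE[finrank ℝ L] A
  set c := μHE[finrank ℝ L] C
  -- Double counting over t in L: the section of the first set at t is A ∩ (C + t), that of the
  -- second is C ∩ (A - t), and they differ by the translation t. Integrating the measure of the
  -- sections over t gives s(A) vol(C) and s(C) vol(A).
  have hS1 : MeasurableSet {q : L × E | q.2 ∈ A ∧ q.2 - (q.1 : E) ∈ C} :=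
    (measurable_snd hA).inter
      ((measurable_snd.sub (measurable_subtype_coe.comp measurable_fst)) hC)
  have hS2 : MeasurableSet {q : L × E | q.2 ∈ C ∧ q.2 + (q.1 : E) ∈ A} :=
    (measurable_snd hC).inter
      ((measurable_snd.add (measurable_subtype_coe.comp measurable_fst)) hA)
  have f1 : ∀ ν : Measure E, IsFiniteMeasure ν →
      ∫⁻ y : L, ν {x | (y, x) ∈ {q : L × E | q.2 ∈ A ∧ q.2 - (q.1 : E) ∈ C}} = ν A * c := by
    intro ν _
    refine lintegral_measure_section volume ν hS1 hA (fun x hx => ?_) fun x hx y hy => hx hy.1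
    have hm : MeasurableSet {v : L | p + (v : E) ∈ C} :=
      (measurable_subtype_coe.const_add p) hC
    rw [hCv, ← (Measure.measurePreserving_sub_left volume (⟨x - p, hR x (hAR hx)⟩ : L)).measure_preimage
      hm.nullMeasurableSet]
    congr 1
    ext y
    simp only [mem_ofPred_eq, mem_preimage, Submodule.coe_sub, hx, true_and]
    rw [show p + (x - p - (y : E)) = x - y by abel]
  have f2 : ∀ ν : Measure E, IsFiniteMeasure ν →
      ∫⁻ y : L, ν {x | (y, x) ∈ {q : L × E | q.2 ∈ C ∧ q.2 + (q.1 : E) ∈ A}} = ν C * a := by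
    intro ν _
    refine lintegral_measure_section volume ν hS2 hC (fun x hx => ?_) fun x hx y hy => hx hy.1
    have hm : MeasurableSet {v : L | p + (v : E) ∈ A} :=
      (measurable_subtype_coe.const_add p) hA
    rw [hAv, ← (measurePreserving_add_left volume (⟨x - p, hR x (hCR hx)⟩ : L)).measure_preimage
      hm.nullMeasurableSet]
    congr 1
    ext y
    simp only [mem_ofPred_eq, mem_preimage, Submodule.coe_add, hx, true_and]
    rw [show p + (x - p + (y : E)) = x + y by abel]
  set ν₁ := s.toJordanDecomposition.posPart
  set ν₂ := s.toJordanDecomposition.negPart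
  have hsν : ∀ {B : Set E}, MeasurableSet B → s B = (ν₁ B).toReal - (ν₂ B).toReal := fun hB =>
    s.apply_eq_posPart_real_sub_negPart_real hB
  -- Equality of s on the two sections, with the negative parts moved to the other side so that only
  -- nonnegative functions are integrated.
  have hpt : ∀ y : L,
      ν₁ {x | (y, x) ∈ {q : L × E | q.2 ∈ A ∧ q.2 - (q.1 : E) ∈ C}} +
        ν₂ {x | (y, x) ∈ {q : L × E | q.2 ∈ C ∧ q.2 + (q.1 : E) ∈ A}} =
      ν₁ {x | (y, x) ∈ {q : L × E | q.2 ∈ C ∧ q.2 + (q.1 : E) ∈ A}} +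
        ν₂ {x | (y, x) ∈ {q : L × E | q.2 ∈ A ∧ q.2 - (q.1 : E) ∈ C}} := by
    intro y
    have m1 : MeasurableSet {x | (y, x) ∈ {q : L × E | q.2 ∈ A ∧ q.2 - (q.1 : E) ∈ C}} :=
      measurable_prodMk_left hS1
    have m2 : MeasurableSet {x | (y, x) ∈ {q : L × E | q.2 ∈ C ∧ q.2 + (q.1 : E) ∈ A}} :=
      measurable_prodMk_left hS2
    have himg : (fun z => z + (y : E)) ''
        {x | (y, x) ∈ {q : L × E | q.2 ∈ C ∧ q.2 + (q.1 : E) ∈ A}} =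
        {x | (y, x) ∈ {q : L × E | q.2 ∈ A ∧ q.2 - (q.1 : E) ∈ C}} := by
      ext z
      rw [mem_image_add_right]
      simp [and_comm]
    have h := hs y y.2 _ m2 (fun x hx => hCR hx.1) (by
      rw [himg]
      exact fun x hx => hAR hx.1)
    rw [himg, hsν m1, hsν m2] at h
    rw [← ENNReal.toReal_eq_toReal_iff' (by finiteness) (by finiteness),
      ENNReal.toReal_add (by finiteness) (by finiteness),
      ENNReal.toReal_add (by finiteness) (by finiteness)]
    linarith
  have hint : ν₁ A * c + ν₂ C * a = ν₁ C * a + ν₂ A * c := by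
    rw [← f1 ν₁ inferInstance, ← f2 ν₂ inferInstance, ← f2 ν₁ inferInstance,
      ← f1 ν₂ inferInstance]
    exact (lintegral_add_left (measurable_measure_prodMk_left hS1) _).symm.trans
      ((lintegral_congr hpt).trans (lintegral_add_left (measurable_measure_prodMk_left hS2) _))
  have hreal := congrArg ENNReal.toReal hint
  rw [ENNReal.toReal_add (by finiteness) (by finiteness),
    ENNReal.toReal_add (by finiteness) (by finiteness), ENNReal.toReal_mul, ENNReal.toReal_mul,
    ENNReal.toReal_mul, ENNReal.toReal_mul] at hreal
  rw [hsν hA, hsν hC]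
  linarith

theorem SignedMeasure.abs_apply_le {E : Type*} [MeasurableSpace E] (s : SignedMeasure E)
    {A : Set E} (hA : MeasurableSet A) :
    |s A| ≤ s.toJordanDecomposition.posPart.real univ +
      s.toJordanDecomposition.negPart.real univ := by
  rw [s.apply_eq_posPart_real_sub_negPart_real hA]
  have h1 := measureReal_mono (μ := s.toJordanDecomposition.posPart) (subset_univ A)
  have h2 := measureReal_mono (μ := s.toJordanDecomposition.negPart) (subset_univ A)
  have h3 : 0 ≤ s.toJordanDecomposition.posPart.real A := measureReal_nonneg
  have h4 : 0 ≤ s.toJordanDecomposition.negPart.real A := measureReal_nonneg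
  rw [abs_le]
  constructor <;> linarith

end

variable {d : ℕ} {φ : Polytope d → ℝ} {Φ : Polytope d → SignedMeasure (Space d)}

theorem measurableSet_image_add_right {A : Set (Space d)} (hA : MeasurableSet A) (t : Space d) :
    MeasurableSet ((fun y => y + t) '' A) :=
  (MeasurableEquiv.addRight t).measurableSet_image.2 hA

/-! ### Consequences of locality -/

namespace IsLocalExtension

/-- Covariance moves Q back by t; the interior of the set where P and Q - t agree then serves as the
open set in the locality axiom. -/
theorem eq_of_eventually (h : IsLocalExtension φ Φ) (P Q : Polytope d) (t : Space d)
    {A : Set (Space d)} (hA : MeasurableSet A)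
    (hloc : ∀ x ∈ A, ∀ᶠ y in 𝓝 x,
      (y ∈ (P : Set (Space d)) ↔ y + t ∈ (Q : Set (Space d)))) :
    Φ Q ((fun y => y + t) '' A) = Φ P A := by
  have h1 := h.translate Q _ (-t) (measurableSet_image_add_right hA t)
  rw [image_image] at h1
  simp only [add_neg_cancel_right, image_id'] at h1
  rw [← h1]
  refine h.locally_determined (Q.translate (-t)) P A
    (interior {y | y ∈ (P : Set (Space d)) ↔ y + t ∈ (Q : Set (Space d))}) hA isOpen_interior ?_
    fun x hx => mem_interior_iff_mem_nhds.2 (hloc x hx)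
  ext x
  simp only [mem_inter_iff, and_congr_left_iff]
  intro hx
  have := interior_subset hx
  rw [Polytope.carrier_translate, mem_image_add_right, sub_neg_eq_add]
  exact this.symm

theorem eq_of_dirCone_eq (h : IsLocalExtension φ Φ) (P Q : Polytope d) (t : Space d)
    {A : Set (Space d)} (hA : MeasurableSet A) (hP : A ⊆ P)
    (hQ : ∀ x ∈ A, x + t ∈ (Q : Set (Space d)))
    (hcone : ∀ x ∈ A, dirCone (P : Set (Space d)) x = dirCone (Q : Set (Space d)) (x + t)) :
    Φ Q ((fun y => y + t) '' A) = Φ P A := by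
  refine h.eq_of_eventually P Q t hA fun x hx => ?_
  rw [← map_add_left_nhds_zero x, eventually_map]
  filter_upwards [P.isPolyhedral.eventually_mem_iff (hP hx),
    Q.isPolyhedral.eventually_mem_iff (hQ x hx)] with v h1 h2
  rw [h1, hcone x hx, ← h2, add_right_comm]

/-- Off P the polytope looks locally empty, so Φ(P, ·) is there translation invariant and
proportional to Lebesgue measure. The complement has infinite volume and Φ(P, ·) is bounded, so the
factor is 0. -/
theorem eq_zero_of_disjoint (h : IsLocalExtension φ Φ) (P : Polytope d) {A : Set (Space d)}
    (hA : MeasurableSet A) (hAP : A ⊆ (P : Set (Space d))ᶜ) : Φ P A = 0 := by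
  -- For d = 0 the complement of P is empty, and the argument by infinite volume is unavailable.
  rcases Nat.eq_zero_or_pos d with rfl | hd
  · have : A = ∅ := by
      refine eq_empty_of_forall_notMem fun x hx => hAP hx ?_
      obtain ⟨y, hy⟩ := P.nonempty
      rwa [Subsingleton.elim x y]
    rw [this, VectorMeasure.empty]
  have hfin : finrank ℝ (⊤ : Submodule ℝ (Space d)) = d := by simp
  have hvol : (μHE[finrank ℝ (⊤ : Submodule ℝ (Space d))] : Measure (Space d)) = volume := by
    rw [hfin, EuclideanSpace.euclideanHausdorffMeasure_eq_volume]
  have hPm : MeasurableSet (P : Set (Space d)) := P.isCompact.measurableSet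
  have hinv := fun {A C : Set (Space d)} (hA : MeasurableSet A) (hC : MeasurableSet C)
      (hAR : A ⊆ (P : Set (Space d))ᶜ) (hCR : C ⊆ (P : Set (Space d))ᶜ) =>
    SignedMeasure.mul_eq_mul_of_translation_invariant (Φ P) ⊤ 0
    (R := (P : Set (Space d))ᶜ) (fun _ _ => Submodule.mem_top) (by
      intro t _ A hA hAR hAR'
      refine h.eq_of_eventually P P t hA fun x hx => ?_
      have h1 : ∀ᶠ y in 𝓝 x, y ∈ (P : Set (Space d))ᶜ :=
        P.isCompact.isClosed.isOpen_compl.mem_nhds (hAR hx)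
      have h2 : ∀ᶠ y in 𝓝 x, y + t ∈ (P : Set (Space d))ᶜ :=
        (continuous_id.add continuous_const).continuousAt.preimage_mem_nhds
          (P.isCompact.isClosed.isOpen_compl.mem_nhds (hAR' (mem_image_of_mem _ hx)))
      filter_upwards [h1, h2] with y hy1 hy2
      exact iff_of_false hy1 hy2) hA hC hAR hCR
  rw [hvol] at hinv
  have hball : ∀ (B : Set (Space d)) (n : ℕ), volume (B ∩ Metric.ball 0 n) ≠ ⊤ := fun B n =>
    ((measure_mono inter_subset_right).trans_lt Metric.isBounded_ball.measure_lt_top).ne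
  have hmono : ∀ B : Set (Space d), Monotone fun n : ℕ => B ∩ Metric.ball 0 n := fun B m n hmn =>
    inter_subset_inter_right _ (Metric.ball_subset_ball (by exact_mod_cast hmn))
  have hUnion : ∀ B : Set (Space d), ⋃ n : ℕ, B ∩ Metric.ball 0 n = B := fun B => by
    rw [← inter_iUnion, Metric.iUnion_ball_nat, inter_univ]
  -- Balls keep the volumes finite. A nonzero value on one bounded piece would bound the volume of
  -- the complement inside every ball.
  have hbdd : ∀ n : ℕ, Φ P (A ∩ Metric.ball 0 n) = 0 := by
    intro n
    by_contra hne
    have hmA := hA.inter (Metric.isOpen_ball (x := (0 : Space d)) (ε := n)).measurableSet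
    set M := (Φ P).toJordanDecomposition.posPart.real univ +
      (Φ P).toJordanDecomposition.negPart.real univ
    have hb : ∀ k : ℕ, volume ((P : Set (Space d))ᶜ ∩ Metric.ball 0 k) ≤
        ENNReal.ofReal (M * volume.real (A ∩ Metric.ball 0 n) / |Φ P (A ∩ Metric.ball 0 n)|) := by
      intro k
      have hmC := hPm.compl.inter (Metric.isOpen_ball (x := (0 : Space d)) (ε := k)).measurableSet
      have h1 := congrArg abs (hinv hmA hmC (inter_subset_left.trans hAP) inter_subset_left
        (hball _ _) (hball _ _))
      rw [abs_mul, abs_mul, ENNReal.abs_toReal, ENNReal.abs_toReal] at h1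
      rw [← ENNReal.ofReal_toReal (hball (P : Set (Space d))ᶜ k)]
      refine ENNReal.ofReal_le_ofReal ?_
      rw [le_div_iff₀ (abs_pos.2 hne), mul_comm, h1]
      exact mul_le_mul_of_nonneg_right (SignedMeasure.abs_apply_le (Φ P) hmC) ENNReal.toReal_nonneg
    have : Nonempty (Fin d) := ⟨⟨0, hd⟩⟩
    have htop : volume (P : Set (Space d))ᶜ = ⊤ := by
      rw [measure_compl hPm P.isCompact.measure_lt_top.ne, measure_univ_of_isAddLeftInvariant,
        ENNReal.top_sub P.isCompact.measure_lt_top.ne]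
    rw [← hUnion (P : Set (Space d))ᶜ, (hmono _).measure_iUnion] at htop
    exact ENNReal.ofReal_ne_top (top_le_iff.1 (htop ▸ iSup_le hb))
  have := VectorMeasure.tendsto_vectorMeasure_iUnion_atTop_nat (v := Φ P) (hmono A)
    fun n => hA.inter (Metric.isOpen_ball (x := (0 : Space d)) (ε := n)).measurableSet
  rw [hUnion] at this
  refine tendsto_nhds_unique this ?_
  simp [hbdd]

/-- The feasible cone does not change along the relative interior, so locality makes Φ(P, ·)
invariant there under the direction space of F. -/
theorem mul_eq_mul_of_subset_intrinsicInterior (h : IsLocalExtension φ Φ) (P : Polytope d) {m : ℕ}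
    (F : Face P m) {A C : Set (Space d)} (hA : MeasurableSet A) (hC : MeasurableSet C)
    (hAF : A ⊆ intrinsicInterior ℝ (F : Set (Space d)))
    (hCF : C ⊆ intrinsicInterior ℝ (F : Set (Space d))) :
    Φ P A * F.measure.real C = Φ P C * F.measure.real A := by
  have hFP : IsFace (P : Set (Space d)) F := ⟨F.2.1, F.2.2.1⟩
  obtain ⟨p, hp⟩ := hFP.exists_mem_intrinsicInterior P.isPolyhedral
  have hm : finrank ℝ (vectorSpan ℝ (F : Set (Space d))) = m := F.2.2.2
  have hmeas : ∀ {B : Set (Space d)}, MeasurableSet B →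
      B ⊆ intrinsicInterior ℝ (F : Set (Space d)) →
      F.measure B = μHE[finrank ℝ (vectorSpan ℝ (F : Set (Space d)))] B := fun hB hBF => by
    rw [Face.measure, Measure.restrict_apply hB,
      inter_eq_self_of_subset_left (hBF.trans intrinsicInterior_subset), hm]
  have := SignedMeasure.mul_eq_mul_of_translation_invariant (Φ P)
    (vectorSpan ℝ (F : Set (Space d))) p (R := intrinsicInterior ℝ (F : Set (Space d)))
    (fun x hx => vsub_mem_vectorSpan ℝ (intrinsicInterior_subset hx) (intrinsicInterior_subset hp))
    (fun t _ B hB hBR hBR' => h.eq_of_dirCone_eq P P t hB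
      (fun x hx => hFP.mem (hBR hx)) (fun x hx => hFP.mem (hBR' (mem_image_of_mem _ hx)))
      fun x hx => hFP.dirCone_eq P.isPolyhedral (hBR hx) (hBR' (mem_image_of_mem _ hx)))
    hA hC hAF hCF
  rw [← hmeas hA hAF, ← hmeas hC hCF] at this
  exact this (by finiteness) (by finiteness)

end IsLocalExtension

end

open scoped Pointwise

section

theorem eventually_add_mem_intrinsicInterior {E : Type*} [NormedAddCommGroup E]
    [InnerProductSpace ℝ E] {F : Set E} {p : E} (hp : p ∈ intrinsicInterior ℝ F) :
    ∀ᶠ v in 𝓝 (0 : E), v ∈ vectorSpan ℝ F → p + v ∈ intrinsicInterior ℝ F := by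
  have h : {v : vectorSpan ℝ F | p + (v : E) ∈ intrinsicInterior ℝ F} ∈
      𝓝 (0 : vectorSpan ℝ F) := by
    have hp' : (0 : vectorSpan ℝ F) ∈
        {v : vectorSpan ℝ F | p + (v : E) ∈ intrinsicInterior ℝ F} := by
      rwa [mem_ofPred_eq, Submodule.coe_zero, add_zero]
    rw [setOf_add_mem_intrinsicInterior] at hp' ⊢
    exact isOpen_interior.mem_nhds hp'
  rw [nhds_subtype_eq_comap] at h
  change ∀ᶠ v in comap _ _, _ at h
  rw [eventually_comap] at h
  exact h.mono fun v hv hvF => hv ⟨v, hvF⟩ rfl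

variable {d : ℕ}

/-! ### Measures and relative interiors of faces -/

namespace Face

variable {P Q : Polytope d} {m : ℕ}

theorem isFace (F : Face P m) : IsFace (P : Set (Space d)) F := ⟨F.2.1, F.2.2.1⟩

theorem finrank_vectorSpan (F : Face P m) :
    finrank ℝ (vectorSpan ℝ (F : Set (Space d))) = m := F.2.2.2

theorem carrier_injective : Function.Injective (Face.carrier : Face P m → Set (Space d)) :=
  Subtype.val_injective

theorem convex (F : Face P m) : Convex ℝ (F : Set (Space d)) := F.isFace.convex P.isPolyhedral

theorem exists_mem_intrinsicInterior (F : Face P m) :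
    ∃ p, p ∈ intrinsicInterior ℝ (F : Set (Space d)) :=
  F.isFace.exists_mem_intrinsicInterior P.isPolyhedral

theorem measurableSet (F : Face P m) : MeasurableSet (F : Set (Space d)) :=
  F.isCompact.measurableSet

theorem measure_apply (F : Face P m) (A : Set (Space d)) :
    F.measure A = μHE[m] (A ∩ (F : Set (Space d))) :=
  Measure.restrict_apply' F.measurableSet

theorem measure_inter_intrinsicInterior (F : Face P m) (A : Set (Space d)) :
    F.measure (A ∩ intrinsicInterior ℝ (F : Set (Space d))) = F.measure A := by
  obtain ⟨p, hp⟩ := F.isFace.1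
  have := euclideanHausdorffMeasure_inter_intrinsicInterior F.convex hp A
  rw [F.finrank_vectorSpan] at this
  rw [measure_apply, measure_apply, inter_assoc,
    inter_eq_self_of_subset_left intrinsicInterior_subset, this]

theorem measure_eq_intrinsicInterior (F : Face P m) (A : Set (Space d)) :
    F.measure A = μHE[m] (A ∩ intrinsicInterior ℝ (F : Set (Space d))) := by
  rw [← measure_inter_intrinsicInterior, measure_apply, inter_assoc,
    inter_eq_self_of_subset_left intrinsicInterior_subset]

theorem measureReal_intrinsicInterior_pos (F : Face P m) :
    0 < F.measure.real (intrinsicInterior ℝ (F : Set (Space d))) := by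
  obtain ⟨p, hp⟩ := F.exists_mem_intrinsicInterior
  have := euclideanHausdorffMeasure_intrinsicInterior_pos hp
  rw [F.finrank_vectorSpan] at this
  refine ENNReal.toReal_pos ?_ (measure_ne_top _ _)
  rw [measure_eq_intrinsicInterior, inter_self]
  exact this.ne'

/-- The relative interior of a face is a null set for the Lebesgue measure on another face of the
same dimension. -/
theorem measure_intrinsicInterior_eq_zero {F G : Face P m} (h : F ≠ G) :
    G.measure (intrinsicInterior ℝ (F : Set (Space d))) = 0 := by
  rw [measure_eq_intrinsicInterior, (disjoint_left.2 fun p hp hp' =>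
    h (carrier_injective (F.isFace.eq_of_mem G.isFace hp hp'))).inter_eq, measure_empty]

/-- The face of a polytope whose relative interior contains a given point. -/
def ofMem {p : Space d} (hp : p ∈ (P : Set (Space d))) :
    Face P (finrank ℝ (lineality (P : Set (Space d)) p)) :=
  ⟨minFace P p, (P.isPolyhedral.isFace_minFace hp).1, (P.isPolyhedral.isFace_minFace hp).2, by
    rw [P.isPolyhedral.vectorSpan_minFace hp]⟩

end Face

theorem finrank_le (L : Submodule ℝ (Space d)) : finrank ℝ L ≤ d := by
  simpa using Submodule.finrank_le L

/-- A signed measure concentrated on a polytope is the sum of its restrictions to the relative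
interiors of the faces. -/
theorem sum_faces_intrinsicInterior (s : SignedMeasure (Space d)) (P : Polytope d)
    (hs : ∀ A, MeasurableSet A → A ⊆ (P : Set (Space d))ᶜ → s A = 0) {A : Set (Space d)}
    (hA : MeasurableSet A) :
    s A = ∑ m ∈ Finset.range (d + 1), ∑ F : Face P m,
      s (A ∩ intrinsicInterior ℝ (F : Set (Space d))) := by
  classical
  have hPm : MeasurableSet (P : Set (Space d)) := P.isCompact.measurableSet
  have hsplit : s A = s (A ∩ P) := by
    conv_lhs => rw [← inter_union_sdiff A (P : Set (Space d))]
    rw [VectorMeasure.of_union disjoint_sdiff_inter.symm (hA.inter hPm) (MeasurableSet.diff hA hPm),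
      hs (A \ P) (MeasurableSet.diff hA hPm) (fun x hx => hx.2), add_zero]
  rw [hsplit]
  -- Each point of P is relatively interior to exactly one face, its minimal face.
  have hU : A ∩ (P : Set (Space d)) = ⋃ i ∈ (Finset.univ : Finset (Σ m : Fin (d + 1), Face P m)),
      A ∩ intrinsicInterior ℝ (i.2 : Set (Space d)) := by
    ext x
    simp only [mem_inter_iff, Finset.mem_univ, iUnion_true, mem_iUnion]
    constructor
    · rintro ⟨hx, hxP⟩
      exact ⟨⟨⟨_, Nat.lt_succ_of_le (finrank_le _)⟩, Face.ofMem hxP⟩, hx,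
        P.isPolyhedral.mem_intrinsicInterior_minFace hxP⟩
    · rintro ⟨i, hx, hi⟩
      exact ⟨hx, i.2.isFace.mem hi⟩
  rw [hU, VectorMeasure.of_biUnion_finset, Finset.univ_sigma_univ.symm, Finset.sum_sigma,
    Fin.sum_univ_eq_sum_range
      (fun m => ∑ F : Face P m, s (A ∩ intrinsicInterior ℝ (F : Set (Space d)))) (d + 1)]
  · rintro ⟨⟨m, hm⟩, F⟩ - ⟨⟨m', hm'⟩, F'⟩ - hne
    refine disjoint_left.2 fun p hp hp' => hne ?_
    have h := F.isFace.eq_of_mem F'.isFace hp.2 hp'.2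
    have hmm : m = m' := F.finrank_vectorSpan.symm.trans (h ▸ F'.finrank_vectorSpan)
    subst hmm
    rw [Face.carrier_injective h]
  · exact fun i _ => hA.inter (measurableSet_intrinsicInterior _)

/-! ### Existence of the homogeneous decomposition -/

/-- The density on the relative interior of the face `F` of the measure `Φ P`. -/
def faceDensity (Φ : Polytope d → SignedMeasure (Space d)) {P : Polytope d} {m : ℕ}
    (F : Face P m) : ℝ :=
  Φ P (intrinsicInterior ℝ (F : Set (Space d))) /
    F.measure.real (intrinsicInterior ℝ (F : Set (Space d)))

open Classical in
/-- The associated function of degree `j` of a local extension. -/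
def assocFun (Φ : Polytope d → SignedMeasure (Space d)) (j : ℕ) (N : Set (Space d)) : ℝ :=
  if h : ∃ (P : Polytope d) (F : Face P j), sphericalNormals P.carrier F.carrier = N then
    faceDensity Φ h.choose_spec.choose else 0

/-- The homogeneous part of degree `j` of a local extension. -/
def homogeneousPart (Φ : Polytope d → SignedMeasure (Space d)) (j : ℕ) (P : Polytope d) :
    SignedMeasure (Space d) :=
  ∑ F : Face P j, assocFun Φ j (sphericalNormals P.carrier F.carrier) • F.measure.toSignedMeasure

theorem sum_smul_toSignedMeasure_apply {X ι : Type*} [MeasurableSpace X] [Fintype ι] (c : ι → ℝ)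
    (μ : ι → Measure X) [∀ i, IsFiniteMeasure (μ i)] {A : Set X} (hA : MeasurableSet A) :
    (∑ i, c i • (μ i).toSignedMeasure : SignedMeasure X) A = ∑ i, c i * (μ i).real A := by
  simp [sum_apply, Measure.toSignedMeasure_apply_measurable hA]

namespace IsLocalExtension

variable {φ : Polytope d → ℝ} {Φ : Polytope d → SignedMeasure (Space d)}

theorem apply_eq_faceDensity_mul (h : IsLocalExtension φ Φ) {P : Polytope d} {m : ℕ}
    (F : Face P m) {A : Set (Space d)} (hA : MeasurableSet A)
    (hAF : A ⊆ intrinsicInterior ℝ (F : Set (Space d))) :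
    Φ P A = faceDensity Φ F * F.measure.real A := by
  rw [faceDensity, div_mul_eq_mul_div, eq_div_iff F.measureReal_intrinsicInterior_pos.ne']
  exact h.mul_eq_mul_of_subset_intrinsicInterior P F hA (measurableSet_intrinsicInterior _) hAF
    subset_rfl

/-- Equal normals give equal feasible cones, hence equal direction spaces. Moving p to q makes the
relative interiors overlap in a set of positive measure, on which locality equates the two
functionals; cancelling the measure leaves the densities. -/
theorem faceDensity_eq (h : IsLocalExtension φ Φ) {P Q : Polytope d} {m : ℕ} (F : Face P m)
    (G : Face Q m)
    (hn : sphericalNormals P.carrier F.carrier = sphericalNormals Q.carrier G.carrier) :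
    faceDensity Φ F = faceDensity Φ G := by
  obtain ⟨p, hp⟩ := F.exists_mem_intrinsicInterior
  obtain ⟨q, hq⟩ := G.exists_mem_intrinsicInterior
  have hcone : ∀ x ∈ intrinsicInterior ℝ (F : Set (Space d)),
      ∀ y ∈ intrinsicInterior ℝ (G : Set (Space d)),
      dirCone (P : Set (Space d)) x = dirCone (Q : Set (Space d)) y := fun x hx y hy => by
    rw [dirCone_eq_polar P.isPolyhedral F.isFace hx, dirCone_eq_polar Q.isPolyhedral G.isFace hy,
      hn]
  have hspan : vectorSpan ℝ (F : Set (Space d)) = vectorSpan ℝ (G : Set (Space d)) := by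
    rw [F.isFace.vectorSpan_eq P.isPolyhedral hp, G.isFace.vectorSpan_eq Q.isPolyhedral hq,
      lineality, lineality, hcone p hp q hq]
  set A : Set (Space d) := intrinsicInterior ℝ (F : Set (Space d)) ∩
    (fun y => y + (q - p)) ⁻¹' intrinsicInterior ℝ (G : Set (Space d)) with hAdef
  have hA : MeasurableSet A := (measurableSet_intrinsicInterior _).inter
    ((measurable_id.add_const _) (measurableSet_intrinsicInterior _))
  have h1 := h.eq_of_dirCone_eq P Q (q - p) hA (fun x hx => F.isFace.mem hx.1)
    (fun x hx => G.isFace.mem hx.2) fun x hx => hcone x hx.1 _ hx.2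
  have hAG : (fun y => y + (q - p)) '' A ⊆ intrinsicInterior ℝ (G : Set (Space d)) := by
    rintro _ ⟨x, hx, rfl⟩
    exact hx.2
  rw [h.apply_eq_faceDensity_mul F hA inter_subset_left,
    h.apply_eq_faceDensity_mul G (measurableSet_image_add_right hA _) hAG] at h1
  have hm : G.measure ((fun y => y + (q - p)) '' A) = F.measure A := by
    rw [Face.measure_apply, Face.measure_apply,
      inter_eq_self_of_subset_left (hAG.trans intrinsicInterior_subset),
      inter_eq_self_of_subset_left (inter_subset_left.trans intrinsicInterior_subset)]
    exact (isometry_add_right (q - p)).euclideanHausdorffMeasure_image A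
  have hpos : F.measure A ≠ 0 := by
    rw [Face.measure_apply,
      inter_eq_self_of_subset_left (inter_subset_left.trans intrinsicInterior_subset)]
    have hv := euclideanHausdorffMeasure_eq_volume_of_sub_mem (vectorSpan ℝ (F : Set (Space d))) p
      (A := A) fun x hx => vsub_mem_vectorSpan ℝ (intrinsicInterior_subset hx.1)
        (intrinsicInterior_subset hp)
    rw [F.finrank_vectorSpan] at hv
    rw [hv]
    refine (Measure.measure_pos_of_mem_nhds _ (x := 0) ?_).ne'
    rw [nhds_subtype_eq_comap]
    change ∀ᶠ v in comap _ _, _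
    rw [eventually_comap]
    filter_upwards [eventually_add_mem_intrinsicInterior hp,
      eventually_add_mem_intrinsicInterior hq] with v hv1 hv2
    rintro w rfl
    refine ⟨hv1 w.2, ?_⟩
    rw [mem_preimage, show p + (w : Space d) + (q - p) = q + w by abel]
    exact hv2 (hspan ▸ w.2)
  rw [measureReal_def, measureReal_def, hm] at h1
  exact (mul_right_cancel₀ (ENNReal.toReal_ne_zero.2 ⟨hpos, measure_ne_top _ _⟩) h1).symm

/-- By `faceDensity_eq` the pair chosen inside `assocFun` does not matter. -/
theorem assocFun_eq (h : IsLocalExtension φ Φ) {P : Polytope d} {m : ℕ} (F : Face P m) :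
    assocFun Φ m (sphericalNormals P.carrier F.carrier) = faceDensity Φ F := by
  have hex : ∃ (Q : Polytope d) (G : Face Q m),
      sphericalNormals Q.carrier G.carrier = sphericalNormals P.carrier F.carrier :=
    ⟨P, F, rfl⟩
  rw [assocFun, dif_pos hex]
  exact h.faceDensity_eq _ _ hex.choose_spec.choose_spec

theorem eq_sum_homogeneousPart (h : IsLocalExtension φ Φ) (P : Polytope d) :
    Φ P = ∑ j ∈ Finset.range (d + 1), homogeneousPart Φ j P := by
  refine VectorMeasure.ext fun A hA => ?_
  rw [sum_apply, sum_faces_intrinsicInterior (Φ P) P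
    (fun B hB hBP => h.eq_zero_of_disjoint P hB hBP) hA]
  refine Finset.sum_congr rfl fun m _ => ?_
  rw [homogeneousPart, sum_smul_toSignedMeasure_apply _ _ hA]
  refine Finset.sum_congr rfl fun F _ => ?_
  rw [h.assocFun_eq F, h.apply_eq_faceDensity_mul F
    (hA.inter (measurableSet_intrinsicInterior _)) inter_subset_right, measureReal_def,
    F.measure_inter_intrinsicInterior, measureReal_def]

end IsLocalExtension

/-! #### Dilated faces -/

namespace Face

variable {P Q : Polytope d} {m : ℕ}

theorem image_smul_image_inv_smul (K : Set (Space d)) {a : ℝ} (ha : 0 < a) :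
    (fun y => a • y) '' ((fun y => a⁻¹ • y) '' K) = K := by
  simp [smul_smul, ha.ne']

theorem image_inv_smul_image_smul (K : Set (Space d)) {a : ℝ} (ha : 0 < a) :
    (fun y => a⁻¹ • y) '' ((fun y => a • y) '' K) = K := by
  simp [smul_smul, ha.ne']

/-- The faces of a dilate of a polytope are the dilates of its faces. -/
def dilateEquiv {a : ℝ} (ha : 0 < a)
    (hQ : (Q : Set (Space d)) = (fun y => a • y) '' (P : Set (Space d))) (m : ℕ) :
    Face P m ≃ Face Q m where
  toFun F := ⟨(fun y => a • y) '' (F : Set (Space d)), (F.isFace.dilate ha).1,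
    hQ ▸ (F.isFace.dilate ha).2, by rw [vectorSpan_dilate _ ha, F.finrank_vectorSpan]⟩
  invFun G := ⟨(fun y => a⁻¹ • y) '' (G : Set (Space d)), (G.isFace.dilate (inv_pos.2 ha)).1, by
    have := (G.isFace.dilate (inv_pos.2 ha)).2
    rwa [hQ, image_inv_smul_image_smul _ ha] at this, by
    rw [vectorSpan_dilate _ (inv_pos.2 ha), G.finrank_vectorSpan]⟩
  left_inv F := carrier_injective (image_inv_smul_image_smul _ ha)
  right_inv F := carrier_injective (image_smul_image_inv_smul _ ha)

theorem carrier_dilateEquiv {a : ℝ} (ha : 0 < a)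
    (hQ : (Q : Set (Space d)) = (fun y => a • y) '' (P : Set (Space d))) (F : Face P m) :
    (dilateEquiv ha hQ m F : Set (Space d)) = (fun y => a • y) '' (F : Set (Space d)) := rfl

theorem measure_dilateEquiv {a : ℝ} (ha : 0 < a)
    (hQ : (Q : Set (Space d)) = (fun y => a • y) '' (P : Set (Space d))) (F : Face P m)
    (A : Set (Space d)) :
    (dilateEquiv ha hQ m F).measure ((fun y => a • y) '' A) =
      ENNReal.ofReal (a ^ m) * F.measure A := by
  rw [measure_apply, measure_apply, carrier_dilateEquiv,
    ← image_inter (smul_right_injective _ ha.ne')]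
  have := Measure.euclideanHausdorffMeasure_smul₀ (E := Space d) m ha.ne'
    (A ∩ (F : Set (Space d)))
  rw [image_smul, this, ENNReal.smul_def, smul_eq_mul]
  congr 1
  rw [ENNReal.ofReal, ENNReal.coe_inj, Real.toNNReal_pow ha.le]
  congr 1
  ext
  simp [ha.le, abs_of_pos ha]

theorem sphericalNormals_dilateEquiv {a : ℝ} (ha : 0 < a)
    (hQ : (Q : Set (Space d)) = (fun y => a • y) '' (P : Set (Space d))) (F : Face P m) :
    sphericalNormals Q.carrier (dilateEquiv ha hQ m F).carrier =
      sphericalNormals P.carrier F.carrier := by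
  obtain ⟨p, hp⟩ := F.exists_mem_intrinsicInterior
  have hp' : a • p ∈ intrinsicInterior ℝ (dilateEquiv ha hQ m F : Set (Space d)) := by
    rw [carrier_dilateEquiv, intrinsicInterior_dilate _ ha]
    exact mem_image_of_mem _ hp
  rw [sphericalNormals_eq Q.isPolyhedral (Face.isFace _) hp',
    sphericalNormals_eq P.isPolyhedral F.isFace hp, hQ, dirCone_dilate _ ha]

end Face

theorem isHomogeneous_homogeneousPart (Φ : Polytope d → SignedMeasure (Space d)) (j : ℕ) :
    IsHomogeneous j (homogeneousPart Φ j) := by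
  intro a P A ha hA
  have hA' : MeasurableSet ((fun y => a • y) '' A) :=
    (MeasurableEquiv.smul₀ a ha.ne').measurableSet_image.2 hA
  rw [homogeneousPart, homogeneousPart, sum_smul_toSignedMeasure_apply _ _ hA,
    sum_smul_toSignedMeasure_apply _ _ hA', Finset.mul_sum,
    ← (Face.dilateEquiv ha (P.carrier_dilate a) j).sum_comp]
  refine Finset.sum_congr rfl fun F _ => ?_
  rw [Face.sphericalNormals_dilateEquiv, measureReal_def, Face.measure_dilateEquiv,
    ENNReal.toReal_mul, ENNReal.toReal_ofReal (by positivity), ← measureReal_def]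
  ring

/-! #### Faces of full dimension -/

theorem Face.vectorSpan_eq_top {P : Polytope d} (F : Face P d) :
    vectorSpan ℝ (F : Set (Space d)) = ⊤ :=
  Submodule.eq_top_of_finrank_eq (by rw [F.finrank_vectorSpan]; simp)

theorem Face.dirCone_eq_univ {P : Polytope d} (F : Face P d) {p : Space d}
    (hp : p ∈ intrinsicInterior ℝ (F : Set (Space d))) :
    dirCone (P : Set (Space d)) p = univ := by
  refine eq_univ_of_forall fun v => ?_
  have hv : v ∈ lineality (P : Set (Space d)) p := by
    rw [← F.isFace.vectorSpan_eq P.isPolyhedral hp, F.vectorSpan_eq_top]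
    trivial
  exact ((P.isPolyhedral.mem_lineality_iff (F.isFace.mem hp)).1 hv).1

theorem Face.carrier_eq_of_full {P : Polytope d} (F : Face P d) :
    (F : Set (Space d)) = P := by
  obtain ⟨p, hp⟩ := F.exists_mem_intrinsicInterior
  have h := F.isFace.eq_minFace P.isPolyhedral hp
  rw [h]
  ext x
  rw [mem_minFace, ← F.isFace.vectorSpan_eq P.isPolyhedral hp, F.vectorSpan_eq_top]
  simp

theorem Face.sphericalNormals_full {P : Polytope d} (F : Face P d) :
    sphericalNormals P.carrier F.carrier = ∅ := by
  obtain ⟨p, hp⟩ := F.exists_mem_intrinsicInterior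
  rw [sphericalNormals_eq P.isPolyhedral F.isFace hp, F.dirCone_eq_univ hp]
  refine eq_empty_of_forall_notMem fun u hu => ?_
  have h1 := hu.1 u (mem_univ _)
  have h2 : ‖u‖ = 1 := by simpa using hu.2
  rw [real_inner_self_eq_norm_sq, h2] at h1
  norm_num at h1

/-- Either P is its own only d-face, or P lies in a proper affine subspace and both sides vanish. -/
theorem sum_measureReal_full (P : Polytope d) (A : Set (Space d)) :
    ∑ F : Face P d, F.measure.real A = volume.real ((P : Set (Space d)) ∩ A) := by
  by_cases hex : Nonempty (Face P d)
  · obtain ⟨F⟩ := hex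
    have : Unique (Face P d) := ⟨⟨F⟩, fun G => Face.carrier_injective
      (by rw [G.carrier_eq_of_full, Face.carrier_eq_of_full])⟩
    rw [Fintype.sum_unique, measureReal_def, Face.measure_apply, Face.carrier_eq_of_full,
      EuclideanSpace.euclideanHausdorffMeasure_eq_volume, inter_comm, measureReal_def]
  · rw [not_nonempty_iff] at hex
    rw [Fintype.sum_empty]
    symm
    have h0 : volume (P : Set (Space d)) = 0 := by
      refine measure_mono_null (subset_affineSpan ℝ _) (Measure.addHaar_affineSubspace volume
        (affineSpan ℝ (P : Set (Space d))) fun htop => ?_)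
      have hPP : IsFace (P : Set (Space d)) P :=
        ⟨P.nonempty, fun _ => ⟨0, by ext; simp⟩⟩
      refine hex.false ⟨P, hPP.1, hPP.2, ?_⟩
      rw [← direction_affineSpan, htop, AffineSubspace.direction_top]
      simp
    rw [measureReal_def, measure_mono_null inter_subset_left h0, ENNReal.toReal_zero]

theorem IsLocalExtension.isHomogeneousDecomposition {φ : Polytope d → ℝ}
    {Φ : Polytope d → SignedMeasure (Space d)} (h : IsLocalExtension φ Φ) :
    IsHomogeneousDecomposition Φ (homogeneousPart Φ) where
  homogeneous j _ := isHomogeneous_homogeneousPart Φ j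
  sum_eq := h.eq_sum_homogeneousPart
  top := by
    refine ⟨assocFun Φ d ∅, fun P A hA => ?_⟩
    rw [homogeneousPart, sum_smul_toSignedMeasure_apply _ _ hA, ← sum_measureReal_full,
      Finset.mul_sum]
    exact Finset.sum_congr rfl fun F _ => by rw [F.sphericalNormals_full]

theorem isAssociated_homogeneousPart (Φ : Polytope d → SignedMeasure (Space d)) :
    IsAssociated (homogeneousPart Φ) (assocFun Φ) := fun _ _ _ => rfl

/-! ### Uniqueness -/

/-- Evaluated at dilates of P and A by a > 0, the difference of the two decompositions is a
polynomial in a with infinitely many roots, so each coefficient vanishes. -/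
theorem IsHomogeneousDecomposition.unique {Φ : Polytope d → SignedMeasure (Space d)}
    {Φh Φh' : ℕ → Polytope d → SignedMeasure (Space d)} (h : IsHomogeneousDecomposition Φ Φh)
    (h' : IsHomogeneousDecomposition Φ Φh') {j : ℕ} (hj : j ≤ d) : Φh j = Φh' j := by
  funext P
  refine VectorMeasure.ext fun A hA => ?_
  let p : Polynomial ℝ := ∑ i ∈ Finset.range (d + 1),
    Polynomial.monomial i (Φh i P A - Φh' i P A)
  have hroot : ∀ a : ℝ, 0 < a → p.IsRoot a := by
    intro a ha
    have h1 := congrArg (fun s : SignedMeasure (Space d) => s ((fun y => a • y) '' A))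
      ((h.sum_eq (P.dilate a)).symm.trans (h'.sum_eq (P.dilate a)))
    simp only [sum_apply] at h1
    have h2 : ∀ i ∈ Finset.range (d + 1),
        (Polynomial.monomial i (Φh i P A - Φh' i P A)).eval a =
          Φh i (P.dilate a) ((fun y => a • y) '' A) -
            Φh' i (P.dilate a) ((fun y => a • y) '' A) := by
      intro i hi
      have hid : i ≤ d := Nat.lt_succ_iff.1 (Finset.mem_range.1 hi)
      rw [h.homogeneous i hid a P A ha hA, h'.homogeneous i hid a P A ha hA,
        Polynomial.eval_monomial]
      ring
    rw [Polynomial.IsRoot, Polynomial.eval_finsetSum, Finset.sum_congr rfl h2,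
      Finset.sum_sub_distrib, h1, sub_self]
  have hp : p = 0 := Polynomial.eq_zero_of_infinite_isRoot p
    ((Set.Ioi_infinite (0 : ℝ)).mono fun a ha => hroot a ha)
  have hc := congrArg (fun q => Polynomial.coeff q j) hp
  simp only [p, Polynomial.finsetSum_coeff, Polynomial.coeff_monomial, Polynomial.coeff_zero,
    Finset.sum_ite_eq', Finset.mem_range, Nat.lt_succ_iff, hj, if_true] at hc
  linarith

theorem sum_smul_apply_intrinsicInterior {P : Polytope d} {m : ℕ} (c : Face P m → ℝ)
    (F : Face P m) :
    (∑ G : Face P m, c G • G.measure.toSignedMeasure : SignedMeasure (Space d))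
      (intrinsicInterior ℝ (F : Set (Space d))) =
      c F * F.measure.real (intrinsicInterior ℝ (F : Set (Space d))) := by
  rw [sum_smul_toSignedMeasure_apply _ _ (measurableSet_intrinsicInterior _)]
  refine Finset.sum_eq_single F (fun G _ hG => ?_) fun h => absurd (Finset.mem_univ _) h
  rw [measureReal_def, Face.measure_intrinsicInterior_eq_zero hG.symm, ENNReal.toReal_zero,
    mul_zero]

/-- On the relative interior of F only the summand of F survives, and its measure there is positive.
-/
theorem IsAssociated.unique {Φh : ℕ → Polytope d → SignedMeasure (Space d)}
    {f f' : ℕ → Set (Space d) → ℝ} (h : IsAssociated Φh f) (h' : IsAssociated Φh f') {j : ℕ}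
    (hj : j ≤ d) (P : Polytope d) (F : Face P j) :
    f j (sphericalNormals P.carrier F.carrier) = f' j (sphericalNormals P.carrier F.carrier) := by
  have h1 := congrArg (fun s : SignedMeasure (Space d) =>
    s (intrinsicInterior ℝ (F : Set (Space d)))) ((h j hj P).symm.trans (h' j hj P))
  simp only [sum_smul_apply_intrinsicInterior] at h1
  exact mul_right_cancel₀ F.measureReal_intrinsicInterior_pos.ne' h1

end

section

section

variable {E : Type*} [NormedAddCommGroup E] [InnerProductSpace ℝ E] [FiniteDimensional ℝ E]
  [MeasurableSpace E] [BorelSpace E] {S : Type*} [Fintype S] [DecidableEq S]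

/-! ### Integration over the fibres of a linear map -/

/-- The inner products with the v s are linear coordinates on the span of v, and their Jacobian is
the square root of the Gram determinant. -/
theorem lintegral_span_eq {v : S → E} (hv : LinearIndependent ℝ v) :
    ∃ e : Submodule.span ℝ (range v) ≃ₗ[ℝ] (S → ℝ), (∀ q s, e q s = ⟪v s, q⟫) ∧
      ∀ h : Submodule.span ℝ (range v) → ENNReal, Measurable h →
        ENNReal.ofReal √(Matrix.gram ℝ v).det * ∫⁻ q, h q = ∫⁻ w, h (e.symm w) := by
  set W := Submodule.span ℝ (range v)
  have hfin : finrank ℝ W = Fintype.card S := finrank_span_eq_card hv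
  have hvW : ∀ s, v s ∈ W := fun s => Submodule.subset_span (mem_range_self s)
  let M₀ : W →ₗ[ℝ] (S → ℝ) := LinearMap.pi fun s => (innerₗ E (v s)) ∘ₗ W.subtype
  have hM₀ : ∀ q s, M₀ q s = ⟪v s, q⟫ := fun q s => rfl
  have hinj : Function.Injective M₀ := by
    rw [← LinearMap.ker_eq_bot, LinearMap.ker_eq_bot']
    intro q hq
    have h1 : (q : E) ∈ Wᗮ := by
      rw [Submodule.mem_orthogonal]
      intro u hu
      induction hu using Submodule.span_induction with
      | mem x hx =>
        obtain ⟨s, rfl⟩ := hx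
        rw [← hM₀, hq]
        rfl
      | zero => simp
      | add x y _ _ hx hy => rw [inner_add_left, hx, hy, add_zero]
      | smul c x _ hx => rw [real_inner_smul_left, hx, mul_zero]
    have h2 := Submodule.inner_left_of_mem_orthogonal q.2 h1
    rw [inner_self_eq_zero] at h2
    exact Subtype.ext h2
  let e : W ≃ₗ[ℝ] (S → ℝ) := LinearMap.linearEquivOfInjective M₀ hinj (by simp [hfin])
  have he : ∀ q s, e q s = ⟪v s, q⟫ := fun q s => hM₀ q s
  refine ⟨e, he, fun h hh => ?_⟩
  let M : W →ₗ[ℝ] EuclideanSpace ℝ S :=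
    (WithLp.linearEquiv 2 ℝ (S → ℝ)).symm.toLinearMap ∘ₗ M₀
  have hdet : M.normDet = √(Matrix.gram ℝ v).det := by
    let b : OrthonormalBasis S ℝ W := (stdOrthonormalBasis ℝ W).reindex
      (finCongr hfin |>.trans (Fintype.equivFin S).symm)
    -- With the square matrix A of inner products of v and b, the Gram matrix of the images M b is
    -- Aᵀ A and, by Parseval, that of v is A Aᵀ; both have the same determinant.
    have h1 : M.normDet ^ 2 = (Matrix.gram ℝ (M <| b ·)).det := M.normDet_sq_eq_det_gram b
    let A : Matrix S S ℝ := Matrix.of fun s i => ⟪v s, b i⟫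
    have h2 : Matrix.gram ℝ (M <| b ·) = A.transpose * A := by
      ext i j
      simp only [Matrix.gram_apply, Matrix.mul_apply, Matrix.transpose_apply, A, Matrix.of_apply,
        PiLp.inner_apply]
      refine Finset.sum_congr rfl fun s _ => ?_
      change ⟪⟪v s, b i⟫, ⟪v s, b j⟫⟫ = _
      simp [mul_comm]
    have h3 : Matrix.gram ℝ v = A * A.transpose := by
      ext s t
      simp only [Matrix.gram_apply, Matrix.mul_apply, Matrix.transpose_apply, A, Matrix.of_apply]
      have := b.sum_inner_mul_inner ⟨v s, hvW s⟩ ⟨v t, hvW t⟩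
      simp only [Submodule.coe_inner] at this
      rw [← this]
      exact Finset.sum_congr rfl fun i _ => by rw [real_inner_comm (b i : E) (v t)]
    rw [h2, Matrix.det_mul, mul_comm, ← Matrix.det_mul, ← h3] at h1
    rw [← h1, Real.sqrt_sq M.normDet_nonneg]
  have hmeas : Measurable e :=
    (LinearMap.continuous_of_finiteDimensional e.toLinearMap).measurable
  have hmeas' : Measurable e.symm :=
    (LinearMap.continuous_of_finiteDimensional e.symm.toLinearMap).measurable
  have hmap : Measure.map e (ENNReal.ofReal √(Matrix.gram ℝ v).det • volume) = volume := by
    ext B hB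
    rw [Measure.map_apply hmeas hB, Measure.smul_apply, smul_eq_mul, ← hdet,
      ← M.euclideanHausdorffMeasure_image_eq_normDet_mul_volume]
    have h1 : finrank ℝ W = finrank ℝ (EuclideanSpace ℝ S) := by simp [hfin]
    rw [h1, InnerProductSpace.euclideanHausdorffMeasure_eq_volume]
    have h2 : M '' (e ⁻¹' B) = WithLp.ofLp ⁻¹' B := by
      ext z
      constructor
      · rintro ⟨q, hq, rfl⟩
        exact hq
      · intro hz
        refine ⟨e.symm (WithLp.ofLp z), by simpa using hz, ?_⟩
        have : M₀ (e.symm (WithLp.ofLp z)) = WithLp.ofLp z := e.apply_symm_apply _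
        change WithLp.toLp 2 (M₀ (e.symm (WithLp.ofLp z))) = z
        rw [this]
    rw [h2, (PiLp.volume_preserving_ofLp S).measure_preimage hB.nullMeasurableSet]
  have hcomp : Measurable fun w => h (e.symm w) := hh.comp hmeas'
  rw [← hmap, lintegral_map hcomp hmeas, lintegral_smul_measure, smul_eq_mul]
  simp

/-- The coarea formula for the linear map whose coordinates are the inner products with the
vectors of a linearly independent family `v`. -/
theorem lintegral_eq_lintegral_fibers {v : S → E} (hv : LinearIndependent ℝ v) :
    ∃ σ : (S → ℝ) →ₗ[ℝ] E, (∀ w s, ⟪v s, σ w⟫ = w s) ∧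
      (∀ w, σ w ∈ Submodule.span ℝ (range v)) ∧
      ∀ g : E → ENNReal, Measurable g →
        ENNReal.ofReal √(Matrix.gram ℝ v).det * ∫⁻ z, g z =
          ∫⁻ w, ∫⁻ t : (Submodule.span ℝ (range v))ᗮ, g (σ w + t) := by
  obtain ⟨e, he, hint⟩ := lintegral_span_eq hv
  refine ⟨(Submodule.subtype _) ∘ₗ e.symm.toLinearMap, fun w s => ?_, fun w => (e.symm w).2,
    fun g hg => ?_⟩
  · have := he (e.symm w) s
    rw [e.apply_symm_apply] at this
    exact this.symm
  · set W := Submodule.span ℝ (range v)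
    have hmp := (W.measurePreserving_measurableEquivProd (0 : E)).symm
    rw [InnerProductSpace.euclideanHausdorffMeasure_eq_volume] at hmp
    have hG : Measurable fun q : W × Wᗮ => g ((q.1 : E) + q.2) :=
      hg.comp ((measurable_subtype_coe.comp measurable_fst).add
        (measurable_subtype_coe.comp measurable_snd))
    have h1 : ∫⁻ z, g z = ∫⁻ q : W, ∫⁻ t : Wᗮ, g (q + t) := by
      rw [← hmp.lintegral_comp hg]
      simp only [Submodule.measurableEquivProd_symm_apply, vadd_eq_add, add_zero]
      rw [Measure.volume_eq_prod, lintegral_prod _ hG.aemeasurable]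
    rw [h1, hint _ hG.lintegral_prod_right']
    rfl

end

end

/-! ### Translation vectors and frames of normals -/

section

/-- The translation vectors `(0, x_1, …, x_n)`. -/
def consZero {E : Type*} [Zero E] {n : ℕ} (x : Fin n → E) : Fin (n + 1) → E := Fin.cons 0 x

theorem continuous_consZero {E : Type*} [Zero E] [TopologicalSpace E] {n : ℕ} (i : Fin (n + 1)) :
    Continuous fun x : Fin n → E => consZero x i := by
  refine Fin.cases ?_ (fun j => ?_) i
  · exact continuous_const
  · exact continuous_apply j

/-- The first set is never moved. Displacing set i by y i for every i is thus, up to the common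
translation by y 0, a shift of the free translation vectors. -/
theorem consZero_add {E : Type*} [AddCommGroup E] {n : ℕ} (x : Fin n → E)
    (y : Fin (n + 1) → E) (i : Fin (n + 1)) :
    consZero (x + fun j => y j.succ - y 0) i = consZero x i + (y i - y 0) := by
  refine Fin.cases ?_ (fun j => ?_) i
  · simp [consZero]
  · simp [consZero]

section

variable {E : Type*} [NormedAddCommGroup E] [InnerProductSpace ℝ E] [FiniteDimensional ℝ E]

/-- The union of orthonormal bases of the orthogonal complements of subspaces. -/
def normalFrame {ι : Type*} (L : ι → Submodule ℝ E) (p : (i : ι) × Fin (finrank ℝ (L i)ᗮ)) : E :=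
  stdOrthonormalBasis ℝ (L p.1)ᗮ p.2

theorem span_orthonormalBasis (N : Submodule ℝ E) :
    Submodule.span ℝ (range fun r => (stdOrthonormalBasis ℝ N r : E)) = N := by
  have h := (stdOrthonormalBasis ℝ N).toBasis.span_eq
  have h2 := congrArg (Submodule.map N.subtype) h
  rw [Submodule.map_span, Submodule.map_top, Submodule.range_subtype, ← range_comp] at h2
  simpa [Function.comp_def] using h2

theorem mem_orthogonal_iff_frame {N : Submodule ℝ E} {x : E} :
    x ∈ Nᗮ ↔ ∀ r, ⟪(stdOrthonormalBasis ℝ N r : E), x⟫ = 0 := by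
  conv_lhs => rw [← span_orthonormalBasis N]
  rw [Submodule.mem_orthogonal]
  constructor
  · exact fun h r => h _ (Submodule.subset_span (mem_range_self r))
  · intro h u hu
    induction hu using Submodule.span_induction with
    | mem x hx =>
      obtain ⟨s, rfl⟩ := hx
      exact h s
    | zero => simp
    | add x y _ _ hx hy => rw [inner_add_left, hx, hy, add_zero]
    | smul c x _ hx => rw [real_inner_smul_left, hx, mul_zero]

theorem span_normalFrame {ι : Type*} (L : ι → Submodule ℝ E) :
    Submodule.span ℝ (range (normalFrame L)) = ⨆ i, (L i)ᗮ := by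
  have : range (normalFrame L) = ⋃ i, range fun r => (stdOrthonormalBasis ℝ (L i)ᗮ r : E) := by
    ext x
    simp [normalFrame]
  rw [this, Submodule.span_iUnion]
  exact iSup_congr fun i => span_orthonormalBasis _

theorem orthogonal_span_normalFrame {ι : Type*} (L : ι → Submodule ℝ E) :
    (Submodule.span ℝ (range (normalFrame L)))ᗮ = ⨅ i, L i := by
  rw [span_normalFrame, ← Submodule.iInf_orthogonal]
  exact iInf_congr fun i => Submodule.orthogonal_orthogonal _

end

section

variable {E : Type*} [NormedAddCommGroup E] [InnerProductSpace ℝ E] [FiniteDimensional ℝ E]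
  [MeasurableSpace E] [BorelSpace E]

/-! ### Translative integral formulas for subsets of affine subspaces -/

/-- The volume of the set of translation vectors and points in a common intersection. -/
theorem lintegral_volume_iInter_translate {n : ℕ} {B : Fin (n + 1) → Set E}
    (hB : ∀ i, MeasurableSet (B i)) :
    ∫⁻ x : Fin n → E, volume {p : E | ∀ i, p - consZero x i ∈ B i} = ∏ i, volume (B i) := by
  have hT : MeasurableSet {q : (Fin n → E) × E | ∀ i, q.2 - consZero q.1 i ∈ B i} := by
    simp only [ofPred_forall]
    exact MeasurableSet.iInter fun i => (measurable_snd.sub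
      ((continuous_consZero i).measurable.comp measurable_fst)) (hB i)
  rw [Fin.prod_univ_succ]
  refine lintegral_measure_section volume volume hT (hB 0) ?_ ?_
  · intro p hp
    have h1 : {y : Fin n → E | (y, p) ∈ {q : (Fin n → E) × E | ∀ i, q.2 - consZero q.1 i ∈ B i}} =
        univ.pi fun i => (fun y => p - y) ⁻¹' B i.succ := by
      ext y
      simp [Fin.forall_fin_succ, consZero, hp]
    rw [h1, volume_pi_pi]
    exact Finset.prod_congr rfl fun i _ =>
      (Measure.measurePreserving_sub_left volume p).measure_preimage (hB i.succ).nullMeasurableSet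
  · intro p hp y hy
    exact hp (by simpa [consZero] using hy 0)

theorem cube_eq_pi (S : Type*) :
    {w : S → ℝ | ∀ s, w s ∈ Icc (0 : ℝ) 1} = univ.pi fun _ => Icc (0 : ℝ) 1 := by
  ext w
  rw [mem_univ_pi]
  rfl

theorem volume_cube (S : Type*) [Fintype S] :
    volume {w : S → ℝ | ∀ s, w s ∈ Icc (0 : ℝ) 1} = 1 := by
  rw [cube_eq_pi, volume_pi_pi]
  simp

theorem measurableSet_cube (S : Type*) [Fintype S] :
    MeasurableSet {w : S → ℝ | ∀ s, w s ∈ Icc (0 : ℝ) 1} := by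
  rw [cube_eq_pi]
  exact MeasurableSet.univ_pi fun _ => measurableSet_Icc

/-- The product of a subset of `L` and the unit cube in the orthogonal complement. -/
def thicken (L : Submodule ℝ E) (B : Set E) : Set E :=
  {z | L.starProjection z ∈ B ∧ ∀ r, ⟪(stdOrthonormalBasis ℝ Lᗮ r : E), z⟫ ∈ Icc (0 : ℝ) 1}

theorem measurableSet_thicken (L : Submodule ℝ E) {B : Set E} (hB : MeasurableSet B) :
    MeasurableSet (thicken L B) := by
  refine (L.starProjection.continuous.measurable hB).inter ?_
  exact (by fun_prop : Measurable fun (z : E) r => ⟪(stdOrthonormalBasis ℝ Lᗮ r : E), z⟫)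
    (measurableSet_cube _)

/-- Coarea for an orthonormal basis of Lᗮ: the Gram determinant is 1, each fibre over the unit cube
is a copy of B, and the cube has volume 1. -/
theorem volume_thicken (L : Submodule ℝ E) {B : Set E} (hB : MeasurableSet B) (hBL : B ⊆ L) :
    volume (thicken L B) = μHE[finrank ℝ L] B := by
  set v : Fin (finrank ℝ Lᗮ) → E := fun r => (stdOrthonormalBasis ℝ Lᗮ r : E) with hv
  have hort : Orthonormal ℝ v :=
    (stdOrthonormalBasis ℝ Lᗮ).orthonormal.comp_linearIsometry Lᗮ.subtypeₗᵢ
  obtain ⟨σ, hσ, hσs, hint⟩ := lintegral_eq_lintegral_fibers hort.linearIndependent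
  have hspan : Submodule.span ℝ (range v) = Lᗮ := span_orthonormalBasis Lᗮ
  have hJ : (Submodule.span ℝ (range v))ᗮ = L := by rw [hspan, Submodule.orthogonal_orthogonal]
  have hg := hint ((thicken L B).indicator 1)
    (measurable_one.indicator (measurableSet_thicken L hB))
  rw [Matrix.gram_eq_one_iff_orthonormal.2 hort, Matrix.det_one, Real.sqrt_one,
    ENNReal.ofReal_one, one_mul, lintegral_indicator_one (measurableSet_thicken L hB)] at hg
  have hBv := euclideanHausdorffMeasure_eq_volume_of_sub_mem (Submodule.span ℝ (range v))ᗮ 0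
    (A := B) fun x hx => by
      rw [hJ, sub_zero]
      exact hBL hx
  have hmem : ∀ w (t : (Submodule.span ℝ (range v))ᗮ), σ w + (t : E) ∈ thicken L B ↔
      w ∈ {w : Fin (finrank ℝ Lᗮ) → ℝ | ∀ s, w s ∈ Icc (0 : ℝ) 1} ∧
        t ∈ {t : (Submodule.span ℝ (range v))ᗮ | 0 + (t : E) ∈ B} := by
    intro w t
    have ht : (t : E) ∈ L := hJ.le t.2
    have h1 : L.starProjection (σ w + t) = t := by
      rw [map_add, Submodule.starProjection_eq_self_iff.2 ht,
        (Submodule.starProjection_apply_eq_zero_iff (K := L)).2 (hspan.le (hσs w)), zero_add]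
    have h2 : ∀ r, ⟪v r, σ w + t⟫ = w r := fun r => by
      rw [inner_add_right, hσ, real_inner_comm,
        Submodule.inner_right_of_mem_orthogonal ht (stdOrthonormalBasis ℝ Lᗮ r).2, add_zero]
    have h3 : σ w + (t : E) ∈ thicken L B ↔
        L.starProjection (σ w + t) ∈ B ∧ ∀ r, ⟪v r, σ w + t⟫ ∈ Icc (0 : ℝ) 1 := Iff.rfl
    rw [h3, h1]
    simp only [h2, mem_ofPred_eq, zero_add]
    exact and_comm
  have hinner : ∀ w, ∫⁻ t : (Submodule.span ℝ (range v))ᗮ,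
      (thicken L B).indicator (1 : E → ENNReal) (σ w + t) =
      {w : Fin (finrank ℝ Lᗮ) → ℝ | ∀ s, w s ∈ Icc (0 : ℝ) 1}.indicator
        (fun _ => volume {t : (Submodule.span ℝ (range v))ᗮ | 0 + (t : E) ∈ B}) w := by
    intro w
    have hm : MeasurableSet {t : (Submodule.span ℝ (range v))ᗮ | 0 + (t : E) ∈ B} :=
      (measurable_subtype_coe.const_add 0) hB
    by_cases hw : w ∈ {w : Fin (finrank ℝ Lᗮ) → ℝ | ∀ s, w s ∈ Icc (0 : ℝ) 1}
    · rw [indicator_of_mem hw, ← lintegral_indicator_one hm]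
      refine lintegral_congr fun t => ?_
      by_cases ht : t ∈ {t : (Submodule.span ℝ (range v))ᗮ | 0 + (t : E) ∈ B}
      · rw [indicator_of_mem ht, indicator_of_mem ((hmem w t).2 ⟨hw, ht⟩)]
        rfl
      · rw [indicator_of_notMem ht, indicator_of_notMem fun h => ht ((hmem w t).1 h).2]
    · rw [indicator_of_notMem hw]
      refine (lintegral_congr fun t => ?_).trans lintegral_zero
      exact indicator_of_notMem (fun h => hw ((hmem w t).1 h).1) _
  rw [lintegral_congr hinner, lintegral_indicator_const (measurableSet_cube _), volume_cube,
    mul_one, ← hBv] at hg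
  rw [hg, hJ]

end

end

section

section

variable {E : Type*} [NormedAddCommGroup E] [InnerProductSpace ℝ E] [FiniteDimensional ℝ E]
  [MeasurableSpace E] [BorelSpace E]

/-- The translative integral formula for subsets `B i` of linear subspaces `L i` with linearly
independent orthogonal complements; the integrand is the volume of `⋂ i, (B i + x i)`. -/
theorem lintegral_measure_iInter_translate_of_subset {n : ℕ} {L : Fin (n + 1) → Submodule ℝ E}
    (hL : LinearIndependent ℝ (normalFrame L)) {B : Fin (n + 1) → Set E}
    (hB : ∀ i, MeasurableSet (B i)) (hBL : ∀ i, B i ⊆ L i) :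
    (Measurable fun x : Fin n → E =>
      μHE[finrank ℝ (⨅ i, L i : Submodule ℝ E)] {p : E | ∀ i, p - consZero x i ∈ B i}) ∧
    ∫⁻ x : Fin n → E,
      μHE[finrank ℝ (⨅ i, L i : Submodule ℝ E)] {p : E | ∀ i, p - consZero x i ∈ B i} =
      ENNReal.ofReal √(Matrix.gram ℝ (normalFrame L)).det * ∏ i, μHE[finrank ℝ (L i)] (B i) := by
  obtain ⟨σ, hσ, hσs, hint⟩ := lintegral_eq_lintegral_fibers hL
  set v := normalFrame L with hv
  set W := Submodule.span ℝ (range v) with hW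
  set D := ENNReal.ofReal √(Matrix.gram ℝ v).det
  have hJ : Wᗮ = ⨅ i, L i := orthogonal_span_normalFrame L
  have hσc : Continuous σ := LinearMap.continuous_of_finiteDimensional σ
  -- the right inverse is determined by its coordinates
  have hσu : ∀ q ∈ W, ∀ w, (∀ s, ⟪v s, q⟫ = w s) → σ w = q := by
    intro q hq w hw
    have h1 : σ w - q ∈ Wᗮ := by
      rw [hW, Submodule.mem_orthogonal]
      intro u hu
      induction hu using Submodule.span_induction with
      | mem x hx =>
        obtain ⟨s, rfl⟩ := hx
        rw [inner_sub_right, hσ, hw, sub_self]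
      | zero => simp
      | add x y _ _ hx hy => rw [inner_add_left, hx, hy, add_zero]
      | smul c x _ hx => rw [real_inner_smul_left, hx, mul_zero]
    have h2 := Submodule.inner_right_of_mem_orthogonal (sub_mem (hσs w) hq) h1
    rw [inner_self_eq_zero] at h2
    exact sub_eq_zero.1 h2
  let M : (Fin (n + 1) → E) → ((i : Fin (n + 1)) × Fin (finrank ℝ (L i)ᗮ)) → ℝ :=
    fun x s => ⟪v s, x s.1⟫
  -- the volume of the part of a fibre in the intersection
  let V : E × (Fin n → E) → ENNReal := fun q =>
    volume {t : Wᗮ | ∀ i, (L i).starProjection (q.1 + t - consZero q.2 i) ∈ B i}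
  have hVset : MeasurableSet {q : (E × (Fin n → E)) × Wᗮ |
      ∀ i, (L i).starProjection (q.1.1 + q.2 - consZero q.1.2 i) ∈ B i} := by
    simp only [ofPred_forall]
    refine MeasurableSet.iInter fun i => Continuous.measurable ?_ (hB i)
    have := continuous_consZero (E := E) i
    fun_prop
  have hVm : Measurable V := measurable_measure_prodMk_left hVset
  have hMc : Continuous fun x : Fin n → E => M (consZero x) := by
    exact continuous_pi fun s => continuous_const.inner (continuous_consZero s.1)
  set C := {w : ((i : Fin (n + 1)) × Fin (finrank ℝ (L i)ᗮ)) → ℝ | ∀ s, w s ∈ Icc (0 : ℝ) 1}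
  have hC : MeasurableSet C := measurableSet_cube _
  -- the integrand as the volume of a fibre
  have hfib : ∀ x : Fin n → E,
      μHE[finrank ℝ (⨅ i, L i : Submodule ℝ E)] {p : E | ∀ i, p - consZero x i ∈ B i} =
        V (σ (M (consZero x)), x) := by
    intro x
    have hmemW : ∀ p : E, (∀ i, p - consZero x i ∈ L i) ↔ p - σ (M (consZero x)) ∈ Wᗮ := by
      intro p
      constructor
      · intro h
        rw [hW, Submodule.mem_orthogonal]
        intro u hu
        induction hu using Submodule.span_induction with
        | mem y hy =>
          obtain ⟨s, rfl⟩ := hy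
          have h1 : ⟪v s, p - consZero x s.1⟫ = 0 := by
            rw [real_inner_comm]
            exact Submodule.inner_right_of_mem_orthogonal (h s.1)
              (stdOrthonormalBasis ℝ (L s.1)ᗮ s.2).2
          rw [inner_sub_right] at h1
          rw [inner_sub_right, hσ]
          exact h1
        | zero => simp
        | add x y _ _ hx hy => rw [inner_add_left, hx, hy, add_zero]
        | smul c x _ hx => rw [real_inner_smul_left, hx, mul_zero]
      · intro h i
        rw [← Submodule.orthogonal_orthogonal (L i), mem_orthogonal_iff_frame]
        intro r
        have h1 : ⟪v ⟨i, r⟩, p - σ (M (consZero x))⟫ = 0 :=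
          Submodule.inner_right_of_mem_orthogonal (Submodule.subset_span (mem_range_self _)) h
        rw [inner_sub_right, hσ] at h1
        rw [inner_sub_right]
        exact h1
    have h1 := euclideanHausdorffMeasure_eq_volume_of_sub_mem Wᗮ (σ (M (consZero x)))
      (A := {p : E | ∀ i, p - consZero x i ∈ B i}) fun p hp => (hmemW p).1 fun i => hBL i (hp i)
    rw [← hJ, h1]
    change _ = volume {t : Wᗮ | _}
    congr 1
    ext t
    refine forall_congr' fun i => ?_
    have h2 : σ (M (consZero x)) + (t : E) - consZero x i ∈ L i :=
      (hmemW _).2 (by simp) i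
    rw [Submodule.starProjection_eq_self_iff.2 h2]
  have hmeas : Measurable fun x : Fin n → E => V (σ (M (consZero x)), x) :=
    hVm.comp ((hσc.comp hMc).measurable.prodMk measurable_id)
  simp only [hfib]
  refine ⟨hmeas, ?_⟩
  -- The thickened sets have full dimension, so Tonelli suffices, and thickening turns their volumes
  -- into the measures of the B i.
  have hthick := lintegral_volume_iInter_translate fun i => measurableSet_thicken (L i) (hB i)
  rw [Finset.prod_congr rfl fun i _ => volume_thicken (L i) (hB i) (hBL i)] at hthick
  -- fibre integration of the volume of the intersection of the thickened sets
  have hslice : ∀ x : Fin n → E, D * volume {p : E | ∀ i, p - consZero x i ∈ thicken (L i) (B i)} =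
      ∫⁻ w, C.indicator (fun w => V (σ (w + M (consZero x)), x)) w := by
    intro x
    have hm : MeasurableSet {p : E | ∀ i, p - consZero x i ∈ thicken (L i) (B i)} := by
      simp only [ofPred_forall]
      exact MeasurableSet.iInter fun i =>
        (measurable_id.sub_const _) (measurableSet_thicken (L i) (hB i))
    have h1 := hint _ (measurable_one.indicator hm)
    rw [lintegral_indicator_one hm] at h1
    rw [h1, ← lintegral_add_right_eq_self _ (M (consZero x))]
    refine lintegral_congr fun w => ?_
    have hmem : ∀ t : Wᗮ, σ (w + M (consZero x)) + (t : E) ∈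
        {p : E | ∀ i, p - consZero x i ∈ thicken (L i) (B i)} ↔
        w ∈ C ∧ t ∈ {t : Wᗮ | ∀ i,
          (L i).starProjection (σ (w + M (consZero x)) + t - consZero x i) ∈ B i} := by
      intro t
      have hin : ∀ i r, ⟪(stdOrthonormalBasis ℝ (L i)ᗮ r : E),
          σ (w + M (consZero x)) + t - consZero x i⟫ = w ⟨i, r⟩ := by
        intro i r
        have h2 : ⟪v ⟨i, r⟩, (t : E)⟫ = 0 :=
          Submodule.inner_right_of_mem_orthogonal (Submodule.subset_span (mem_range_self _)) t.2
        have h3 : ⟪v ⟨i, r⟩, σ (w + M (consZero x)) + t - consZero x i⟫ = w ⟨i, r⟩ := by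
          rw [inner_sub_right, inner_add_right, hσ, h2, Pi.add_apply]
          simp [M]
        exact h3
      simp only [thicken, mem_ofPred_eq, hin, forall_and, C, Sigma.forall]
      exact and_comm
    have hVm' : MeasurableSet {t : Wᗮ | ∀ i,
        (L i).starProjection (σ (w + M (consZero x)) + t - consZero x i) ∈ B i} :=
      measurable_prodMk_left (x := ((σ (w + M (consZero x)), x) : E × (Fin n → E))) hVset
    by_cases hw : w ∈ C
    · rw [indicator_of_mem hw]
      change _ = volume {t : Wᗮ | _}
      rw [← lintegral_indicator_one hVm']
      refine lintegral_congr fun t => ?_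
      by_cases ht : t ∈ {t : Wᗮ | ∀ i,
          (L i).starProjection (σ (w + M (consZero x)) + t - consZero x i) ∈ B i}
      · rw [indicator_of_mem ht, indicator_of_mem ((hmem t).2 ⟨hw, ht⟩)]
        rfl
      · rw [indicator_of_notMem ht, indicator_of_notMem fun h => ht ((hmem t).1 h).2]
    · rw [indicator_of_notMem hw]
      exact (lintegral_congr fun t => indicator_of_notMem (fun h => hw ((hmem t).1 h).1) _).trans
        lintegral_zero
  have hDm : Measurable fun x : Fin n → E =>
      volume {p : E | ∀ i, p - consZero x i ∈ thicken (L i) (B i)} := by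
    have hT : MeasurableSet {q : (Fin n → E) × E |
        ∀ i, q.2 - consZero q.1 i ∈ thicken (L i) (B i)} := by
      simp only [ofPred_forall]
      exact MeasurableSet.iInter fun i => (measurable_snd.sub
        ((continuous_consZero i).measurable.comp measurable_fst)) (measurableSet_thicken _ (hB i))
    exact measurable_measure_prodMk_left hT
  -- the integral over the translations does not depend on the fibre
  have hshift : ∀ w, ∫⁻ x : Fin n → E, V (σ (w + M (consZero x)), x) =
      ∫⁻ x : Fin n → E, V (σ (M (consZero x)), x) := by
    intro w
    -- The vector y i in (L i)ᗮ has the prescribed coordinates w on the frame of (L i)ᗮ. The fibre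
    -- over w arises from the fibre over 0 by displacing set i by y i, which the orthogonal
    -- projection to L i does not see.
    let y : Fin (n + 1) → E := fun i => ∑ r, w ⟨i, r⟩ • v ⟨i, r⟩
    have hy1 : ∀ i, y i ∈ (L i)ᗮ := fun i => Submodule.sum_mem _ fun r _ =>
      Submodule.smul_mem _ _ (stdOrthonormalBasis ℝ (L i)ᗮ r).2
    have hyW : ∀ i, y i ∈ W := fun i => Submodule.sum_mem _ fun r _ =>
      Submodule.smul_mem _ _ (Submodule.subset_span (mem_range_self _))
    have hy2 : ∀ s, ⟪v s, y s.1⟫ = w s := by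
      rintro ⟨i, r⟩
      have hort : Orthonormal ℝ fun r => (stdOrthonormalBasis ℝ (L i)ᗮ r : E) :=
        (stdOrthonormalBasis ℝ (L i)ᗮ).orthonormal.comp_linearIsometry (L i)ᗮ.subtypeₗᵢ
      exact hort.inner_right_fintype (fun r => w ⟨i, r⟩) r
    rw [← lintegral_add_right_eq_self (fun x : Fin n → E => V (σ (M (consZero x)), x))
      (fun j => y j.succ - y 0)]
    refine lintegral_congr fun x => ?_
    have hσeq : σ (w + M (consZero x)) =
        y 0 + σ (M (consZero (x + fun j => y j.succ - y 0))) := by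
      refine hσu _ (add_mem (hyW 0) (hσs _)) _ fun s => ?_
      rw [inner_add_right, hσ]
      simp only [M, consZero_add, inner_add_right, inner_sub_right, hy2, Pi.add_apply]
      ring
    change volume {t : Wᗮ | _} = volume {t : Wᗮ | _}
    congr 1
    ext t
    refine forall_congr' fun i => ?_
    simp only [hσeq, consZero_add]
    have h0 : (L i).starProjection (y i) = 0 :=
      (Submodule.starProjection_apply_eq_zero_iff (K := L i)).2 (hy1 i)
    have h1 : y 0 + σ (M (consZero (x + fun j => y j.succ - y 0))) + (t : E) - consZero x i =
        (σ (M (consZero (x + fun j => y j.succ - y 0))) + (t : E) -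
          (consZero x i + (y i - y 0))) + y i := by abel
    rw [h1, map_add, h0, add_zero]
  have hswap : AEMeasurable (Function.uncurry fun (x : Fin n → E)
      (w : ((i : Fin (n + 1)) × Fin (finrank ℝ (L i)ᗮ)) → ℝ) =>
      C.indicator (fun w => V (σ (w + M (consZero x)), x)) w) (volume.prod volume) := by
    have h1 : (Function.uncurry fun (x : Fin n → E)
        (w : ((i : Fin (n + 1)) × Fin (finrank ℝ (L i)ᗮ)) → ℝ) =>
        C.indicator (fun w => V (σ (w + M (consZero x)), x)) w) =
        (Prod.snd ⁻¹' C).indicator fun q => V (σ (q.2 + M (consZero q.1)), q.1) := by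
      ext ⟨x, w⟩
      rfl
    rw [h1]
    refine (Measurable.indicator ?_ (measurable_snd hC)).aemeasurable
    exact hVm.comp (((hσc.comp (continuous_snd.add (hMc.comp continuous_fst))).measurable).prodMk
      measurable_fst)
  rw [← hthick, ← lintegral_const_mul _ hDm, lintegral_congr hslice, lintegral_lintegral_swap hswap]
  have hinner : ∀ w, ∫⁻ x : Fin n → E, C.indicator (fun w => V (σ (w + M (consZero x)), x)) w =
      C.indicator (fun _ => ∫⁻ x : Fin n → E, V (σ (M (consZero x)), x)) w := by
    intro w
    by_cases hw : w ∈ C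
    · simp only [indicator_of_mem hw]
      exact hshift w
    · simp only [indicator_of_notMem hw, lintegral_zero]
  rw [lintegral_congr hinner, lintegral_indicator_const hC, volume_cube, mul_one]

end

end

section

section

variable {E : Type*} [NormedAddCommGroup E] [InnerProductSpace ℝ E] [FiniteDimensional ℝ E]

theorem finrank_iInf_add_sum_finrank_orthogonal {ι : Type*} [Fintype ι] {L : ι → Submodule ℝ E}
    (hL : LinearIndependent ℝ (normalFrame L)) :
    finrank ℝ (⨅ i, L i : Submodule ℝ E) + ∑ i, finrank ℝ (L i)ᗮ = finrank ℝ E := by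
  have h1 : finrank ℝ (Submodule.span ℝ (range (normalFrame L))) = ∑ i, finrank ℝ (L i)ᗮ := by
    rw [finrank_span_eq_card hL]
    simp
  rw [← orthogonal_span_normalFrame, ← h1, add_comm]
  exact Submodule.finrank_add_finrank_orthogonal _

variable [MeasurableSpace E] [BorelSpace E]

/-- If the normal spaces of affine subspaces are linearly dependent, almost all translates of the
subspaces have no common point. -/
theorem ae_not_exists_of_not_linearIndependent {n : ℕ} {L : Fin (n + 1) → Submodule ℝ E}
    (hL : ¬LinearIndependent ℝ (normalFrame L)) (a : Fin (n + 1) → E) :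
    ∀ᵐ x : Fin n → E, ¬∃ p : E, ∀ i, p - consZero x i - a i ∈ L i := by
  obtain ⟨g, hg0, ⟨i₀, r₀⟩, hg⟩ := Fintype.not_linearIndependent_iff.1 hL
  -- Collecting a linear relation of the frame by index gives vectors y i orthogonal to L i with sum
  -- 0 and not all zero.
  let y : Fin (n + 1) → E := fun i => ∑ r, g ⟨i, r⟩ • normalFrame L ⟨i, r⟩
  have hy1 : ∀ i, y i ∈ (L i)ᗮ := fun i => Submodule.sum_mem _ fun r _ =>
    Submodule.smul_mem _ _ (stdOrthonormalBasis ℝ (L i)ᗮ r).2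
  have hy2 : ∀ i r, ⟪normalFrame L ⟨i, r⟩, y i⟫ = g ⟨i, r⟩ := by
    intro i r
    have hort : Orthonormal ℝ fun r => (stdOrthonormalBasis ℝ (L i)ᗮ r : E) :=
      (stdOrthonormalBasis ℝ (L i)ᗮ).orthonormal.comp_linearIsometry (L i)ᗮ.subtypeₗᵢ
    exact hort.inner_right_fintype (fun r => g ⟨i, r⟩) r
  have hsum : ∑ i, y i = 0 := by
    rw [← hg0, Fintype.sum_sigma]
  -- The set of index 0 is not translated, so a nonzero y i with i ≠ 0 is needed; if there were
  -- none, the zero sum would kill y 0 as well.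
  have hne : ∃ j : Fin n, y j.succ ≠ 0 := by
    by_contra! h
    rw [Fin.sum_univ_succ] at hsum
    simp only [h, Finset.sum_const_zero, add_zero] at hsum
    have hall : ∀ i, y i = 0 := Fin.cases hsum h
    apply hg
    rw [← hy2 i₀ r₀, hall, inner_zero_right]
  obtain ⟨j₀, hj₀⟩ := hne
  let l : (Fin n → E) →ₗ[ℝ] ℝ := ∑ j : Fin n, (innerₗ E (y j.succ)) ∘ₗ LinearMap.proj j
  have hl : ∀ x, l x = ∑ j : Fin n, ⟪y j.succ, x j⟫ := fun x => by simp [l]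
  have hl0 : l (Pi.single j₀ (y j₀.succ)) ≠ 0 := by
    rw [hl, Finset.sum_eq_single j₀]
    · simpa using hj₀
    · intro j _ hj
      simp [hj]
    · simp
  set c : ℝ := -∑ i, ⟪y i, a i⟫
  -- Pairing a common point p with each y i and summing eliminates p; the translations satisfy one
  -- nontrivial affine equation.
  have hnull : volume {x : Fin n → E | l x = c} = 0 := by
    have h1 := Measure.addHaar_affineSubspace (volume : Measure (Fin n → E))
      ((AffineSubspace.mk' c ⊥).comap l.toAffineMap) fun htop => by
        have hmem : ∀ x, l x = c := fun x => by
          have : x ∈ (AffineSubspace.mk' c ⊥).comap l.toAffineMap :=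
            htop ▸ AffineSubspace.mem_top ..
          rw [AffineSubspace.mem_comap, AffineSubspace.mem_mk'] at this
          simpa [sub_eq_zero] using this
        apply hl0
        rw [hmem, ← hmem 0, map_zero]
    convert h1 using 2
    ext x
    rw [SetLike.mem_coe, AffineSubspace.mem_comap, AffineSubspace.mem_mk']
    simp [sub_eq_zero]
  refine measure_mono_null ?_ hnull
  intro x hx
  simp only [mem_compl_iff, mem_ofPred_eq, not_not] at hx
  obtain ⟨p, hp⟩ := hx
  have h1 : ∀ i, ⟪y i, consZero x i⟫ = ⟪y i, p⟫ - ⟪y i, a i⟫ := by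
    intro i
    have := Submodule.inner_left_of_mem_orthogonal (hp i) (hy1 i)
    rw [inner_sub_right, inner_sub_right] at this
    linarith
  have h2 : ∑ i, ⟪y i, consZero x i⟫ = c := by
    rw [Finset.sum_congr rfl fun i _ => h1 i, Finset.sum_sub_distrib, ← sum_inner, hsum,
      inner_zero_left, zero_sub]
  rw [Fin.sum_univ_succ] at h2
  rw [mem_ofPred_eq, hl]
  simpa [consZero] using h2

/-- Recentres affine subspaces a i + L i at the origin, at the price of a shift of the translation
vectors that Lebesgue measure ignores. -/
theorem measure_iInter_translate_eq {E : Type*} [NormedAddCommGroup E] [MeasurableSpace E]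
    [BorelSpace E] {n : ℕ} (m : ℕ) (B : Fin (n + 1) → Set E)
    (a : Fin (n + 1) → E) (x : Fin n → E) :
    μHE[m] {p : E | ∀ i, p - consZero x i ∈ B i} =
      μHE[m] {p : E | ∀ i, p - consZero (x + fun j => a j.succ - a 0) i ∈ {z | z + a i ∈ B i}} := by
  have h1 : {p : E | ∀ i, p - consZero x i ∈ B i} = (fun y => y + a 0) ''
      {p : E | ∀ i, p - consZero (x + fun j => a j.succ - a 0) i ∈ {z | z + a i ∈ B i}} := by
    ext p
    rw [mem_image_add_right]
    refine forall_congr' fun i => ?_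
    rw [consZero_add, mem_ofPred_eq,
      show p - a 0 - (consZero x i + (a i - a 0)) + a i = p - consZero x i by abel]
  rw [h1]
  exact (isometry_add_right (a 0)).euclideanHausdorffMeasure_image _

/-- The translative integral formula for subsets `B i` of affine subspaces `a i + L i`. -/
theorem lintegral_measure_iInter_translate {n : ℕ} {L : Fin (n + 1) → Submodule ℝ E}
    (hL : LinearIndependent ℝ (normalFrame L)) {B : Fin (n + 1) → Set E}
    (hB : ∀ i, MeasurableSet (B i)) (a : Fin (n + 1) → E) (hBL : ∀ i, ∀ x ∈ B i, x - a i ∈ L i) :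
    (Measurable fun x : Fin n → E =>
      μHE[finrank ℝ (⨅ i, L i : Submodule ℝ E)] {p : E | ∀ i, p - consZero x i ∈ B i}) ∧
    ∫⁻ x : Fin n → E,
      μHE[finrank ℝ (⨅ i, L i : Submodule ℝ E)] {p : E | ∀ i, p - consZero x i ∈ B i} =
      ENNReal.ofReal √(Matrix.gram ℝ (normalFrame L)).det * ∏ i, μHE[finrank ℝ (L i)] (B i) := by
  obtain ⟨h1, h2⟩ := lintegral_measure_iInter_translate_of_subset hL
    (B := fun i => {z | z + a i ∈ B i}) (fun i => (measurable_id.add_const (a i)) (hB i))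
    fun i z hz => by simpa using hBL i _ hz
  simp only [measure_iInter_translate_eq _ B a]
  refine ⟨h1.comp (measurable_id.add_const _), ?_⟩
  rw [lintegral_add_right_eq_self (fun x : Fin n → E => μHE[finrank ℝ (⨅ i, L i : Submodule ℝ E)]
    {p : E | ∀ i, p - consZero x i ∈ {z | z + a i ∈ B i}}), h2]
  congr 1
  refine Finset.prod_congr rfl fun i _ => ?_
  have h3 : B i = (fun y => y + a i) '' {z | z + a i ∈ B i} := by
    ext p
    rw [mem_image_add_right, mem_ofPred_eq, sub_add_cancel]
  conv_rhs => rw [h3]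
  exact ((isometry_add_right (a i)).euclideanHausdorffMeasure_image _).symm

end

variable {d : ℕ}

/-! ### Translative integral formulas for faces of polytopes -/

theorem faceDet_eq {n : ℕ} (F : Fin n → Set (Space d)) :
    faceDet F = √(Matrix.gram ℝ (normalFrame fun i => vectorSpan ℝ (F i))).det := rfl

theorem faceDet_eq_zero {n : ℕ} {F : Fin n → Set (Space d)}
    (h : ¬LinearIndependent ℝ (normalFrame fun i => vectorSpan ℝ (F i))) : faceDet F = 0 := by
  rw [faceDet_eq]
  have := (Matrix.det_gram_ne_zero_iff_linearIndependent (𝕜 := ℝ)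
    (v := normalFrame fun i => vectorSpan ℝ (F i))).not.2 h
  rw [not_not.1 this, Real.sqrt_zero]

theorem mem_degreeTuples {k j : ℕ} {m : Fin k → ℕ} :
    m ∈ degreeTuples d k j ↔ (∀ i, j ≤ m i ∧ m i ≤ d) ∧ ∑ i, m i = (k - 1) * d + j := by
  simp [degreeTuples]

/-- The tuple of the dimensions of the direction spaces. -/
def dims {ι : Type*} (F : ι → Set (Space d)) (i : ι) : ℕ := finrank ℝ (vectorSpan ℝ (F i))

/-- Independent normal spaces make codimensions add, so the dimension of the intersection is fixed
by the sum of the dimensions. The bounds j ≤ m i ≤ d are then automatic. -/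
theorem finrank_iInf_eq_iff {n j : ℕ} {F : Fin (n + 1) → Set (Space d)}
    (hL : LinearIndependent ℝ (normalFrame fun i => vectorSpan ℝ (F i))) :
    finrank ℝ (⨅ i, vectorSpan ℝ (F i) : Submodule ℝ (Space d)) = j ↔
      dims F ∈ degreeTuples d (n + 1) j := by
  have h1 := finrank_iInf_add_sum_finrank_orthogonal hL
  rw [finrank_euclideanSpace_fin] at h1
  have h2 : ∀ i, dims F i + finrank ℝ (vectorSpan ℝ (F i))ᗮ = d := fun i => by
    have := Submodule.finrank_add_finrank_orthogonal (vectorSpan ℝ (F i))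
    rwa [finrank_euclideanSpace_fin] at this
  have h3 : ∑ i, dims F i + ∑ i, finrank ℝ (vectorSpan ℝ (F i))ᗮ = (n + 1) * d := by
    rw [← Finset.sum_add_distrib, Finset.sum_congr rfl fun i _ => h2 i]
    simp
  rw [mem_degreeTuples, Nat.add_sub_cancel]
  rw [add_mul, one_mul] at h3
  constructor
  · rintro rfl
    refine ⟨fun i => ⟨Submodule.finrank_mono (iInf_le _ i), finrank_le _⟩, ?_⟩
    omega
  · rintro ⟨-, h⟩
    omega

/-- Dependent normal spaces are covered too: the determinant is then 0, and almost all of the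
intersections are empty. -/
theorem integral_measure_iInter_translate {n j : ℕ} {F B : Fin (n + 1) → Set (Space d)}
    (hdim : dims F ∈ degreeTuples d (n + 1) j) (hF : ∀ i, (F i).Nonempty)
    (hB : ∀ i, MeasurableSet (B i)) (hBF : ∀ i, B i ⊆ F i)
    (hfin : ∀ i, μHE[dims F i] (B i) ≠ ⊤) :
    Integrable (fun x : Fin n → Space d =>
      (μHE[j] {p : Space d | ∀ i, p - consZero x i ∈ B i}).toReal) ∧
    ∫ x : Fin n → Space d, (μHE[j] {p : Space d | ∀ i, p - consZero x i ∈ B i}).toReal =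
      faceDet F * ∏ i, (μHE[dims F i] (B i)).toReal := by
  choose a ha using hF
  have hBL : ∀ i, ∀ x ∈ B i, x - a i ∈ vectorSpan ℝ (F i) := fun i x hx =>
    vsub_mem_vectorSpan ℝ (hBF i hx) (ha i)
  by_cases hL : LinearIndependent ℝ (normalFrame fun i => vectorSpan ℝ (F i))
  · obtain ⟨h1, h2⟩ := lintegral_measure_iInter_translate hL hB a hBL
    rw [(finrank_iInf_eq_iff hL).2 hdim] at h1 h2
    have hfin' : ENNReal.ofReal √(Matrix.gram ℝ (normalFrame fun i => vectorSpan ℝ (F i))).det *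
        ∏ i, μHE[finrank ℝ (vectorSpan ℝ (F i))] (B i) ≠ ⊤ :=
      ENNReal.mul_ne_top ENNReal.ofReal_ne_top (ENNReal.prod_ne_top fun i _ => hfin i)
    have hne := h2.trans_ne hfin'
    refine ⟨integrable_toReal_of_lintegral_ne_top h1.aemeasurable hne, ?_⟩
    rw [integral_toReal h1.aemeasurable (ae_lt_top h1 hne), h2, ENNReal.toReal_mul,
      ENNReal.toReal_ofReal (Real.sqrt_nonneg _), ENNReal.toReal_prod, faceDet_eq]
    rfl
  · have h0 : (fun x : Fin n → Space d =>
        (μHE[j] {p : Space d | ∀ i, p - consZero x i ∈ B i}).toReal) =ᵐ[volume] 0 := by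
      filter_upwards [ae_not_exists_of_not_linearIndependent hL a] with x hx
      have : {p : Space d | ∀ i, p - consZero x i ∈ B i} = ∅ :=
        eq_empty_of_forall_notMem fun p hp => hx ⟨p, fun i => hBL i _ (hp i)⟩
      rw [this, measure_empty, ENNReal.toReal_zero, Pi.zero_apply]
    refine ⟨(integrable_zero _ _ _).congr h0.symm, ?_⟩
    rw [integral_congr_ae h0, faceDet_eq_zero hL, zero_mul]
    simp

end

section

variable {d : ℕ}

/-! ### Sums over faces -/

theorem finite_isFace (P : Polytope d) : {F | IsFace P.carrier F}.Finite := by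
  refine (Set.finite_iUnion (ι := Fin (d + 1)) fun m =>
    Set.finite_range (Face.carrier : Face P m → Set (Space d))).subset fun F hF => ?_
  have := finrank_le (vectorSpan ℝ F)
  exact mem_iUnion.2 ⟨⟨finrank ℝ (vectorSpan ℝ F), by omega⟩, ⟨F, hF.1, hF.2, rfl⟩, rfl⟩

/-- The finite set of all faces of a polytope. -/
def allFaces (P : Polytope d) : Finset (Set (Space d)) := (finite_isFace P).toFinset

theorem mem_allFaces {P : Polytope d} {F : Set (Space d)} :
    F ∈ allFaces P ↔ IsFace P.carrier F := by
  simp [allFaces]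

open Classical in
theorem sum_face (P : Polytope d) (j : ℕ) (h : Set (Space d) → ℝ) :
    ∑ F : Face P j, h F.carrier = ∑ G ∈ allFaces P with finrank ℝ (vectorSpan ℝ G) = j, h G := by
  refine Finset.sum_nbij Face.carrier ?_ Face.carrier_injective.injOn ?_ fun _ _ => rfl
  · intro F _
    exact Finset.mem_filter.2 ⟨mem_allFaces.2 F.isFace, F.finrank_vectorSpan⟩
  · intro G hG
    obtain ⟨h1, h2⟩ := Finset.mem_filter.1 (Finset.mem_coe.1 hG)
    exact ⟨⟨G, (mem_allFaces.1 h1).1, (mem_allFaces.1 h1).2, h2⟩,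
      Finset.mem_coe.2 (Finset.mem_univ _), rfl⟩

open Classical in
theorem sum_pi_face {ι : Type*} [Fintype ι] [DecidableEq ι] (P : ι → Polytope d) (m : ι → ℕ)
    (h : (ι → Set (Space d)) → ℝ) :
    ∑ F : (i : ι) → Face (P i) (m i), h (fun i => (F i).carrier) =
      ∑ F ∈ Fintype.piFinset (fun i => allFaces (P i)) with dims F = m, h F := by
  refine Finset.sum_nbij (fun F i => (F i).carrier) ?_ ?_ ?_ fun _ _ => rfl
  · intro F _
    exact Finset.mem_filter.2 ⟨Fintype.mem_piFinset.2 fun i => mem_allFaces.2 (F i).isFace,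
      funext fun i => (F i).finrank_vectorSpan⟩
  · intro F _ F' _ h
    exact funext fun i => Face.carrier_injective (congrFun h i)
  · intro G hG
    obtain ⟨h1, h2⟩ := Finset.mem_filter.1 (Finset.mem_coe.1 hG)
    have h3 := fun i => mem_allFaces.1 (Fintype.mem_piFinset.1 h1 i)
    exact ⟨fun i => ⟨G i, (h3 i).1, (h3 i).2, congrFun h2 i⟩,
      Finset.mem_coe.2 (Finset.mem_univ _), rfl⟩

-- Replaces tuples in the dependent types `Face (P i) (m i)`, with m varying, by tuples of plain
-- sets, so that faces of the intersection can be matched with them.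
open Classical in
theorem sum_sum_pi_face {n j : ℕ} (P : Fin n → Polytope d) (h : (Fin n → Set (Space d)) → ℝ) :
    ∑ m ∈ degreeTuples d n j, ∑ F : (i : Fin n) → Face (P i) (m i), h (fun i => (F i).carrier) =
      ∑ F ∈ Fintype.piFinset (fun i => allFaces (P i)) with dims F ∈ degreeTuples d n j, h F := by
  rw [Finset.sum_congr rfl fun m _ => sum_pi_face P m h,
    ← Finset.sum_fiberwise_of_maps_to (g := dims) (t := degreeTuples d n j)
    fun F hF => (Finset.mem_filter.1 hF).2]
  refine Finset.sum_congr rfl fun m hm => Finset.sum_congr ?_ fun _ _ => rfl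
  ext F
  simp only [Finset.mem_filter, and_assoc]
  exact and_congr_right fun _ => ⟨fun h => ⟨h ▸ hm, h⟩, fun h => h.2⟩

/-! ### Intersections of translates -/

theorem interTranslates_eq {n : ℕ} (K : Fin (n + 1) → Set (Space d)) (x : Fin n → Space d) :
    interTranslates K x = ⋂ i, (fun y => y + consZero x i) '' K i := by
  ext p
  simp only [interTranslates, mem_inter_iff, mem_iInter, mem_image_add_right, Fin.forall_fin_succ,
    consZero, Fin.cons_zero, Fin.cons_succ, sub_zero]

theorem evalSet_carrier (Ψ : Polytope d → SignedMeasure (Space d)) (P : Polytope d) :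
    evalSet Ψ P.carrier = Ψ P := by
  have h : ∃ Q : Polytope d, (Q : Set (Space d)) = P.carrier := ⟨P, rfl⟩
  rw [evalSet, dif_pos h, Polytope.carrier_injective h.choose_spec]

theorem evalSet_empty (Ψ : Polytope d → SignedMeasure (Space d)) : evalSet Ψ ∅ = 0 :=
  dif_neg fun ⟨P, hP⟩ => P.nonempty.ne_empty hP

open Classical in
/-- Whenever the relative interiors of faces meet after translation, the faces are in general
position. -/
theorem ae_linearIndependent_of_meet {n : ℕ} (P : Fin (n + 1) → Polytope d) :
    ∀ᵐ x : Fin n → Space d, ∀ F ∈ Fintype.piFinset (fun i => allFaces (P i)),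
      (∃ p, ∀ i, p - consZero x i ∈ F i) →
        LinearIndependent ℝ (normalFrame fun i => vectorSpan ℝ (F i)) := by
  rw [Finset.eventually_all]
  intro F hF
  by_cases hL : LinearIndependent ℝ (normalFrame fun i => vectorSpan ℝ (F i))
  · exact Eventually.of_forall fun _ _ => hL
  · choose a ha using fun i => (mem_allFaces.1 (Fintype.mem_piFinset.1 hF i)).1
    filter_upwards [ae_not_exists_of_not_linearIndependent hL a] with x hx h
    obtain ⟨p, hp⟩ := h
    exact absurd ⟨p, fun i => vsub_mem_vectorSpan ℝ (hp i) (ha i)⟩ hx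

-- Sending F to the intersection of the F i + x i is a bijection from tuples with meeting relative
-- interiors onto the faces of the intersection. By general position it matches the dimensions, and
-- it carries mixed normals to normals and intersections of relative interiors to relative
-- interiors.
open Classical in
theorem evalSet_interTranslates {n j : ℕ} {Ψ : Polytope d → SignedMeasure (Space d)}
    {f : Set (Space d) → ℝ}
    (hΨ : ∀ P : Polytope d,
      Ψ P = ∑ F : Face P j, f (sphericalNormals P F) • F.measure.toSignedMeasure)
    (P : Fin (n + 1) → Polytope d) {A : Fin (n + 1) → Set (Space d)}
    (hA : ∀ i, MeasurableSet (A i)) {x : Fin n → Space d}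
    (hx : ∀ F ∈ Fintype.piFinset (fun i => allFaces (P i)),
      (∃ p, ∀ i, p - consZero x i ∈ F i) →
        LinearIndependent ℝ (normalFrame fun i => vectorSpan ℝ (F i))) :
    evalSet Ψ (interTranslates (fun i => (P i).carrier) x) (interTranslates A x) =
      ∑ F ∈ Fintype.piFinset (fun i => allFaces (P i)) with dims F ∈ degreeTuples d (n + 1) j,
        f (mixedSphericalNormals (fun i => (P i).carrier) F) *
          (μHE[j] {p : Space d |
            ∀ i, p - consZero x i ∈ A i ∩ intrinsicInterior ℝ (F i)}).toReal := by
  have hPx : ∀ i, IsPolyhedral ((fun y => y + consZero x i) '' (P i).carrier) := fun i =>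
    (P i).isPolyhedral.translate _
  rcases (interTranslates (fun i => (P i).carrier) x).eq_empty_or_nonempty with he | hne
  · rw [he, evalSet_empty, zero_apply]
    symm
    refine Finset.sum_eq_zero fun F hF => ?_
    have hF' := fun i => mem_allFaces.1 (Fintype.mem_piFinset.1 (Finset.mem_filter.1 hF).1 i)
    rw [eq_empty_of_forall_notMem (s := {p : Space d | _}), measure_empty, ENNReal.toReal_zero,
      mul_zero]
    intro p hp
    have : p ∈ interTranslates (fun i => (P i).carrier) x := by
      rw [interTranslates_eq, mem_iInter]
      exact fun i => mem_image_add_right.2 ((hF' i).mem (hp i).2)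
    rw [he] at this
    exact this
  obtain ⟨K, hK⟩ : ∃ K : Polytope d, K.carrier = interTranslates (fun i => (P i).carrier) x := by
    refine IsPolyhedral.exists_polytope ?_ ?_ hne
    · rw [interTranslates_eq]
      exact IsPolyhedral.iInter hPx
    · exact (P 0).isCompact.inter_right (isClosed_iInter fun i =>
        ((P i.succ).isPolyhedral.translate _).isClosed)
  have hAx : MeasurableSet (interTranslates A x) :=
    (hA 0).inter (MeasurableSet.iInter fun i => measurableSet_image_add_right (hA _) _)
  rw [← hK, evalSet_carrier, hΨ, sum_smul_toSignedMeasure_apply _ _ hAx]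
  simp only [measureReal_def, Face.measure_eq_intrinsicInterior]
  rw [sum_face K j fun G =>
    f (sphericalNormals K.carrier G) *
      (μHE[j] (interTranslates A x ∩ intrinsicInterior ℝ G)).toReal]
  rw [interTranslates_eq] at hK
  have hmeet : ∀ F ∈ Fintype.piFinset (fun i => allFaces (P i)), ∀ p : Space d,
      (∀ i, p - consZero x i ∈ intrinsicInterior ℝ (F i)) →
      (∀ i, p ∈ intrinsicInterior ℝ ((fun y => y + consZero x i) '' F i)) ∧
      (∀ i, IsFace ((fun y => y + consZero x i) '' (P i).carrier)
        ((fun y => y + consZero x i) '' F i)) := by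
    intro F hF p hp
    have hF' := fun i => mem_allFaces.1 (Fintype.mem_piFinset.1 hF i)
    exact ⟨fun i => by rw [intrinsicInterior_translate]; exact mem_image_add_right.2 (hp i),
      fun i => (hF' i).translate (P i).isPolyhedral (hp i) _⟩
  symm
  -- Tuples whose translated relative interiors do not meet contribute the measure of the empty set.
  rw [← Finset.sum_filter_of_ne (p := fun F : Fin (n + 1) → Set (Space d) =>
    ∃ p : Space d, ∀ i, p - consZero x i ∈ intrinsicInterior ℝ (F i))]
  swap
  · intro F hF h0
    by_contra hcon
    apply h0
    rw [eq_empty_of_forall_notMem (s := {p : Space d | _}), measure_empty, ENNReal.toReal_zero,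
      mul_zero]
    exact fun p hp => hcon ⟨p, fun i => (hp i).2⟩
  have hdim : ∀ F ∈ Fintype.piFinset (fun i => allFaces (P i)), ∀ p : Space d,
      (∀ i, p - consZero x i ∈ intrinsicInterior ℝ (F i)) →
      (finrank ℝ (vectorSpan ℝ (⋂ i, (fun y => y + consZero x i) '' F i)) = j ↔
        dims F ∈ degreeTuples d (n + 1) j) := by
    intro F hF p hp
    obtain ⟨h1, h2⟩ := hmeet F hF p hp
    have hL := hx F hF ⟨p, fun i => intrinsicInterior_subset (hp i)⟩
    rw [← finrank_iInf_eq_iff hL, (isFace_iInter hPx h2 h1).vectorSpan_eq (IsPolyhedral.iInter hPx)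
      (mem_intrinsicInterior_iInter hPx h2 h1)]
    have : lineality (⋂ i, (fun y => y + consZero x i) '' (P i).carrier) p =
        ⨅ i, vectorSpan ℝ (F i) := by
      ext v
      rw [mem_lineality_iInter hPx fun i => (h2 i).mem (h1 i), Submodule.mem_iInf]
      refine forall_congr' fun i => ?_
      rw [← (h2 i).vectorSpan_eq (hPx i) (h1 i), vectorSpan_translate]
    rw [this]
  refine Finset.sum_bij (fun F _ => ⋂ i, (fun y => y + consZero x i) '' F i) ?_ ?_ ?_ ?_
  · intro F hF
    simp only [Finset.mem_filter] at hF
    obtain ⟨⟨hF1, hF2⟩, p, hp⟩ := hF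
    obtain ⟨h1, h2⟩ := hmeet F hF1 p hp
    rw [Finset.mem_filter, mem_allFaces, hK]
    exact ⟨isFace_iInter hPx h2 h1, (hdim F hF1 p hp).2 hF2⟩
  · intro F hF F' hF' heq
    simp only [Finset.mem_filter] at hF hF'
    obtain ⟨⟨hF1, hF2⟩, p, hp⟩ := hF
    obtain ⟨⟨hF1', hF2'⟩, p', hp'⟩ := hF'
    obtain ⟨h1, h2⟩ := hmeet F hF1 p hp
    obtain ⟨h1', h2'⟩ := hmeet F' hF1' p' hp'
    have h3 : p ∈ ⋂ i, intrinsicInterior ℝ ((fun y => y + consZero x i) '' F' i) := by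
      rw [← intrinsicInterior_iInter hPx h2' ⟨p', mem_iInter.2 h1'⟩, ← heq]
      exact mem_intrinsicInterior_iInter hPx h2 h1
    funext i
    have h4 := (h2 i).eq_of_mem (h2' i) (h1 i) (mem_iInter.1 h3 i)
    exact (add_left_injective (consZero x i)).image_injective h4
  · intro G hG
    rw [Finset.mem_filter, mem_allFaces] at hG
    obtain ⟨hG1, hG2⟩ := hG
    obtain ⟨p, hp⟩ := hG1.exists_mem_intrinsicInterior K.isPolyhedral
    have hpK := hG1.mem hp
    rw [hK, mem_iInter] at hpK
    have hpi : ∀ i, p - consZero x i ∈ (P i).carrier := fun i => mem_image_add_right.1 (hpK i)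
    -- The preimage of G consists of the minimal faces of the P i at the translates of one
    -- relatively interior point of G.
    let F : Fin (n + 1) → Set (Space d) := fun i => minFace (P i).carrier (p - consZero x i)
    have hF1 : F ∈ Fintype.piFinset (fun i => allFaces (P i)) := Fintype.mem_piFinset.2 fun i =>
      mem_allFaces.2 ((P i).isPolyhedral.isFace_minFace (hpi i))
    have hF3 : ∀ i, p - consZero x i ∈ intrinsicInterior ℝ (F i) := fun i =>
      (P i).isPolyhedral.mem_intrinsicInterior_minFace (hpi i)
    obtain ⟨h1, h2⟩ := hmeet F hF1 p hF3
    have hFG : ⋂ i, (fun y => y + consZero x i) '' F i = G := by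
      refine IsFace.eq_of_mem (K := K.carrier) ?_ hG1 (mem_intrinsicInterior_iInter hPx h2 h1) hp
      rw [hK]
      exact isFace_iInter hPx h2 h1
    refine ⟨F, ?_, hFG⟩
    simp only [Finset.mem_filter]
    exact ⟨⟨hF1, (hdim F hF1 p hF3).1 (hFG ▸ hG2)⟩, p, hF3⟩
  · intro F hF
    simp only [Finset.mem_filter] at hF
    obtain ⟨⟨hF1, hF2⟩, p, hp⟩ := hF
    obtain ⟨h1, h2⟩ := hmeet F hF1 p hp
    rw [mixedSphericalNormals_eq_sphericalNormals (x := consZero x) (q := p)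
      (fun i => (P i).isPolyhedral) (fun i => mem_allFaces.1 (Fintype.mem_piFinset.1 hF1 i))
      (mem_iInter.2 fun i => mem_image_add_right.2 (hp i)), ← hK,
      intrinsicInterior_iInter hPx h2 ⟨p, mem_iInter.2 h1⟩, interTranslates_eq]
    congr 3
    ext q
    simp only [mem_ofPred_eq, mem_inter_iff, mem_iInter, mem_image_add_right,
      intrinsicInterior_translate, forall_and]

/-- The iterated translative integral formula. -/
theorem integral_evalSet_interTranslates {n j : ℕ} {Ψ : Polytope d → SignedMeasure (Space d)}
    {f : Set (Space d) → ℝ}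
    (hΨ : ∀ P : Polytope d,
      Ψ P = ∑ F : Face P j, f (sphericalNormals P F) • F.measure.toSignedMeasure)
    (P : Fin (n + 1) → Polytope d) {A : Fin (n + 1) → Set (Space d)}
    (hA : ∀ i, MeasurableSet (A i)) :
    Integrable (fun x : Fin n → Space d =>
      evalSet Ψ (interTranslates (fun i => (P i).carrier) x) (interTranslates A x)) ∧
    ∫ x : Fin n → Space d,
      evalSet Ψ (interTranslates (fun i => (P i).carrier) x) (interTranslates A x) =
      ∑ m ∈ degreeTuples d (n + 1) j, mixedMeasure f m P (univ.pi A) := by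
  classical
  -- The expansion over tuples of faces is available only for translations in general position,
  -- hence almost everywhere; integrability of the left side is inherited from the finite sum.
  have hae : (fun x : Fin n → Space d =>
      evalSet Ψ (interTranslates (fun i => (P i).carrier) x) (interTranslates A x)) =ᵐ[volume]
      fun x => ∑ F ∈ Fintype.piFinset (fun i => allFaces (P i)) with
        dims F ∈ degreeTuples d (n + 1) j,
        f (mixedSphericalNormals (fun i => (P i).carrier) F) *
          (μHE[j] {p : Space d |
            ∀ i, p - consZero x i ∈ A i ∩ intrinsicInterior ℝ (F i)}).toReal := by
    filter_upwards [ae_linearIndependent_of_meet P] with x hx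
    exact evalSet_interTranslates hΨ P hA hx
  have hint : ∀ F ∈ (Fintype.piFinset fun i => allFaces (P i)).filter
      (fun F => dims F ∈ degreeTuples d (n + 1) j), _ := fun F hF =>
    have hF1 := fun i => mem_allFaces.1 (Fintype.mem_piFinset.1 (Finset.mem_filter.1 hF).1 i)
    integral_measure_iInter_translate (B := fun i => A i ∩ intrinsicInterior ℝ (F i))
      (Finset.mem_filter.1 hF).2 (fun i => (hF1 i).1)
      (fun i => (hA i).inter (measurableSet_intrinsicInterior _))
      (fun i => inter_subset_right.trans intrinsicInterior_subset)
      (fun i => by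
        let G : Face (P i) (dims F i) := ⟨F i, (hF1 i).1, (hF1 i).2, rfl⟩
        have := G.measure_eq_intrinsicInterior (A i)
        exact this ▸ measure_ne_top _ _)
  refine ⟨(integrable_finsetSum _ fun F hF => (hint F hF).1.const_mul _).congr hae.symm, ?_⟩
  rw [integral_congr_ae hae, integral_finsetSum _ fun F hF => (hint F hF).1.const_mul _]
  rw [Finset.sum_congr rfl fun F hF => by rw [integral_const_mul, (hint F hF).2],
    ← sum_sum_pi_face]
  refine Finset.sum_congr rfl fun m _ => ?_
  rw [mixedMeasure, sum_smul_toSignedMeasure_apply _ _ (MeasurableSet.univ_pi hA)]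
  refine Finset.sum_congr rfl fun F _ => ?_
  rw [measureReal_def, Measure.pi_pi, ENNReal.toReal_prod, mul_assoc]
  congr 2
  refine Finset.prod_congr rfl fun i _ => ?_
  rw [Face.measure_eq_intrinsicInterior, dims, Face.finrank_vectorSpan]

end

section

variable {d : ℕ}

/-! ### Homogeneity of the mixed measures -/

section

variable {ι : Type*} {K F : ι → Set (Space d)} {a : ι → ℝ}

theorem mixedSphericalNormals_dilate [Finite ι] [Nonempty ι] (hK : ∀ i, IsPolyhedral (K i))
    (hF : ∀ i, IsFace (K i) (F i)) (ha : ∀ i, 0 < a i) :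
    mixedSphericalNormals (fun i => (fun y => a i • y) '' K i)
      (fun i => (fun y => a i • y) '' F i) = mixedSphericalNormals K F := by
  choose p hp using fun i => (hF i).exists_mem_intrinsicInterior (hK i)
  rw [mixedSphericalNormals_eq (fun i => (hK i).dilate (ha i)) (fun i => (hF i).dilate (ha i))
    (p := fun i => a i • p i) (fun i => by
      rw [intrinsicInterior_dilate _ (ha i)]
      exact mem_image_of_mem _ (hp i)), mixedSphericalNormals_eq hK hF hp]
  simp only [dirCone_dilate _ (ha _)]

theorem faceDet_dilate [Fintype ι] [DecidableEq ι] (ha : ∀ i, 0 < a i) :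
    faceDet (fun i => (fun y => a i • y) '' F i) = faceDet F := by
  have h : (fun i => (vectorSpan ℝ ((fun y => a i • y) '' F i))ᗮ) =
      fun i => (vectorSpan ℝ (F i))ᗮ := by
    funext i
    rw [vectorSpan_dilate _ (ha i)]
  rw [faceDet, faceDet, h]

end

/-- Product measures are determined by boxes, where the scaling holds factor by factor. -/
theorem pi_measure_dilateEquiv {ι : Type*} [Fintype ι] {P Q : ι → Polytope d} {m : ι → ℕ}
    {a : ι → ℝ} (ha : ∀ i, 0 < a i) (hQ : ∀ i, (Q i).carrier = (fun y => a i • y) '' (P i).carrier)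
    (F : (i : ι) → Face (P i) (m i)) {S : Set (ι → Space d)} (hS : MeasurableSet S) :
    Measure.pi (fun i => (Face.dilateEquiv (ha i) (hQ i) (m i) (F i)).measure)
        ((fun z i => a i • z i) '' S) =
      (∏ i, ENNReal.ofReal (a i ^ m i)) * Measure.pi (fun i => (F i).measure) S := by
  let e : (ι → Space d) ≃ᵐ (ι → Space d) :=
    MeasurableEquiv.piCongrRight fun i => MeasurableEquiv.smul₀ (a i) (ha i).ne'
  have he : (e : (ι → Space d) → ι → Space d) = fun z i => a i • z i := rfl
  rw [Measure.pi_eq (μ' := (∏ i, ENNReal.ofReal (a i ^ m i)) •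
    (Measure.pi fun i => (F i).measure).map e)]
  · rw [← he, Measure.smul_apply, Measure.map_apply e.measurable (e.measurableSet_image.2 hS),
      preimage_image_eq _ e.injective, smul_eq_mul]
  · intro s hs
    have h1 : e ⁻¹' univ.pi s = univ.pi fun i => (fun y => a i • y) ⁻¹' s i := by
      ext z
      simp [he]
    rw [Measure.smul_apply, Measure.map_apply e.measurable (MeasurableSet.univ_pi hs), h1,
      Measure.pi_pi, smul_eq_mul, ← Finset.prod_mul_distrib]
    refine Finset.prod_congr rfl fun i _ => ?_
    rw [← Face.measure_dilateEquiv (ha i) (hQ i), image_preimage_eq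
      (f := fun y : Space d => a i • y) _ (MeasurableEquiv.smul₀ (a i) (ha i).ne').surjective]

theorem mixedMeasure_dilate (f : Set (Space d) → ℝ) {k : ℕ} [NeZero k] (m : Fin k → ℕ)
    {P Q : Fin k → Polytope d} {a : Fin k → ℝ} (ha : ∀ i, 0 < a i)
    (hQ : ∀ i, (Q i).carrier = (fun y => a i • y) '' (P i).carrier) {S : Set (Fin k → Space d)}
    (hS : MeasurableSet S) :
    mixedMeasure f m Q ((fun z i => a i • z i) '' S) =
      (∏ i, a i ^ m i) * mixedMeasure f m P S := by
  have hS' : MeasurableSet ((fun (z : Fin k → Space d) i => a i • z i) '' S) :=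
    (MeasurableEquiv.piCongrRight fun i =>
      MeasurableEquiv.smul₀ (α := Space d) (a i) (ha i).ne').measurableSet_image.2 hS
  rw [mixedMeasure, mixedMeasure, sum_smul_toSignedMeasure_apply _ _ hS,
    sum_smul_toSignedMeasure_apply _ _ hS', Finset.mul_sum,
    ← (Equiv.piCongrRight fun i => Face.dilateEquiv (ha i) (hQ i) (m i)).sum_comp]
  refine Finset.sum_congr rfl fun F _ => ?_
  simp only [Equiv.piCongrRight_apply, Pi.map_apply, Face.carrier_dilateEquiv, hQ]
  rw [mixedSphericalNormals_dilate (fun i => (P i).isPolyhedral) (fun i => (F i).isFace) ha,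
    faceDet_dilate ha, measureReal_def, pi_measure_dilateEquiv ha hQ F hS, ENNReal.toReal_mul,
    ENNReal.toReal_prod, ← measureReal_def,
    Finset.prod_congr rfl fun i _ => ENNReal.toReal_ofReal (pow_nonneg (ha i).le (m i))]
  ring

theorem mixedMeasure_update_dilate (f : Set (Space d) → ℝ) {k : ℕ} (m : Fin k → ℕ)
    (P : Fin k → Polytope d) (i : Fin k) {a : ℝ} (ha : 0 < a) {S : Set (Fin k → Space d)}
    (hS : MeasurableSet S) :
    mixedMeasure f m (Function.update P i ((P i).dilate a))
        ((fun z => Function.update z i (a • z i)) '' S) =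
      a ^ m i * mixedMeasure f m P S := by
  have : NeZero k := ⟨fun h => (h ▸ i).elim0⟩
  -- Dilating one polytope is the simultaneous dilation with factor a at i and 1 elsewhere.
  let b : Fin k → ℝ := Function.update 1 i a
  have hbi : b i = a := Function.update_self ..
  have hbl : ∀ l, l ≠ i → b l = 1 := fun l hl => Function.update_of_ne hl ..
  have hb : ∀ l, 0 < b l := fun l => by
    rcases eq_or_ne l i with rfl | hl
    · rwa [hbi]
    · rw [hbl l hl]
      exact one_pos
  have h1 : (fun z : Fin k → Space d => Function.update z i (a • z i)) = fun z l => b l • z l := by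
    funext z l
    rcases eq_or_ne l i with rfl | hl
    · rw [Function.update_self, hbi]
    · rw [Function.update_of_ne hl, hbl l hl, one_smul]
  rw [h1, mixedMeasure_dilate f m hb (P := P) (fun l => ?_) hS, Fintype.prod_eq_single i, hbi]
  · intro l hl
    rw [hbl l hl, one_pow]
  · rcases eq_or_ne l i with rfl | hl
    · rw [Function.update_self, hbi, Polytope.carrier_dilate]
    · rw [Function.update_of_ne hl, hbl l hl]
      simp

/-! ### Two polytopes -/

/-- Only index i₀ can have nonzero normal vectors, so the whole frame is a single orthonormal basis.
-/
theorem faceDet_eq_one {n : ℕ} {F : Fin n → Set (Space d)} (i₀ : Fin n)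
    (h : ∀ i, i ≠ i₀ → vectorSpan ℝ (F i) = ⊤) : faceDet F = 1 := by
  have hi : ∀ (i : Fin n) (_ : Fin (finrank ℝ (vectorSpan ℝ (F i))ᗮ)), i = i₀ := by
    intro i r
    by_contra hne
    have h0 : finrank ℝ (vectorSpan ℝ (F i))ᗮ = 0 := by
      rw [h i hne, Submodule.top_orthogonal_eq_bot, finrank_bot]
    exact (h0 ▸ r).elim0
  have hort : Orthonormal ℝ (normalFrame fun i => vectorSpan ℝ (F i)) := by
    have hb : ∀ i, Orthonormal ℝ fun r =>
        (stdOrthonormalBasis ℝ (vectorSpan ℝ (F i))ᗮ r : Space d) :=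
      fun i => (stdOrthonormalBasis ℝ (vectorSpan ℝ (F i))ᗮ).orthonormal.comp_linearIsometry
        (vectorSpan ℝ (F i))ᗮ.subtypeₗᵢ
    refine ⟨fun ⟨i, r⟩ => (hb i).1 r, ?_⟩
    rintro ⟨i, r⟩ ⟨i', r'⟩ hne
    obtain rfl : i = i' := (hi i r).trans (hi i' r').symm
    exact (hb i).2 fun h : r = r' => hne (h ▸ rfl)
  rw [faceDet_eq, Matrix.gram_eq_one_iff_orthonormal.2 hort, Matrix.det_one, Real.sqrt_one]

/-- A face whose feasible cone is the whole space imposes no condition on the intersected cone. -/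
theorem mixedSphericalNormals_eq_of_full {n : ℕ} {K F : Fin n → Set (Space d)}
    (hK : ∀ i, IsPolyhedral (K i)) (hF : ∀ i, IsFace (K i) (F i)) (i₀ : Fin n)
    (h : ∀ i, i ≠ i₀ → ∀ p ∈ intrinsicInterior ℝ (F i), dirCone (K i) p = univ) :
    mixedSphericalNormals K F = sphericalNormals (K i₀) (F i₀) := by
  have : Nonempty (Fin n) := ⟨i₀⟩
  choose p hp using fun i => (hF i).exists_mem_intrinsicInterior (hK i)
  rw [mixedSphericalNormals_eq hK hF hp, sphericalNormals_eq (hK i₀) (hF i₀) (hp i₀)]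
  congr 1
  ext u
  refine forall_congr' fun v => imp_congr_left ⟨fun hv => hv i₀, fun hv i => ?_⟩
  rcases eq_or_ne i i₀ with rfl | hi
  · exact hv
  · rw [h i hi _ (hp i)]
    trivial

section

variable {P Q : Polytope d} {m : ℕ}

theorem mixedSphericalNormals_right_full (F : Face P m) (G : Face Q d) :
    mixedSphericalNormals ![P.carrier, Q.carrier] ![F.carrier, G.carrier] =
      sphericalNormals P.carrier F.carrier :=
  mixedSphericalNormals_eq_of_full (Fin.forall_fin_two.2 ⟨P.isPolyhedral, Q.isPolyhedral⟩)
    (Fin.forall_fin_two.2 ⟨F.isFace, G.isFace⟩) 0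
    (Fin.forall_fin_two.2 ⟨fun h => absurd rfl h, fun _ _ hp => G.dirCone_eq_univ hp⟩)

theorem mixedSphericalNormals_left_full (F : Face P d) (G : Face Q m) :
    mixedSphericalNormals ![P.carrier, Q.carrier] ![F.carrier, G.carrier] =
      sphericalNormals Q.carrier G.carrier :=
  mixedSphericalNormals_eq_of_full (Fin.forall_fin_two.2 ⟨P.isPolyhedral, Q.isPolyhedral⟩)
    (Fin.forall_fin_two.2 ⟨F.isFace, G.isFace⟩) 1
    (Fin.forall_fin_two.2 ⟨fun _ _ hp => F.dirCone_eq_univ hp, fun h => absurd rfl h⟩)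

theorem faceDet_right_full (F : Set (Space d)) (G : Face Q d) :
    faceDet ![F, G.carrier] = 1 :=
  faceDet_eq_one 0 (Fin.forall_fin_two.2 ⟨fun h => absurd rfl h, fun _ => G.vectorSpan_eq_top⟩)

theorem faceDet_left_full (F : Face P d) (G : Set (Space d)) :
    faceDet ![F.carrier, G] = 1 :=
  faceDet_eq_one 1 (Fin.forall_fin_two.2 ⟨fun _ => F.vectorSpan_eq_top, fun h => absurd rfl h⟩)

end

theorem mixedMeasureTwo_apply_prod (f : Set (Space d) → ℝ) (m m' : ℕ) (P Q : Polytope d)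
    {A B : Set (Space d)} (hA : MeasurableSet A) (hB : MeasurableSet B) :
    mixedMeasureTwo f m m' P Q (A ×ˢ B) = ∑ F : Face P m, ∑ G : Face Q m',
      (f (mixedSphericalNormals ![P.carrier, Q.carrier] ![F.carrier, G.carrier]) *
        faceDet ![F.carrier, G.carrier]) * (F.measure.real A * G.measure.real B) := by
  simp [mixedMeasureTwo, sum_apply, Measure.toSignedMeasure_apply_measurable (hA.prod hB),
    measureReal_prod_prod]

theorem mixedMeasureTwo_apply_prod_right_full (f : Set (Space d) → ℝ) (m : ℕ) (P Q : Polytope d)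
    {A B : Set (Space d)} (hA : MeasurableSet A) (hB : MeasurableSet B) :
    mixedMeasureTwo f m d P Q (A ×ˢ B) =
      (∑ F : Face P m, f (sphericalNormals P.carrier F.carrier) * F.measure.real A) *
        volume.real (Q.carrier ∩ B) := by
  rw [mixedMeasureTwo_apply_prod f m d P Q hA hB, ← sum_measureReal_full, Finset.sum_mul_sum]
  refine Finset.sum_congr rfl fun F _ => Finset.sum_congr rfl fun G _ => ?_
  rw [mixedSphericalNormals_right_full, faceDet_right_full]
  ring

theorem mixedMeasureTwo_apply_prod_left_full (f : Set (Space d) → ℝ) (m : ℕ) (P Q : Polytope d)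
    {A B : Set (Space d)} (hA : MeasurableSet A) (hB : MeasurableSet B) :
    mixedMeasureTwo f d m P Q (A ×ˢ B) = volume.real (P.carrier ∩ A) *
      ∑ G : Face Q m, f (sphericalNormals Q.carrier G.carrier) * G.measure.real B := by
  rw [mixedMeasureTwo_apply_prod f d m P Q hA hB, ← sum_measureReal_full, Finset.sum_mul_sum]
  refine Finset.sum_congr rfl fun F _ => Finset.sum_congr rfl fun G _ => ?_
  rw [mixedSphericalNormals_left_full, faceDet_left_full]
  ring

theorem mixedMeasure_pair (f : Set (Space d) → ℝ) (m m' : ℕ) (P Q : Polytope d)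
    {A B : Set (Space d)} (hA : MeasurableSet A) (hB : MeasurableSet B) :
    mixedMeasure f ![m, m'] ![P, Q] (univ.pi ![A, B]) = mixedMeasureTwo f m m' P Q (A ×ˢ B) := by
  rw [mixedMeasureTwo_apply_prod f m m' P Q hA hB, mixedMeasure,
    sum_smul_toSignedMeasure_apply _ _ (MeasurableSet.univ_pi (Fin.forall_fin_two.2 ⟨hA, hB⟩)),
    ← (piFinTwoEquiv fun i => Face (![P, Q] i) (![m, m'] i)).symm.sum_comp]
  erw [Fintype.sum_prod_type]
  refine Finset.sum_congr rfl fun F _ => Finset.sum_congr rfl fun G _ => ?_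
  rw [measureReal_def, Measure.pi_pi, Fin.prod_univ_two, ENNReal.toReal_mul]
  have h1 : (fun i => (![P, Q] i).carrier) = ![P.carrier, Q.carrier] :=
    funext (Fin.forall_fin_two.2 ⟨rfl, rfl⟩)
  have h2 : (fun i => ((piFinTwoEquiv fun i =>
      Face (![P, Q] i) (![m, m'] i)).symm (F, G) i).carrier) = ![F.carrier, G.carrier] :=
    funext (Fin.forall_fin_two.2 ⟨rfl, rfl⟩)
  rw [h1, h2]
  rfl

/-- A pair is determined by its first entry, since the sum is d + j; that entry is at most d, so the
natural subtraction is exact. -/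
theorem sum_degreeTuples_two {j : ℕ} (g : (Fin 2 → ℕ) → ℝ) :
    ∑ m ∈ degreeTuples d 2 j, g m = ∑ m ∈ Finset.Icc j d, g ![m, d - m + j] := by
  have h : ∀ m ∈ degreeTuples d 2 j, ![m 0, d - m 0 + j] = m := by
    intro m hm
    obtain ⟨h1, h2⟩ := mem_degreeTuples.1 hm
    rw [Fin.sum_univ_two] at h2
    have := h1 0
    refine funext (Fin.forall_fin_two.2 ⟨rfl, ?_⟩)
    change d - m 0 + j = m 1
    omega
  refine Finset.sum_nbij' (fun m => m 0) (fun m => ![m, d - m + j]) ?_ ?_ h ?_ ?_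
  · intro m hm
    exact Finset.mem_Icc.2 ((mem_degreeTuples.1 hm).1 0)
  · intro m hm
    rw [Finset.mem_Icc] at hm
    rw [mem_degreeTuples, Fin.sum_univ_two, Fin.forall_fin_two]
    change ((j ≤ m ∧ m ≤ d) ∧ j ≤ d - m + j ∧ d - m + j ≤ d) ∧ m + (d - m + j) = _
    omega
  · exact fun _ _ => rfl
  · intro m hm
    rw [h m hm]

/-- The translative integral formula for two polytopes. -/
theorem integral_evalSet_inter_translate {j : ℕ}
    {Ψ : Polytope d → SignedMeasure (Space d)} {f : Set (Space d) → ℝ}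
    (hΨ : ∀ P : Polytope d,
      Ψ P = ∑ F : Face P j, f (sphericalNormals P F) • F.measure.toSignedMeasure)
    (P Q : Polytope d) {A B : Set (Space d)} (hA : MeasurableSet A) (hB : MeasurableSet B) :
    Integrable (fun x : Space d =>
      evalSet Ψ (P.carrier ∩ (fun y => y + x) '' Q.carrier) (A ∩ (fun y => y + x) '' B)) ∧
    ∫ x : Space d,
      evalSet Ψ (P.carrier ∩ (fun y => y + x) '' Q.carrier) (A ∩ (fun y => y + x) '' B) =
      ∑ m ∈ Finset.Icc j d, mixedMeasureTwo f m (d - m + j) P Q (A ×ˢ B) := by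
  obtain ⟨h1, h2⟩ := integral_evalSet_interTranslates hΨ ![P, Q] (A := ![A, B])
    (Fin.forall_fin_two.2 ⟨hA, hB⟩)
  have hI : ∀ (K L : Set (Space d)) (x : Fin 1 → Space d),
      interTranslates ![K, L] x = K ∩ (fun y => y + x 0) '' L := by
    intro K L x
    ext p
    simp only [interTranslates, mem_inter_iff, mem_iInter, Fin.forall_fin_one]
    rfl
  rw [show (fun i => (![P, Q] i).carrier) = ![P.carrier, Q.carrier] from
      funext (Fin.forall_fin_two.2 ⟨rfl, rfl⟩)] at h1 h2
  simp only [hI] at h1 h2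
  -- One translation vector is a function on `Fin 1`; this identification preserves volume.
  have hmp := volume_preserving_funUnique (Fin 1) (Space d)
  rw [sum_degreeTuples_two] at h2
  simp only [mixedMeasure_pair f _ _ P Q hA hB] at h2
  rw [← h2]
  exact ⟨(hmp.integrable_comp_emb (MeasurableEquiv.measurableEmbedding _)).1 h1,
    (hmp.integral_comp' (fun x : Space d =>
      evalSet Ψ (P.carrier ∩ (fun y => y + x) '' Q.carrier) (A ∩ (fun y => y + x) '' B))).symm⟩

end

end LocalFunctional

end

theorem theorem5p1 (d : ℕ) (φ : Polytope d → ℝ) (Φ : Polytope d → SignedMeasure (Space d))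
    (hΦ : IsLocalExtension φ Φ) :
    -- existence of the homogeneous parts and of the associated functions
    (∃ (Φh : ℕ → Polytope d → SignedMeasure (Space d)) (f : ℕ → Set (Space d) → ℝ),
      IsHomogeneousDecomposition Φ Φh ∧ IsAssociated Φh f) ∧
    -- their uniqueness
    (∀ Φh Φh' : ℕ → Polytope d → SignedMeasure (Space d),
      IsHomogeneousDecomposition Φ Φh → IsHomogeneousDecomposition Φ Φh' →
      ∀ j ≤ d, Φh j = Φh' j) ∧
    (∀ (Φh : ℕ → Polytope d → SignedMeasure (Space d)) (f f' : ℕ → Set (Space d) → ℝ),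
      IsAssociated Φh f → IsAssociated Φh f' → ∀ j ≤ d, ∀ (P : Polytope d) (F : Face P j),
        f j (sphericalNormals P F) = f' j (sphericalNormals P F)) ∧
    ∀ (Φh : ℕ → Polytope d → SignedMeasure (Space d)) (f : ℕ → Set (Space d) → ℝ),
      IsHomogeneousDecomposition Φ Φh → IsAssociated Φh f → ∀ j ≤ d,
      -- the translative integral formula for two polytopes
      (∀ (P Q : Polytope d) (A B : Set (Space d)), MeasurableSet A → MeasurableSet B →
        Integrable (fun x : Space d =>
          evalSet (Φh j) ((P : Set (Space d)) ∩ (fun y => y + x) '' (Q : Set (Space d)))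
            (A ∩ (fun y => y + x) '' B)) ∧
        ∫ x : Space d,
          evalSet (Φh j) ((P : Set (Space d)) ∩ (fun y => y + x) '' (Q : Set (Space d)))
            (A ∩ (fun y => y + x) '' B) =
          ∑ m ∈ Finset.Icc j d, mixedMeasureTwo (f j) m (d - m + j) P Q (A ×ˢ B) ∧
        mixedMeasureTwo (f j) j d P Q (A ×ˢ B) =
          Φh j P A * volume.real ((Q : Set (Space d)) ∩ B) ∧
        mixedMeasureTwo (f j) d j P Q (A ×ˢ B) =
          volume.real ((P : Set (Space d)) ∩ A) * Φh j Q B) ∧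
      -- the iterated formula for `k = n + 1 ≥ 2` polytopes
      (∀ (n : ℕ), 1 ≤ n → ∀ (P : Fin (n + 1) → Polytope d) (A : Fin (n + 1) → Set (Space d)),
        (∀ i, MeasurableSet (A i)) →
        Integrable (fun x : Fin n → Space d =>
          evalSet (Φh j) (interTranslates (fun i => (P i : Set (Space d))) x)
            (interTranslates A x)) ∧
        ∫ x : Fin n → Space d,
          evalSet (Φh j) (interTranslates (fun i => (P i : Set (Space d))) x)
            (interTranslates A x) =
          ∑ m ∈ degreeTuples d (n + 1) j, mixedMeasure (f j) m P (univ.pi A)) ∧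
      -- homogeneity of degree `m i` of the mixed measures in the `i`-th polytope
      (∀ k : ℕ, 2 ≤ k → ∀ m ∈ degreeTuples d k j, ∀ (P : Fin k → Polytope d) (i : Fin k) (α : ℝ)
        (S : Set (Fin k → Space d)), 0 < α → MeasurableSet S →
        mixedMeasure (f j) m (Function.update P i ((P i).dilate α))
            ((fun z => Function.update z i (α • z i)) '' S) =
          α ^ m i * mixedMeasure (f j) m P S) := by
  refine ⟨⟨homogeneousPart Φ, assocFun Φ, hΦ.isHomogeneousDecomposition,
    isAssociated_homogeneousPart Φ⟩, fun _ _ h h' _ hj => h.unique h' hj,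
    fun _ _ _ h h' _ hj P F => h.unique h' hj P F, ?_⟩
  intro Φh f _ hf j hj
  have hΨ := hf j hj
  have happly : ∀ (P : Polytope d) (A : Set (Space d)), MeasurableSet A → Φh j P A =
      ∑ F : Face P j, f j (sphericalNormals P.carrier F.carrier) * F.measure.real A := by
    intro P A hA
    rw [hΨ P, sum_smul_toSignedMeasure_apply _ _ hA]
  refine ⟨fun P Q A B hA hB => ?_, fun n _ P A hA => integral_evalSet_interTranslates hΨ P hA,
    fun k _ m _ P i α S hα hS => mixedMeasure_update_dilate (f j) m P i hα hS⟩
  obtain ⟨h1, h2⟩ := integral_evalSet_inter_translate hΨ P Q hA hB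
  refine ⟨h1, h2, ?_, ?_⟩
  · rw [mixedMeasureTwo_apply_prod_right_full (f j) j P Q hA hB, happly P A hA]
  · rw [mixedMeasureTwo_apply_prod_left_full (f j) j P Q hA hB, happly Q B hB]
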